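/- Let $F/K$ be a finite Galois extension of number fields with Galois group $G$, let $d=[K:\mathbb{Q}]$, let $S_\infty$ be the set of Archimedean places of $F$, let $X_{S_\infty}$ be the kernel of the augmentation map $\mathbb{Z}[S_\infty]\to\mathbb{Z}$, let $\mu_F$ be the group of roots of unity in $F$, and let $\mathrm{Cl}_F$ be the ideal class group of $\mathcal{O}_F$. Let $\mathrm{G}_0(\mathbb{Z}[G])$ be the Grothendieck group of the category of finitely generated $\mathbb{Z}[G]$-modules (one generator $[M]$ for each such module, one relation $[M]=[L]+[N]$ for each short exact sequence $0\to L\to M\to N\to 0$), and let $\sigma$ be the automorphism of $\mathrm{G}_0(\mathbb{Z}[G])$ with $\sigma[M]=[\mathrm{Hom}_{\mathbb{Z}}(M,\mathbb{Z})]$ for every finitely generated $\mathbb{Z}$-free $\mathbb{Z}[G]$-module $M$, where $(gf)(m)=f(g^{-1}m)$. Let $\mathrm{Id}_F$ be the (discrete) group of fractional ideals of $\mathcal{O}_F$, let $F_{\mathbb{R}}=F\otimes_{\mathbb{Q}}\mathbb{R}=\prod_{w\in S_\infty}F_w$, and form the fibre product $\mathrm{Id}_F\times_{\mathbb{R}_{>0}}F_{\mathbb{R}}^\times$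 with respect to the ideal norm and the absolute value $|\mathrm{Nm}|$ of the norm of the $\mathbb{R}$-algebra $F_{\mathbb{R}}$. The oriented Arakelov class group $\widetilde{\mathrm{Pic}}{}^0_F$ is the cokernel of $F^\times\to \mathrm{Id}_F\times_{\mathbb{R}_{>0}}F_{\mathbb{R}}^\times$, $\alpha\mapsto(\alpha\mathcal{O}_F,\alpha)$, and the Arakelov class group $\mathrm{Pic}^0_F$ is the quotient of $\widetilde{\mathrm{Pic}}{}^0_F$ by the image of $\{1\}\times C$, where $C=\prod_{w}C_w$ is the maximal compact subgroup of $F_{\mathbb{R}}^\times$ ($C_w=\{\pm1\}$ if $w$ is real, and $C_w$ is the circle group in $F_w$ if $w$ is complex). Let $\widetilde{\mathrm{Ar}}_F=\mathrm{Hom}_{\mathrm{cts}}(\widetilde{\mathrm{Pic}}{}^0_F,\mathbb{R}/\mathbb{Z})$ and $\mathrm{Ar}_F=\mathrm{Hom}_{\mathrm{cts}}(\mathrm{Pic}^0_F,\mathbb{R}/\mathbb{Z})$ be the Pontryagin duals, with $G$ acting by $(g\chi)(x)=\chi(g^{-1}x)$. Then $\widetilde{\mathrm{Ar}}_F$ and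 $\mathrm{Ar}_F$ are finitely generated $\mathbb{Z}[G]$-modules. Put $$\Psi(F/K)=[\mathcal{O}_F^\times]-[X_{S_\infty}]-[\mathrm{Cl}_F]\in \mathrm{G}_0(\mathbb{Z}[G]).$$ Then the two equalities $$\text{(a)}\quad [\widetilde{\mathrm{Ar}}_F]=d\cdot[\mathbb{Z}[G]]-[\mathbb{Z}],\qquad \text{(b)}\quad [\mathrm{Ar}_F]=[\mathbb{Z}[S_\infty]]-[\mathbb{Z}]-\sigma[\mu_F]$$ both hold in $\mathrm{G}_0(\mathbb{Z}[G])$ if and only if $\Psi(F/K)=0$. Moreover, $\Psi(F/K)$ is always a torsion element of $\mathrm{G}_0(\mathbb{Z}[G])$. -/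

import Mathlib

open scoped NumberField nonZeroDivisors TensorProduct

universe u v

noncomputable section

/-! ### The Grothendieck group of finitely generated modules -/

/-- The subgroup of relations `[B] - [A] - [C]`, one for each short exact sequence
`0 → A → B → C → 0` of finitely generated `Λ`-modules. -/
def G0.relations (Λ : Type u) [Ring Λ] : AddSubgroup (FreeAbelianGroup (FGModuleCat.{u} Λ)) :=
  AddSubgroup.closure
    {x | ∃ (A B C : FGModuleCat.{u} Λ) (f : A →ₗ[Λ] B) (g : B →ₗ[Λ] C),
      Function.Injective f ∧ Function.Exact f g ∧ Function.Surjective g ∧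
      x = FreeAbelianGroup.of B - FreeAbelianGroup.of A - FreeAbelianGroup.of C}

/-- The Grothendieck group `G₀(Λ)` of the category of finitely generated `Λ`-modules. -/
def G0 (Λ : Type u) [Ring Λ] : Type (u + 1) :=
  FreeAbelianGroup (FGModuleCat.{u} Λ) ⧸ G0.relations Λ

instance (Λ : Type u) [Ring Λ] : AddCommGroup (G0 Λ) :=
  inferInstanceAs (AddCommGroup (FreeAbelianGroup (FGModuleCat.{u} Λ) ⧸ G0.relations Λ))

namespace G0

section Basic

variable {Λ : Type u} [Ring Λ]

variable (Λ) in
/-- The class `[M]` in `G₀(Λ)` of a finitely generated `Λ`-module `M`. -/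
def cls (M : Type u) [AddCommGroup M] [Module Λ M] [Module.Finite Λ M] : G0 Λ :=
  QuotientAddGroup.mk (FreeAbelianGroup.of (FGModuleCat.of Λ M))

theorem cls_of_exact {A B C : Type u} [AddCommGroup A] [AddCommGroup B] [AddCommGroup C]
    [Module Λ A] [Module Λ B] [Module Λ C]
    [Module.Finite Λ A] [Module.Finite Λ B] [Module.Finite Λ C]
    (f : A →ₗ[Λ] B) (g : B →ₗ[Λ] C) (hf : Function.Injective f) (hfg : Function.Exact f g)
    (hg : Function.Surjective g) : cls Λ B = cls Λ A + cls Λ C := by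
  have h : FreeAbelianGroup.of (FGModuleCat.of Λ B) - FreeAbelianGroup.of (FGModuleCat.of Λ A)
      - FreeAbelianGroup.of (FGModuleCat.of Λ C) ∈ relations Λ :=
    AddSubgroup.subset_closure ⟨_, _, _, f, g, hf, hfg, hg, rfl⟩
  have h2 := (QuotientAddGroup.eq_zero_iff _).2 h
  rw [QuotientAddGroup.mk_sub, QuotientAddGroup.mk_sub, sub_sub, sub_eq_zero] at h2
  exact h2

/-- An additive function on finitely generated modules induces a homomorphism on `G₀(Λ)`. -/
def lift {T : Type*} [AddCommGroup T] (φ : FGModuleCat.{u} Λ → T)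
    (h : ∀ (A B C : FGModuleCat.{u} Λ) (f : A →ₗ[Λ] B) (g : B →ₗ[Λ] C),
      Function.Injective f → Function.Exact f g → Function.Surjective g →
      φ B = φ A + φ C) : G0 Λ →+ T :=
  QuotientAddGroup.lift _ (FreeAbelianGroup.lift φ) (by
    rw [relations, AddSubgroup.closure_le]
    rintro x ⟨A, B, C, f, g, hf, hfg, hg, rfl⟩
    have := h A B C f g hf hfg hg
    simp [this])

theorem lift_cls {T : Type*} [AddCommGroup T] (φ : FGModuleCat.{u} Λ → T) (h)
    (M : Type u) [AddCommGroup M] [Module Λ M] [Module.Finite Λ M] :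
    lift φ h (cls Λ M) = φ (FGModuleCat.of Λ M) :=
  FreeAbelianGroup.lift_apply_of φ _

end Basic

end G0

/-! ### Modules over integral group rings -/

/-- The class in `G₀(ℤ[G])` of an abelian group with a linear action of `G`, seen as
a `ℤ[G]`-module. -/
def G0.clsRep {G : Type u} [Group G] {M : Type u} [AddCommGroup M] (ρ : Representation ℤ G M)
    [Module.Finite (MonoidAlgebra ℤ G) ρ.asModule] : G0 (MonoidAlgebra ℤ G) :=
  G0.cls (MonoidAlgebra ℤ G) ρ.asModule

namespace IntegralDual

variable {G : Type u} [Group G] [Finite G]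

instance finite_asModule {M : Type*} [AddCommGroup M] (ρ : Representation ℤ G M)
    [Module.Finite ℤ M] : Module.Finite (MonoidAlgebra ℤ G) ρ.asModule := by
  exact @Module.Finite.of_restrictScalars_finite ℤ (MonoidAlgebra ℤ G) ρ.asModule _ _ _
    (Representation.instModuleAsModule ρ) _ _ _ (Module.Finite.equiv ρ.asModuleEquiv.symm)

instance isNoetherianRing : IsNoetherianRing (MonoidAlgebra ℤ G) :=
  isNoetherian_of_tower ℤ inferInstance

theorem finite_int (M : Type*) [AddCommGroup M] [Module (MonoidAlgebra ℤ G) M]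
    [Module.Finite (MonoidAlgebra ℤ G) M] : Module.Finite ℤ M :=
  Module.Finite.trans (MonoidAlgebra ℤ G) M

/-- `M* = Hom_ℤ(M, ℤ)`, with `G` acting by `(g • f) m = f (g⁻¹ • m)`. -/
abbrev dualRep (G : Type u) [Group G] (M : Type*) [AddCommGroup M] [Module (MonoidAlgebra ℤ G) M] :
    Representation ℤ G (Module.Dual ℤ M) :=
  (Representation.ofModule' (k := ℤ) (G := G) M).dual

/-- The `ℤ[G]`-module `M*`. -/
abbrev Dual (G : Type u) [Group G] (M : Type*) [AddCommGroup M] [Module (MonoidAlgebra ℤ G) M] :=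
  (dualRep G M).asModule

instance finite_dual (M : Type*) [AddCommGroup M] [Module (MonoidAlgebra ℤ G) M]
    [Module.Finite (MonoidAlgebra ℤ G) M] [Module.Free ℤ M] :
    Module.Finite (MonoidAlgebra ℤ G) (Dual G M) :=
  have := finite_int (G := G) M
  finite_asModule _

/-- The transpose of a homomorphism of `ℤ[G]`-modules. -/
def transpose {G : Type u} [Group G] {M N : Type*} [AddCommGroup M] [AddCommGroup N]
    [Module (MonoidAlgebra ℤ G) M] [Module (MonoidAlgebra ℤ G) N]
    (f : M →ₗ[MonoidAlgebra ℤ G] N) : Dual G N →ₗ[MonoidAlgebra ℤ G] Dual G M :=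
  Representation.IntertwiningMap.equivLinearMapAsModule (dualRep G N) (dualRep G M)
    { toLinearMap := (f.restrictScalars ℤ).dualMap
      isIntertwining' := fun g => by
        ext φ m
        simp [Representation.ofModule', Module.Dual.transpose_apply] }

theorem transpose_apply {G : Type u} [Group G] {M N : Type*} [AddCommGroup M] [AddCommGroup N]
    [Module (MonoidAlgebra ℤ G) M] [Module (MonoidAlgebra ℤ G) N]
    (f : M →ₗ[MonoidAlgebra ℤ G] N) (φ : Module.Dual ℤ N) (m : M) :
    DFunLike.coe (F := Module.Dual ℤ M) (transpose f φ) m = φ (f m) := rfl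

theorem cls_dual_of_exact {A B C : Type u} [AddCommGroup A] [AddCommGroup B] [AddCommGroup C]
    [Module (MonoidAlgebra ℤ G) A] [Module (MonoidAlgebra ℤ G) B] [Module (MonoidAlgebra ℤ G) C]
    [Module.Finite (MonoidAlgebra ℤ G) A] [Module.Finite (MonoidAlgebra ℤ G) B]
    [Module.Finite (MonoidAlgebra ℤ G) C]
    [Module.Free ℤ A] [Module.Free ℤ B] [Module.Free ℤ C]
    (f : A →ₗ[MonoidAlgebra ℤ G] B) (g : B →ₗ[MonoidAlgebra ℤ G] C)
    (hf : Function.Injective f) (hfg : Function.Exact f g) (hg : Function.Surjective g) :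
    G0.clsRep (dualRep G B) = G0.clsRep (dualRep G A) + G0.clsRep (dualRep G C) := by
  rw [add_comm]
  obtain ⟨s, hs⟩ := Module.projective_lifting_property (g.restrictScalars ℤ)
    (LinearMap.id : C →ₗ[ℤ] C) hg
  have hs' : ∀ c, g (s c) = c := fun c => LinearMap.congr_fun hs c
  refine G0.cls_of_exact (transpose g) (transpose f) ?_ ?_ ?_
  · exact LinearMap.dualMap_injective_of_surjective (f := g.restrictScalars ℤ) hg
  · intro φ
    constructor
    · intro h
      have h' : ∀ a, (show Module.Dual ℤ B from φ) (f a) = 0 := fun a =>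
        LinearMap.congr_fun (show (f.restrictScalars ℤ).dualMap (show Module.Dual ℤ B from φ) = 0
          from h) a
      refine ⟨(show Module.Dual ℤ B from φ) ∘ₗ s, ?_⟩
      refine LinearMap.ext fun b => ?_
      change (show Module.Dual ℤ B from φ) (s (g b)) = (show Module.Dual ℤ B from φ) b
      obtain ⟨a, ha⟩ := (hfg (s (g b) - b)).1 (by rw [map_sub, hs', sub_self])
      rw [← sub_eq_zero, ← map_sub, ← ha, h']
    · rintro ⟨ψ, rfl⟩
      refine LinearMap.ext fun a => ?_
      change (show Module.Dual ℤ C from ψ) (g (f a)) = 0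
      rw [hfg.apply_apply_eq_zero, map_zero]
  · intro φ
    have hr : ∀ b : B, ∃ a : A, f a = b - s (g b) := fun b =>
      (hfg _).1 (by rw [map_sub, hs', sub_self])
    choose r hr using hr
    let rl : B →ₗ[ℤ] A :=
      { toFun := r
        map_add' := fun x y => hf (by rw [map_add, hr, hr, hr]; simp only [map_add]; abel)
        map_smul' := fun n x => hf (by
          rw [RingHom.id_apply, map_zsmul, hr, hr, map_zsmul, map_zsmul, smul_sub]) }
    refine ⟨(show Module.Dual ℤ A from φ) ∘ₗ rl, LinearMap.ext fun a => ?_⟩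
    change (show Module.Dual ℤ A from φ) (r (f a)) = (show Module.Dual ℤ A from φ) a
    congr 1
    apply hf
    rw [hr, hfg.apply_apply_eq_zero, map_zero, sub_zero]

/-- A lattice is free over `ℤ`, and so is every submodule of it. -/
theorem free_submodule {P : Type*} [AddCommGroup P] [Module (MonoidAlgebra ℤ G) P]
    [Module.Finite (MonoidAlgebra ℤ G) P] [Module.Free ℤ P]
    (N : Submodule (MonoidAlgebra ℤ G) P) : Module.Free ℤ N :=
  have := finite_int (G := G) P
  inferInstanceAs (Module.Free ℤ (N.restrictScalars ℤ))

/-- The class `[P*] - [(ker p)*]` attached to a homomorphism `p` from a lattice `P`. -/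
def presentationClass {P M : Type u} [AddCommGroup P] [AddCommGroup M]
    [Module (MonoidAlgebra ℤ G) P] [Module (MonoidAlgebra ℤ G) M]
    [Module.Finite (MonoidAlgebra ℤ G) P] [Module.Free ℤ P]
    (p : P →ₗ[MonoidAlgebra ℤ G] M) : G0 (MonoidAlgebra ℤ G) :=
  have := free_submodule (LinearMap.ker p)
  G0.clsRep (dualRep G P) - G0.clsRep (dualRep G (LinearMap.ker p))

theorem presentationClass_eq {P K M : Type u} [AddCommGroup P] [AddCommGroup K] [AddCommGroup M]
    [Module (MonoidAlgebra ℤ G) P] [Module (MonoidAlgebra ℤ G) K] [Module (MonoidAlgebra ℤ G) M]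
    [Module.Finite (MonoidAlgebra ℤ G) P] [Module.Free ℤ P]
    [Module.Finite (MonoidAlgebra ℤ G) K] [Module.Free ℤ K]
    (p : P →ₗ[MonoidAlgebra ℤ G] M) (i : K →ₗ[MonoidAlgebra ℤ G] P)
    (hi : Function.Injective i) (hip : Function.Exact i p) :
    presentationClass p = G0.clsRep (dualRep G P) - G0.clsRep (dualRep G K) := by
  have := free_submodule (LinearMap.ker p)
  have h0 : ∀ k, p (i k) = 0 := hip.apply_apply_eq_zero
  have e := cls_dual_of_exact (A := PUnit.{u + 1}) (0 : _ →ₗ[MonoidAlgebra ℤ G] K)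
    (i.codRestrict (LinearMap.ker p) h0) (fun _ _ _ => rfl)
    (by
      intro k
      constructor
      · intro h
        refine ⟨0, ?_⟩
        have : i k = 0 := congrArg Subtype.val h
        rw [map_zero]; exact (hi (this.trans (map_zero i).symm)).symm
      · rintro ⟨x, rfl⟩; simp)
    (by
      rintro ⟨x, hx⟩
      obtain ⟨k, rfl⟩ := (hip x).1 hx
      exact ⟨k, rfl⟩)
  have z := cls_dual_of_exact (A := PUnit.{u + 1}) (B := PUnit.{u + 1}) (C := PUnit.{u + 1})
    (LinearMap.id : _ →ₗ[MonoidAlgebra ℤ G] _) LinearMap.id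
    (fun _ _ _ => rfl) (fun _ => ⟨fun _ => ⟨0, rfl⟩, fun _ => rfl⟩) (fun x => ⟨x, rfl⟩)
  rw [left_eq_add] at z
  rw [z, zero_add] at e
  rw [presentationClass, e]

/-- Independence of the presentation. -/
theorem presentationClass_indep {P Q M : Type u} [AddCommGroup P] [AddCommGroup Q]
    [AddCommGroup M]
    [Module (MonoidAlgebra ℤ G) P] [Module (MonoidAlgebra ℤ G) Q] [Module (MonoidAlgebra ℤ G) M]
    [Module.Finite (MonoidAlgebra ℤ G) P] [Module.Free ℤ P]
    [Module.Finite (MonoidAlgebra ℤ G) Q] [Module.Free ℤ Q]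
    (p : P →ₗ[MonoidAlgebra ℤ G] M) (q : Q →ₗ[MonoidAlgebra ℤ G] M)
    (hp : Function.Surjective p) (hq : Function.Surjective q) :
    presentationClass p = presentationClass q := by
  let π : P × Q →ₗ[MonoidAlgebra ℤ G] M :=
    p ∘ₗ LinearMap.fst _ P Q - q ∘ₗ LinearMap.snd _ P Q
  have hπ : ∀ x, π x = p x.1 - q x.2 := fun x => rfl
  have := free_submodule (LinearMap.ker p)
  have := free_submodule (LinearMap.ker q)
  have := free_submodule (LinearMap.ker π)
  have h1 := cls_dual_of_exact
    (((LinearMap.inr (MonoidAlgebra ℤ G) P Q) ∘ₗ (LinearMap.ker q).subtype).codRestrict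
      (LinearMap.ker π) (by rintro ⟨x, hx⟩; simpa [hπ] using hx))
    ((LinearMap.fst (MonoidAlgebra ℤ G) P Q) ∘ₗ (LinearMap.ker π).subtype)
    (by
      rintro x y h
      have := congrArg (fun z => (Subtype.val z).2) h
      exact Subtype.ext this)
    (by
      rintro ⟨⟨x, y⟩, h⟩
      constructor
      · rintro rfl
        refine ⟨⟨y, ?_⟩, rfl⟩
        simpa [hπ] using h
      · rintro ⟨z, hz⟩
        exact (congrArg (fun z => (Subtype.val z).1) hz).symm)
    (by
      intro x
      obtain ⟨y, hy⟩ := hq (p x)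
      exact ⟨⟨(x, y), by simp [hπ, hy]⟩, rfl⟩)
  have h2 := cls_dual_of_exact
    (((LinearMap.inl (MonoidAlgebra ℤ G) P Q) ∘ₗ (LinearMap.ker p).subtype).codRestrict
      (LinearMap.ker π) (by rintro ⟨x, hx⟩; simpa [hπ] using hx))
    ((LinearMap.snd (MonoidAlgebra ℤ G) P Q) ∘ₗ (LinearMap.ker π).subtype)
    (by
      rintro x y h
      have := congrArg (fun z => (Subtype.val z).1) h
      exact Subtype.ext this)
    (by
      rintro ⟨⟨x, y⟩, h⟩
      constructor
      · rintro rfl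
        refine ⟨⟨x, ?_⟩, rfl⟩
        simpa [hπ] using h
      · rintro ⟨z, hz⟩
        exact (congrArg (fun z => (Subtype.val z).2) hz).symm)
    (by
      intro y
      obtain ⟨x, hx⟩ := hp (q y)
      exact ⟨⟨(x, y), by simp [hπ, hx]⟩, rfl⟩)
  rw [presentationClass, presentationClass, sub_eq_sub_iff_add_eq_add, add_comm, ← h1, h2, add_comm]

variable (G) in
/-- The value of `σ` on a finitely generated module `M`, computed from a presentation of `M`
by lattices: `[(ℤ[G]ⁿ)*] - [K*]`, where `K` is the kernel of a surjection `ℤ[G]ⁿ → M`. -/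
def sigmaFun (M : Type u) [AddCommGroup M] [Module (MonoidAlgebra ℤ G) M]
    [Module.Finite (MonoidAlgebra ℤ G) M] : G0 (MonoidAlgebra ℤ G) :=
  presentationClass (Module.Finite.exists_fin' (MonoidAlgebra ℤ G) M).choose_spec.choose

theorem sigmaFun_eq {P M : Type u} [AddCommGroup P] [AddCommGroup M]
    [Module (MonoidAlgebra ℤ G) P] [Module (MonoidAlgebra ℤ G) M]
    [Module.Finite (MonoidAlgebra ℤ G) P] [Module.Free ℤ P] [Module.Finite (MonoidAlgebra ℤ G) M]
    (p : P →ₗ[MonoidAlgebra ℤ G] M) (hp : Function.Surjective p) :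
    sigmaFun G M = presentationClass p :=
  presentationClass_indep _ _
    (Module.Finite.exists_fin' (MonoidAlgebra ℤ G) M).choose_spec.choose_spec hp

theorem sigmaFun_add {A B C : Type u} [AddCommGroup A] [AddCommGroup B] [AddCommGroup C]
    [Module (MonoidAlgebra ℤ G) A] [Module (MonoidAlgebra ℤ G) B] [Module (MonoidAlgebra ℤ G) C]
    [Module.Finite (MonoidAlgebra ℤ G) A] [Module.Finite (MonoidAlgebra ℤ G) B]
    [Module.Finite (MonoidAlgebra ℤ G) C]
    (f : A →ₗ[MonoidAlgebra ℤ G] B) (g : B →ₗ[MonoidAlgebra ℤ G] C)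
    (hf : Function.Injective f) (hfg : Function.Exact f g) (hg : Function.Surjective g) :
    sigmaFun G B = sigmaFun G A + sigmaFun G C := by
  obtain ⟨n, p, hp⟩ := Module.Finite.exists_fin' (MonoidAlgebra ℤ G) B
  have := free_submodule (LinearMap.ker p)
  have := free_submodule (LinearMap.ker (g ∘ₗ p))
  have hK : ∀ x : LinearMap.ker (g ∘ₗ p), ∃ a, f a = p x := fun x => (hfg _).1 x.2
  choose r hr using hK
  let q : LinearMap.ker (g ∘ₗ p) →ₗ[MonoidAlgebra ℤ G] A :=
    { toFun := r
      map_add' := fun x y => hf (by simp [hr])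
      map_smul' := fun c x => hf (by simp [hr]) }
  have hq : ∀ x, f (q x) = p x := hr
  rw [sigmaFun_eq p hp, sigmaFun_eq (g ∘ₗ p) (hg.comp hp), sigmaFun_eq q (by
    intro a
    obtain ⟨x, hx⟩ := hp (f a)
    exact ⟨⟨x, by simp [hx, hfg.apply_apply_eq_zero]⟩, hf (by rw [hq, hx])⟩)]
  rw [presentationClass_eq q
    (Submodule.inclusion (LinearMap.ker_le_ker_comp p g))
    (Submodule.inclusion_injective _) (by
      rintro ⟨x, hx⟩
      constructor
      · intro h
        have : p x = 0 := by rw [← hq ⟨x, hx⟩, h, map_zero]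
        exact ⟨⟨x, this⟩, rfl⟩
      · rintro ⟨⟨y, hy⟩, h⟩
        apply hf
        rw [hq, map_zero, ← h]
        exact hy)]
  simp only [presentationClass]
  abel

end IntegralDual

/-- The endomorphism `σ` of `G₀(ℤ[G])` induced by the duality `M ↦ M*` on `ℤ[G]`-lattices. It is
characterised by `sigma_lattice`, since every class is a difference of classes of lattices. -/
def G0.sigma (G : Type u) [Group G] [Finite G] :
    G0 (MonoidAlgebra ℤ G) →+ G0 (MonoidAlgebra ℤ G) :=
  G0.lift (fun M => IntegralDual.sigmaFun G M)
    (fun _ _ _ f g hf hfg hg => IntegralDual.sigmaFun_add f g hf hfg hg)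

theorem G0.sigma_lattice {G : Type u} [Group G] [Finite G] (M : Type u) [AddCommGroup M]
    [Module (MonoidAlgebra ℤ G) M] [Module.Finite (MonoidAlgebra ℤ G) M] [Module.Free ℤ M] :
    G0.sigma G (G0.cls (MonoidAlgebra ℤ G) M) = G0.clsRep (IntegralDual.dualRep G M) := by
  rw [G0.sigma, G0.lift_cls]
  change IntegralDual.sigmaFun G M = _
  rw [IntegralDual.sigmaFun_eq (LinearMap.id : M →ₗ[MonoidAlgebra ℤ G] M) Function.surjective_id,
    IntegralDual.presentationClass_eq LinearMap.id (0 : PUnit.{u + 1} →ₗ[MonoidAlgebra ℤ G] M)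
      (fun _ _ _ => rfl)
      (fun x => ⟨fun h => ⟨0, by simpa using h.symm⟩, by rintro ⟨_, rfl⟩; simp⟩)]
  have z := IntegralDual.cls_dual_of_exact (A := PUnit.{u + 1}) (B := PUnit.{u + 1})
    (C := PUnit.{u + 1}) (LinearMap.id : _ →ₗ[MonoidAlgebra ℤ G] _) LinearMap.id
    (fun _ _ _ => rfl) (fun _ => ⟨fun _ => ⟨0, rfl⟩, fun _ => rfl⟩) (fun x => ⟨x, rfl⟩)
  rw [left_eq_add] at z
  rw [z, sub_zero]

/-! ### Group actions on subgroups, quotients, units and duals -/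

section Actions

variable {G A : Type*} [Group G] [CommGroup A] [MulDistribMulAction G A]

/-- The action on a stable subgroup. -/
abbrev subgroupAction (H : Subgroup A) (h : ∀ (g : G), ∀ a ∈ H, g • a ∈ H) :
    MulDistribMulAction G H where
  smul g a := ⟨g • (a : A), h g a a.2⟩
  one_smul a := Subtype.ext (one_smul G (a : A))
  mul_smul g g' a := Subtype.ext (mul_smul g g' (a : A))
  smul_one g := Subtype.ext (smul_one g)
  smul_mul g a b := Subtype.ext (smul_mul' g (a : A) b)

/-- The action on the quotient by a stable subgroup. -/
abbrev quotientAction (H : Subgroup A) (h : ∀ (g : G), ∀ a ∈ H, g • a ∈ H) :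
    MulDistribMulAction G (A ⧸ H) where
  smul g := QuotientGroup.map H H (MulDistribMulAction.toMonoidHom A g) (h g)
  one_smul := by
    rintro ⟨a⟩
    exact congrArg (QuotientGroup.mk (s := H)) (one_smul G a)
  mul_smul g g' := by
    rintro ⟨a⟩
    exact congrArg (QuotientGroup.mk (s := H)) (mul_smul g g' a)
  smul_one g := map_one (QuotientGroup.map H H (MulDistribMulAction.toMonoidHom A g) (h g))
  smul_mul g := map_mul (QuotientGroup.map H H (MulDistribMulAction.toMonoidHom A g) (h g))

/-- The action on the unit group of a monoid with an action of `G`. -/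
abbrev unitsAction (G M : Type*) [Group G] [Monoid M] [MulDistribMulAction G M] :
    MulDistribMulAction G Mˣ where
  smul g := Units.map (MulDistribMulAction.toMonoidHom M g)
  one_smul u := Units.ext (one_smul G (u : M))
  mul_smul g g' u := Units.ext (mul_smul g g' (u : M))
  smul_one g := map_one (Units.map (MulDistribMulAction.toMonoidHom M g))
  smul_mul g := map_mul (Units.map (MulDistribMulAction.toMonoidHom M g))

/-- The Pontryagin dual of a topological abelian group `A` on which `G` acts by continuous
automorphisms, written additively, with `G` acting by `(g χ)(a) = χ(g⁻¹ a)`. -/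
def pontryaginRep (G A : Type*) [Group G] [CommGroup A] [MulDistribMulAction G A]
    [TopologicalSpace A] [ContinuousConstSMul G A] :
    Representation ℤ G (Additive (PontryaginDual A)) where
  toFun g := AddMonoidHom.toIntLinearMap (MonoidHom.toAdditive
    (PontryaginDual.map (A := A) (B := A)
      ⟨MulDistribMulAction.toMonoidHom A g⁻¹, continuous_const_smul g⁻¹⟩).toMonoidHom)
  map_one' := by
    refine LinearMap.ext fun χ => PontryaginDual.ext (A := A) fun a => ?_
    change (show PontryaginDual A from Additive.toMul χ) ((1 : G)⁻¹ • a) =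
      (show PontryaginDual A from Additive.toMul χ) a
    rw [inv_one, one_smul]
  map_mul' g g' := by
    refine LinearMap.ext fun χ => PontryaginDual.ext (A := A) fun a => ?_
    change (show PontryaginDual A from Additive.toMul χ) ((g * g')⁻¹ • a) =
      (show PontryaginDual A from Additive.toMul χ) (g'⁻¹ • g⁻¹ • a)
    rw [mul_inv_rev, mul_smul]

theorem pontryaginRep_apply {G A : Type*} [Group G] [CommGroup A] [MulDistribMulAction G A]
    [TopologicalSpace A] [ContinuousConstSMul G A] (g : G) (χ : PontryaginDual A) (a : A) :
    Additive.toMul (pontryaginRep G A g (Additive.ofMul χ)) a = χ (g⁻¹ • a) := rfl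

end Actions

/-! ### The Arakelov class groups of a number field -/

section Arakelov

variable (K : Type v) (F : Type u) [Field K] [Field F] [NumberField F] [Algebra K F]

instance : MulDistribMulAction Gal(F/K) (𝓞 F)ˣ := unitsAction Gal(F/K) (𝓞 F)

/-- The group `Id_F` of fractional ideals of `𝓞 F`, as a discrete group. -/
def IdealGroup : Type u := (FractionalIdeal (𝓞 F)⁰ F)ˣ

instance : CommGroup (IdealGroup F) := inferInstanceAs (CommGroup (FractionalIdeal (𝓞 F)⁰ F)ˣ)
instance : TopologicalSpace (IdealGroup F) := ⊥
instance : DiscreteTopology (IdealGroup F) := ⟨rfl⟩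

variable {K F} in
/-- The fractional ideal `g(I)`. -/
def galIdeal (g : Gal(F/K)) : FractionalIdeal (𝓞 F)⁰ F ≃+* FractionalIdeal (𝓞 F)⁰ F :=
  FractionalIdeal.ringEquivOfRingEquiv F F (MulSemiringAction.toRingEquiv Gal(F/K) (𝓞 F) g)

variable {K F} in
theorem galFraction_apply (g : Gal(F/K)) (x : F) :
    (IsFractionRing.ringEquivOfRingEquiv (K := F) (L := F)
      (MulSemiringAction.toRingEquiv Gal(F/K) (𝓞 F) g)) x = g x := by
  have : (IsFractionRing.ringEquivOfRingEquiv (K := F) (L := F)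
      (MulSemiringAction.toRingEquiv Gal(F/K) (𝓞 F) g)).toRingHom = (g : F →+* F) := by
    apply IsLocalization.ringHom_ext (𝓞 F)⁰
    ext a
    exact IsFractionRing.ringEquivOfRingEquiv_algebraMap
      (MulSemiringAction.toRingEquiv Gal(F/K) (𝓞 F) g) a
  exact RingHom.congr_fun this x

variable {K F} in
theorem mem_galIdeal (g : Gal(F/K)) (I : FractionalIdeal (𝓞 F)⁰ F) (x : F) :
    x ∈ galIdeal g I ↔ ∃ y ∈ I, g y = x := by
  constructor
  · rintro ⟨y, hy, rfl⟩
    exact ⟨y, hy, (galFraction_apply g y).symm⟩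
  · rintro ⟨y, hy, rfl⟩
    exact ⟨y, hy, galFraction_apply g y⟩

instance : MulDistribMulAction Gal(F/K) (IdealGroup F) where
  smul g := Units.map (galIdeal g).toMonoidHom
  one_smul I := Units.ext (by
    refine SetLike.ext fun x => ?_
    change x ∈ galIdeal 1 I.val ↔ _
    rw [mem_galIdeal]; simp)
  mul_smul g g' I := Units.ext (by
    refine SetLike.ext fun x => ?_
    change x ∈ galIdeal _ I.val ↔ x ∈ galIdeal g (galIdeal g' I.val)
    simp only [mem_galIdeal, AlgEquiv.mul_apply]
    constructor
    · rintro ⟨y, hy, rfl⟩; exact ⟨_, ⟨y, hy, rfl⟩, rfl⟩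
    · rintro ⟨_, ⟨y, hy, rfl⟩, rfl⟩; exact ⟨y, hy, rfl⟩)
  smul_one g := map_one (Units.map (galIdeal g).toMonoidHom)
  smul_mul g := map_mul (Units.map (galIdeal g).toMonoidHom)

instance : ContinuousConstSMul Gal(F/K) (IdealGroup F) where
  continuous_const_smul _ := continuous_of_discreteTopology

/-- The subgroup of principal fractional ideals. -/
def principalIdeals : Subgroup (IdealGroup F) := (toPrincipalIdeal (𝓞 F) F).range

variable {K F} in
theorem smul_toPrincipalIdeal (g : Gal(F/K)) (a : Fˣ) :
    g • (show IdealGroup F from toPrincipalIdeal (𝓞 F) F a) =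
      toPrincipalIdeal (𝓞 F) F (Units.map (g : F →* F) a) := by
  refine Units.ext (SetLike.ext fun x => ?_)
  change x ∈ galIdeal g (toPrincipalIdeal (𝓞 F) F a : FractionalIdeal (𝓞 F)⁰ F) ↔ _
  simp only [mem_galIdeal, coe_toPrincipalIdeal, FractionalIdeal.mem_spanSingleton]
  constructor
  · rintro ⟨_, ⟨z, rfl⟩, rfl⟩
    exact ⟨g • z, by simp [Algebra.smul_def]; rfl⟩
  · rintro ⟨z, rfl⟩
    refine ⟨_, ⟨g⁻¹ • z, rfl⟩, ?_⟩
    rw [Algebra.smul_def, Algebra.smul_def, map_mul]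
    congr 1
    change g (g⁻¹ (z : F)) = z
    rw [← AlgEquiv.mul_apply, mul_inv_cancel, AlgEquiv.one_apply]

/-- The ideal class group `Cl_F`. -/
def Cl : Type u := IdealGroup F ⧸ principalIdeals F

instance : CommGroup (Cl F) := inferInstanceAs (CommGroup (IdealGroup F ⧸ principalIdeals F))

instance : MulDistribMulAction Gal(F/K) (Cl F) :=
  quotientAction (principalIdeals F) (by
    rintro g _ ⟨a, rfl⟩
    exact ⟨Units.map (g : F →* F) a, (smul_toPrincipalIdeal g a).symm⟩)

instance : Finite (Cl F) :=
  Finite.of_equiv (ClassGroup (𝓞 F)) (ClassGroup.equiv F).toEquiv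

/-- The étale `ℝ`-algebra `F_ℝ = F ⊗ ℝ`, with its topology as a finite-dimensional real
vector space. -/
def RealAlgebra : Type u := ℝ ⊗[ℚ] F

instance : CommRing (RealAlgebra F) := inferInstanceAs (CommRing (ℝ ⊗[ℚ] F))
instance : Algebra ℝ (RealAlgebra F) := inferInstanceAs (Algebra ℝ (ℝ ⊗[ℚ] F))
instance : Module.Finite ℝ (RealAlgebra F) := inferInstanceAs (Module.Finite ℝ (ℝ ⊗[ℚ] F))
instance : TopologicalSpace (RealAlgebra F) := moduleTopology ℝ (RealAlgebra F)
instance : IsModuleTopology ℝ (RealAlgebra F) := ⟨rfl⟩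
instance : IsTopologicalRing (RealAlgebra F) := IsModuleTopology.isTopologicalRing ℝ (RealAlgebra F)

/-- The embedding `F → F_ℝ`. -/
def toRealAlgebra : F →+* RealAlgebra F :=
  (Algebra.TensorProduct.includeRight : F →ₐ[ℚ] ℝ ⊗[ℚ] F).toRingHom

variable {K F} in
/-- The automorphism of `F_ℝ` induced by `g ∈ Gal(F/K)`. -/
def galReal (g : Gal(F/K)) : RealAlgebra F ≃ₐ[ℝ] RealAlgebra F :=
  (Algebra.TensorProduct.congr AlgEquiv.refl
    (AlgEquiv.ofRingEquiv (f := g.toRingEquiv) (fun r => map_ratCast g r) : F ≃ₐ[ℚ] F) :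
      ℝ ⊗[ℚ] F ≃ₐ[ℝ] ℝ ⊗[ℚ] F)

variable {K F} in
theorem galReal_tmul (g : Gal(F/K)) (r : ℝ) (x : F) :
    galReal g (r ⊗ₜ[ℚ] x : ℝ ⊗[ℚ] F) = (r ⊗ₜ[ℚ] g x : ℝ ⊗[ℚ] F) := rfl

instance : MulDistribMulAction Gal(F/K) (RealAlgebra F) where
  smul g x := galReal g x
  one_smul x := by
    change galReal 1 x = x
    induction x using TensorProduct.induction_on with
    | zero => exact map_zero _
    | tmul r x => rfl
    | add x y hx hy => exact (map_add _ x y).trans (congrArg₂ _ hx hy)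
  mul_smul g g' x := by
    change galReal (g * g') x = galReal g (galReal g' x)
    induction x using TensorProduct.induction_on with
    | zero => exact ((map_zero _).trans (map_zero _).symm).trans (congrArg _ (map_zero _).symm)
    | tmul r x => rfl
    | add x y hx hy =>
      refine (map_add _ x y).trans ((congrArg₂ _ hx hy).trans ?_)
      exact (map_add _ _ _).symm.trans (congrArg _ (map_add _ x y).symm)
  smul_one g := map_one (galReal g)
  smul_mul g := map_mul (galReal g)

instance : ContinuousConstSMul Gal(F/K) (RealAlgebra F) where
  continuous_const_smul g :=
    IsModuleTopology.continuous_of_linearMap (galReal g).toLinearMap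

instance : MulDistribMulAction Gal(F/K) (RealAlgebra F)ˣ := unitsAction _ _

instance : ContinuousConstSMul Gal(F/K) (RealAlgebra F)ˣ where
  continuous_const_smul g :=
    Continuous.units_map (MulDistribMulAction.toMonoidHom (RealAlgebra F) g)
      (continuous_const_smul g)

/-- The absolute value `|Nm| : F_ℝˣ → ℝ` of the norm of the `ℝ`-algebra `F_ℝ`. -/
def realNorm : (RealAlgebra F)ˣ →* ℝ :=
  ((absHom : ℝ →*₀ ℝ) : ℝ →* ℝ).comp ((Algebra.norm ℝ).comp (Units.coeHom (RealAlgebra F)))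

/-- The ideal norm `Id_F → ℝ`. -/
def idealNorm : IdealGroup F →* ℝ :=
  ((Rat.castHom ℝ : ℚ →+* ℝ) : ℚ →* ℝ).comp
    (((FractionalIdeal.absNorm (R := 𝓞 F) (K := F) : FractionalIdeal (𝓞 F)⁰ F →*₀ ℚ) :
      FractionalIdeal (𝓞 F)⁰ F →* ℚ).comp (Units.coeHom (FractionalIdeal (𝓞 F)⁰ F)))

variable {K F} in
theorem realNorm_smul (g : Gal(F/K)) (x : (RealAlgebra F)ˣ) : realNorm F (g • x) = realNorm F x :=
  congrArg abs (Algebra.norm_eq_of_algEquiv (galReal g) (x : RealAlgebra F))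

open scoped Pointwise in
variable {K F} in
theorem idealNorm_smul (g : Gal(F/K)) (I : IdealGroup F) : idealNorm F (g • I) = idealNorm F I := by
  let e := MulSemiringAction.toRingEquiv Gal(F/K) (𝓞 F) g
  have key : ∀ J : FractionalIdeal (𝓞 F)⁰ F,
      FractionalIdeal.absNorm (galIdeal g J) = FractionalIdeal.absNorm J := by
    intro J
    have hJ := J.den_mul_self_eq_num
    rw [FractionalIdeal.absNorm_eq' (I := galIdeal g J)
      ⟨e J.den, mem_nonZeroDivisors_of_ne_zero (by simp)⟩ (J.num.map (e : 𝓞 F →+* 𝓞 F)),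
      FractionalIdeal.absNorm_eq]
    · have h1 : Algebra.norm ℤ (e (J.den : 𝓞 F)) = Algebra.norm ℤ (J.den : 𝓞 F) :=
        Algebra.norm_eq_of_algEquiv (AlgEquiv.ofRingEquiv (f := e) (by simp)) _
      have h2 : Ideal.absNorm (J.num.map (e : 𝓞 F →+* 𝓞 F)) = Ideal.absNorm J.num := by
        rw [Ideal.absNorm_apply, Ideal.absNorm_apply, Submodule.cardQuot_apply,
          Submodule.cardQuot_apply]
        exact (Nat.card_congr (Ideal.quotientEquiv J.num _ e rfl).toEquiv).symm
      rw [h1, h2]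
    · ext x
      have hx : ∀ y : F, y ∈ (J.den : (𝓞 F)⁰) • (J : Submodule (𝓞 F) F) ↔
          ∃ z ∈ J.num, algebraMap (𝓞 F) F z = y := by
        intro y; rw [hJ]; rfl
      constructor
      · rintro ⟨y, hy, rfl⟩
        obtain ⟨w, hw, rfl⟩ := (mem_galIdeal g J y).1 hy
        obtain ⟨z, hz, hzw⟩ := (hx (J.den • w)).1 ⟨w, hw, rfl⟩
        refine ⟨e z, Ideal.mem_map_of_mem _ hz, ?_⟩
        change g (algebraMap (𝓞 F) F z) = algebraMap (𝓞 F) F (e J.den) * g w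
        rw [hzw]
        exact map_mul g (algebraMap (𝓞 F) F J.den) w
      · rintro ⟨z, hz, rfl⟩
        obtain ⟨y, hy, rfl⟩ := (Ideal.mem_map_of_equiv e _).1 hz
        obtain ⟨w, hw, hwz⟩ := (hx _).2 ⟨y, hy, rfl⟩
        refine ⟨g w, (mem_galIdeal g J _).2 ⟨w, hw, rfl⟩, ?_⟩
        change algebraMap (𝓞 F) F (e J.den) * g w = g (algebraMap (𝓞 F) F y)
        rw [← hwz]
        exact (map_mul g (algebraMap (𝓞 F) F J.den) w).symm
  exact congrArg (Rat.cast : ℚ → ℝ) (key I.val)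

/-- The fibre product `Id_F ×_{ℝ_{>0}} F_ℝˣ`. -/
def normFibre : Subgroup (IdealGroup F × (RealAlgebra F)ˣ) :=
  MonoidHom.eqLocus ((idealNorm F).comp (MonoidHom.fst _ _)) ((realNorm F).comp (MonoidHom.snd _ _))

instance : MulDistribMulAction Gal(F/K) (normFibre F) :=
  subgroupAction (normFibre F) (by
    rintro g ⟨I, x⟩ h
    exact (idealNorm_smul g I).trans (Eq.trans h (realNorm_smul g x).symm))

instance : ContinuousConstSMul Gal(F/K) (normFibre F) where
  continuous_const_smul g :=
    Continuous.subtype_mk ((continuous_const_smul (T := IdealGroup F × (RealAlgebra F)ˣ) g).comp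
      continuous_subtype_val) _

theorem norm_principal (a : Fˣ) :
    idealNorm F (toPrincipalIdeal (𝓞 F) F a) =
      realNorm F (Units.map (toRealAlgebra F : F →* RealAlgebra F) a) := by
  have h1 : Algebra.norm ℝ (toRealAlgebra F a) = ((Algebra.norm ℚ (a : F) : ℚ) : ℝ) := by
    change Algebra.norm ℝ ((1 : ℝ) ⊗ₜ[ℚ] (a : F)) = _
    rw [Algebra.norm_apply, Algebra.norm_apply, ← Algebra.baseChange_lmul, LinearMap.det_baseChange]
    rfl
  have h2 : FractionalIdeal.absNorm
      (toPrincipalIdeal (𝓞 F) F a : FractionalIdeal (𝓞 F)⁰ F) = |Algebra.norm ℚ (a : F)| := by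
    rw [coe_toPrincipalIdeal, FractionalIdeal.absNorm_span_singleton]
  change ((FractionalIdeal.absNorm
    (toPrincipalIdeal (𝓞 F) F a : FractionalIdeal (𝓞 F)⁰ F) : ℚ) : ℝ) =
      |Algebra.norm ℝ (toRealAlgebra F a)|
  rw [h1, h2, Rat.cast_abs]

/-- The map `Fˣ → Id_F ×_{ℝ_{>0}} F_ℝˣ`, `α ↦ (α 𝓞_F, α)`. -/
def diagonalMap : Fˣ →* normFibre F :=
  MonoidHom.codRestrict
    (MonoidHom.prod (N := IdealGroup F) (toPrincipalIdeal (𝓞 F) F)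
      (Units.map (toRealAlgebra F : F →* RealAlgebra F)))
    (normFibre F) (norm_principal F)

/-- The oriented Arakelov class group of `F`. -/
def OrientedPic : Type u := normFibre F ⧸ (diagonalMap F).range

instance : CommGroup (OrientedPic F) :=
  inferInstanceAs (CommGroup (normFibre F ⧸ (diagonalMap F).range))
instance : TopologicalSpace (OrientedPic F) :=
  inferInstanceAs (TopologicalSpace (normFibre F ⧸ (diagonalMap F).range))

instance : MulDistribMulAction Gal(F/K) (OrientedPic F) :=
  quotientAction (diagonalMap F).range (by
    rintro g _ ⟨a, rfl⟩
    exact ⟨Units.map (g : F →* F) a,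
      Subtype.ext (Prod.ext (smul_toPrincipalIdeal g a).symm (Units.ext rfl))⟩)

instance : ContinuousConstSMul Gal(F/K) (OrientedPic F) where
  continuous_const_smul g :=
    continuous_quotient_mk'.comp (continuous_const_smul (T := normFibre F) g) |>.quotient_lift _

variable {F} in
/-- The homomorphism `F_ℝ → ℂ` of `ℝ`-algebras extending an embedding `φ : F → ℂ`. -/
def extendEmbedding (φ : F →+* ℂ) : RealAlgebra F →ₐ[ℝ] ℂ :=
  (Algebra.TensorProduct.lift (Algebra.ofId ℝ ℂ) (φ.toRatAlgHom) (fun _ _ => Commute.all _ _) :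
    ℝ ⊗[ℚ] F →ₐ[ℝ] ℂ)

/-- The maximal compact subgroup of `F_ℝˣ = ∏ F_wˣ`: the product of the groups `{±1}` for `w` real
and of the circle groups for `w` complex, that is, the elements all of whose components have
absolute value `1`. -/
def maxCompact : Subgroup (RealAlgebra F)ˣ where
  carrier := {x | ∀ φ : F →+* ℂ, ‖extendEmbedding φ x‖ = 1}
  one_mem' φ := by simp
  mul_mem' hx hy φ := by simp [hx φ, hy φ]
  inv_mem' {x} hx φ := by
    have h : extendEmbedding φ (x : RealAlgebra F) * extendEmbedding φ (↑x⁻¹ : RealAlgebra F) = 1 := by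
      rw [← map_mul, Units.mul_inv, map_one]
    have h2 := congrArg norm h
    rwa [norm_mul, hx φ, one_mul, norm_one] at h2

variable {K F} in
theorem smul_mem_maxCompact (g : Gal(F/K)) (x : (RealAlgebra F)ˣ) (hx : x ∈ maxCompact F) :
    g • x ∈ maxCompact F := by
  intro φ
  have key : (extendEmbedding φ).comp (galReal g).toAlgHom = extendEmbedding (φ.comp (g : F →+* F)) := by
    apply Algebra.TensorProduct.ext
    · ext
    · ext y
      change extendEmbedding φ (galReal g ((1 : ℝ) ⊗ₜ[ℚ] y : ℝ ⊗[ℚ] F)) = _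
      rw [galReal_tmul]
      exact (Algebra.TensorProduct.lift_tmul _ _ _ _ _).trans (by simp [extendEmbedding])
  have := hx (φ.comp (g : F →+* F))
  rw [← key] at this
  exact this

/-- The image of `{1} × comp(F_ℝˣ)` in the oriented Arakelov class group. -/
def compactImage : Subgroup (OrientedPic F) :=
  (((⊥ : Subgroup (IdealGroup F)).prod (maxCompact F)).subgroupOf (normFibre F)).map
    (QuotientGroup.mk' (diagonalMap F).range)

/-- The Arakelov class group `Pic⁰_F`. -/
def Pic0 : Type u := OrientedPic F ⧸ compactImage F

instance : CommGroup (Pic0 F) := inferInstanceAs (CommGroup (OrientedPic F ⧸ compactImage F))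
instance : TopologicalSpace (Pic0 F) :=
  inferInstanceAs (TopologicalSpace (OrientedPic F ⧸ compactImage F))

instance : MulDistribMulAction Gal(F/K) (Pic0 F) :=
  quotientAction (compactImage F) (by
    rintro g _ ⟨⟨⟨I, x⟩, h⟩, ⟨hI, hx⟩, rfl⟩
    have hI' : I = 1 := hI
    refine ⟨g • (⟨⟨I, x⟩, h⟩ : normFibre F), ?_, rfl⟩
    refine ⟨?_, smul_mem_maxCompact g x hx⟩
    change g • I = 1
    rw [hI', smul_one])

instance : ContinuousConstSMul Gal(F/K) (Pic0 F) where
  continuous_const_smul g :=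
    continuous_quotient_mk'.comp (continuous_const_smul (T := OrientedPic F) g) |>.quotient_lift _

end Arakelov

/-! ### The conjecture and the element `Ψ(F/K)` -/

section Conjecture

variable (K : Type v) (F : Type u) [Field K] [NumberField K] [Field F] [NumberField F]
  [Algebra K F]

/-- The Galois module dual to the oriented Arakelov class group. -/
abbrev orientedArRep : Representation ℤ Gal(F/K) (Additive (PontryaginDual (OrientedPic F))) :=
  pontryaginRep Gal(F/K) (OrientedPic F)

/-- The Galois module dual to the Arakelov class group. -/
abbrev arRep : Representation ℤ Gal(F/K) (Additive (PontryaginDual (Pic0 F))) :=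
  pontryaginRep Gal(F/K) (Pic0 F)

/-- The unit group `𝓞_Fˣ` as a Galois module. -/
abbrev unitsRep : Representation ℤ Gal(F/K) (Additive (𝓞 F)ˣ) :=
  Representation.ofMulDistribMulAction Gal(F/K) (𝓞 F)ˣ

instance : MulDistribMulAction Gal(F/K) (NumberField.Units.torsion F) :=
  subgroupAction (NumberField.Units.torsion F) (fun g _ ha =>
    MonoidHom.isOfFinOrder (MulDistribMulAction.toMonoidHom (𝓞 F)ˣ g) ha)

/-- The group `μ_F` of roots of unity of `F` as a Galois module. -/
abbrev rootsRep : Representation ℤ Gal(F/K) (Additive (NumberField.Units.torsion F)) :=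
  Representation.ofMulDistribMulAction Gal(F/K) (NumberField.Units.torsion F)

/-- The class group `Cl_F` as a Galois module. -/
abbrev clRep : Representation ℤ Gal(F/K) (Additive (Cl F)) :=
  Representation.ofMulDistribMulAction Gal(F/K) (Cl F)

/-- The trivial Galois module `ℤ`. -/
abbrev trivialRep : Representation ℤ Gal(F/K) (ULift.{u} ℤ) :=
  Representation.trivial ℤ Gal(F/K) (ULift.{u} ℤ)

/-- The permutation module `ℤ[S_∞]` on the Archimedean places of `F`. -/
abbrev placesRep : Representation ℤ Gal(F/K) (MonoidAlgebra ℤ (NumberField.InfinitePlace F)) :=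
  Representation.ofMulAction ℤ Gal(F/K) (NumberField.InfinitePlace F)

/-- The augmentation map `ℤ[S_∞] → ℤ`. -/
def placesAugmentation : MonoidAlgebra ℤ (NumberField.InfinitePlace F) →ₗ[ℤ] ℤ :=
  Finsupp.linearCombination ℤ (fun _ : NumberField.InfinitePlace F => (1 : ℤ)) ∘ₗ
    (MonoidAlgebra.coeffLinearEquiv ℤ).toLinearMap

theorem placesAugmentation_comp (g : Gal(F/K)) :
    placesAugmentation F ∘ₗ placesRep K F g = placesAugmentation F := by
  ext w
  simp [placesAugmentation]

/-- The module `X_{S_∞}`, the kernel of the augmentation map `ℤ[S_∞] → ℤ`. -/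
abbrev xRep : Representation ℤ Gal(F/K) (LinearMap.ker (placesAugmentation F)) :=
  (placesRep K F).subrepresentation (LinearMap.ker (placesAugmentation F)) (fun g x hx =>
    (LinearMap.congr_fun (placesAugmentation_comp K F g) x).trans hx)

/-- `Ψ(F/K) = [𝓞_Fˣ] - [X_{S_∞}] - [Cl_F]`. -/
def Psi : G0 (MonoidAlgebra ℤ Gal(F/K)) :=
  G0.clsRep (unitsRep K F) - G0.clsRep (xRep K F) - G0.clsRep (clRep K F)

/-- The equality `[A] = d [ℤ[G]] - [ℤ]`, where `d = [K : ℚ]` and `A` is the Pontryagin dual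
of the oriented Arakelov class group. -/
def OrientedArakelovEquality
    [Module.Finite (MonoidAlgebra ℤ Gal(F/K)) (orientedArRep K F).asModule] : Prop :=
  G0.clsRep (orientedArRep K F) =
    Module.finrank ℚ K • G0.cls (MonoidAlgebra ℤ Gal(F/K)) (MonoidAlgebra ℤ Gal(F/K)) -
      G0.clsRep (trivialRep K F)

/-- The equality `[Ar_F] = [ℤ[S_∞]] - [ℤ] - σ[μ_F]`, where `Ar_F` is the Pontryagin dual of the
Arakelov class group. -/
def ArakelovEquality [Module.Finite (MonoidAlgebra ℤ Gal(F/K)) (arRep K F).asModule] : Prop :=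
  G0.clsRep (arRep K F) =
    G0.clsRep (placesRep K F) - G0.clsRep (trivialRep K F) -
      G0.sigma Gal(F/K) (G0.clsRep (rootsRep K F))

/-- The main conjecture for `F/K`: both equalities hold in `G₀(ℤ[G])`. -/
def MainConjecture [Module.Finite (MonoidAlgebra ℤ Gal(F/K)) (orientedArRep K F).asModule]
    [Module.Finite (MonoidAlgebra ℤ Gal(F/K)) (arRep K F).asModule] : Prop :=
  OrientedArakelovEquality K F ∧ ArakelovEquality K F

end Conjecture

end

noncomputable section

/-! ### Formal rules for classes in `G0` -/

namespace G0

section Formal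

variable {Λ : Type u} [Ring Λ]

/-! Write U for the units modulo μ_F, A^∨ for the characters of A with values in ℝ/ℤ, and M* for
Hom_ℤ(M, ℤ). The point is that each of the equalities (a) and (b), taken alone, is equivalent to
σ(Ψ) = 0: the difference of its two sides is exactly σ(Ψ). Since σ is an involution
(`G0.sigma_sigma`), this is the same as Ψ = 0.

To compute σ(Ψ), note that σ fixes the classes of permutation modules and of ℤ, and that σ[A] =
-[A^∨] for finite A, as one sees by dualising a presentation of A by lattices
(`exists_finite_charRep`). So σ(Ψ) = σ[μ_F] + [U*] - [ℤ[S_∞]] + [ℤ] + [Cl_F^∨] (`sigma_Psi`).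

For (b), Pic⁰ maps onto Cl_F, and the kernel is the norm-one part of F_ℝˣ modulo units and modulo
the compact group C. The logarithm turns it into the trace-zero hyperplane modulo the lattice of
units, a torus with character group U*. Hence [Ar_F] = [U*] + [Cl_F^∨] (`exists_clsRep_arRep`).

For (a), the kernel of the projection of the oriented group to Pic⁰ is C/μ_F. Every character of C
is a product of powers of the embeddings φ : F → ℂ, and the exponent vectors of the trivial
character form a copy of ℤ[S_∞], spanned by the φ + φ̄. The vectors that are trivial on μ_F form a
lattice N with [N] + [μ_F^∨] = [ℤ^{Hom(F,ℂ)}] = d[ℤ[G]], because G permutes the embeddings freely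
with d orbits. Every character of C/μ_F extends, so the oriented dual has class [Ar_F] + [N] -
[ℤ[S_∞]] (`exists_clsRep_orientedArRep`).

That Ψ is torsion rests on Swan's theorem that finite modules have torsion class
(`ArtinInduction.cls_mem_torsion_of_finite`). By dévissage the module M may be taken of prime
exponent p. The class of Hom_ℤ(A, M) then depends only on the character of the lattice A
(`HomClass.homCls_eq_of_chi_eq`), so Artin's induction theorem writes |G|[M] as a combination of
classes coinduced from cyclic subgroups. For a cyclic group the simple finite modules are residue
fields of rings ℤ[ζ_d], and the finiteness of the class group makes their classes torsion. Swan's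
theorem implies in turn that lattices with equal characters have classes that differ by torsion.
This applies to U ⊕ ℤ and ℤ[S_∞], which have the same character by Dirichlet's unit theorem; the
remaining terms of Ψ are classes of the finite modules μ_F and Cl_F. -/

theorem cls_of_subsingleton (A : Type u) [AddCommGroup A] [Module Λ A] [Module.Finite Λ A]
    [Subsingleton A] : cls Λ A = 0 := by
  have h := cls_of_exact (Λ := Λ) (A := A) (B := A) (C := A) LinearMap.id LinearMap.id
    (fun _ _ h => h) (fun x => ⟨fun _ => ⟨x, rfl⟩, fun _ => Subsingleton.elim _ _⟩)
    (fun x => ⟨x, rfl⟩)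
  exact left_eq_add.1 h

theorem cls_congr {A B : Type u} [AddCommGroup A] [AddCommGroup B] [Module Λ A] [Module Λ B]
    [Module.Finite Λ A] [Module.Finite Λ B] (e : A ≃ₗ[Λ] B) : cls Λ A = cls Λ B := by
  have h := cls_of_exact (A := A) (B := B) (C := PUnit.{u + 1}) e.toLinearMap
    (0 : B →ₗ[Λ] PUnit.{u + 1}) e.injective
    (fun x => ⟨fun _ => e.surjective x, fun _ => rfl⟩) (fun x => ⟨0, rfl⟩)
  rw [h, cls_of_subsingleton PUnit, add_zero]

theorem cls_eq_submodule_add_quotient {A : Type u} [AddCommGroup A] [Module Λ A]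
    [Module.Finite Λ A] (N : Submodule Λ A) [Module.Finite Λ N] :
    cls Λ A = cls Λ N + cls Λ (A ⧸ N) :=
  cls_of_exact N.subtype N.mkQ N.injective_subtype
    (LinearMap.exact_subtype_mkQ N) N.mkQ_surjective

theorem cls_prod (A B : Type u) [AddCommGroup A] [AddCommGroup B] [Module Λ A] [Module Λ B]
    [Module.Finite Λ A] [Module.Finite Λ B] : cls Λ (A × B) = cls Λ A + cls Λ B :=
  cls_of_exact (LinearMap.inl Λ A B) (LinearMap.snd Λ A B) LinearMap.inl_injective
    .inl_snd LinearMap.snd_surjective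

theorem cls_fin_fun (A : Type u) [AddCommGroup A] [Module Λ A] [Module.Finite Λ A] (n : ℕ) :
    cls Λ (Fin n → A) = n • cls Λ A := by
  induction n with
  | zero => rw [cls_of_subsingleton, zero_smul]
  | succ n ih =>
    rw [← cls_congr (Fin.consLinearEquiv Λ (fun _ : Fin (n + 1) => A)), cls_prod, ih, succ_nsmul,
      add_comm]

end Formal

/-! ### Classes of representations and equivariant maps -/

section Representations

variable {G : Type u} [Group G]

/-- An equivariant homomorphism, as a homomorphism of `ℤ[G]`-modules. -/
def repHom {A B : Type*} [AddCommGroup A] [AddCommGroup B] (ρ : Representation ℤ G A)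
    (σ : Representation ℤ G B) (f : A →+ B) (h : ∀ g a, f (ρ g a) = σ g (f a)) :
    ρ.asModule →ₗ[MonoidAlgebra ℤ G] σ.asModule :=
  Representation.IntertwiningMap.equivLinearMapAsModule ρ σ
    { toLinearMap := f.toIntLinearMap
      isIntertwining' := fun g => LinearMap.ext (h g) }

variable {A B C : Type u} [AddCommGroup A] [AddCommGroup B] [AddCommGroup C]
  {ρA : Representation ℤ G A} {ρB : Representation ℤ G B} {ρC : Representation ℤ G C}
  [Module.Finite (MonoidAlgebra ℤ G) ρA.asModule] [Module.Finite (MonoidAlgebra ℤ G) ρB.asModule]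

theorem clsRep_of_exact [Module.Finite (MonoidAlgebra ℤ G) ρC.asModule] (f : A →+ B) (g : B →+ C)
    (hf : ∀ s a, f (ρA s a) = ρB s (f a)) (hg : ∀ s a, g (ρB s a) = ρC s (g a))
    (hi : Function.Injective f) (he : ∀ b, g b = 0 ↔ ∃ a, f a = b) (hs : Function.Surjective g) :
    clsRep ρB = clsRep ρA + clsRep ρC :=
  cls_of_exact (repHom ρA ρB f hf) (repHom ρB ρC g hg) hi he hs

theorem clsRep_congr (f : A ≃+ B) (hf : ∀ s a, f (ρA s a) = ρB s (f a)) :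
    clsRep ρA = clsRep ρB :=
  cls_congr (LinearEquiv.ofBijective (repHom ρA ρB f.toAddMonoidHom hf) f.bijective)

variable (G) in
/-- A `ℤ[G]`-module, seen as a representation. -/
abbrev modRep (M : Type*) [AddCommGroup M] [Module (MonoidAlgebra ℤ G) M] : Representation ℤ G M :=
  Representation.ofModule' (k := ℤ) (G := G) M

@[simp]
theorem modRep_apply (M : Type*) [AddCommGroup M] [Module (MonoidAlgebra ℤ G) M] (g : G) (m : M) :
    modRep G M g m = MonoidAlgebra.of ℤ G g • m := by
  simp [modRep, Representation.ofModule']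

theorem modRep_asModule (ρ : Representation ℤ G A) (g : G) (a : A) :
    modRep G ρ.asModule g (ρ.asModuleEquiv.symm a) = ρ.asModuleEquiv.symm (ρ g a) := by
  rw [modRep_apply, Representation.asModuleEquiv_symm_map_rho]

/-- A homomorphism of `ℤ[G]`-modules from an equivariant homomorphism. -/
def equivariantHom {M N : Type*} [AddCommGroup M] [Module (MonoidAlgebra ℤ G) M]
    [AddCommGroup N] [Module (MonoidAlgebra ℤ G) N] (f : M →+ N)
    (h : ∀ g m, f (MonoidAlgebra.of ℤ G g • m) = MonoidAlgebra.of ℤ G g • f m) :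
    M →ₗ[MonoidAlgebra ℤ G] N where
  toFun := f
  map_add' := f.map_add
  map_smul' r m := by
    change f (r • m) = r • f m
    induction r using MonoidAlgebra.induction_on with
    | of g => exact h g m
    | add x y hx hy => rw [add_smul, map_add, hx, hy, add_smul]
    | smul n x hx => rw [smul_assoc, map_zsmul, hx, smul_assoc]

/-- A `ℤ[G]`-module is isomorphic to the module of its representation. -/
def modRepEquiv (M : Type*) [AddCommGroup M] [Module (MonoidAlgebra ℤ G) M] :
    M ≃ₗ[MonoidAlgebra ℤ G] (modRep G M).asModule :=
  LinearEquiv.ofBijective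
    (equivariantHom (N := (modRep G M).asModule) (modRep G M).asModuleEquiv.symm.toAddMonoidHom
      (fun g m => by
        rw [← modRep_apply]
        exact Representation.asModuleEquiv_symm_map_rho (modRep G M) g m))
    (modRep G M).asModuleEquiv.symm.bijective

instance finite_modRep (M : Type*) [AddCommGroup M] [Module (MonoidAlgebra ℤ G) M]
    [Module.Finite (MonoidAlgebra ℤ G) M] :
    Module.Finite (MonoidAlgebra ℤ G) (modRep G M).asModule :=
  Module.Finite.equiv (modRepEquiv M)

theorem clsRep_modRep (M : Type u) [AddCommGroup M] [Module (MonoidAlgebra ℤ G) M]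
    [Module.Finite (MonoidAlgebra ℤ G) M] :
    clsRep (modRep G M) = cls (MonoidAlgebra ℤ G) M :=
  (cls_congr (modRepEquiv M)).symm

/-- Two homomorphisms with the same range compare the classes of their sources. -/
theorem clsRep_of_range_eq [Finite G] {A B K L E : Type u} [AddCommGroup A] [AddCommGroup B]
    [AddCommGroup K] [AddCommGroup L] [AddCommGroup E]
    {ρA : Representation ℤ G A} {ρB : Representation ℤ G B} {ρK : Representation ℤ G K}
    {ρL : Representation ℤ G L} {ρE : Representation ℤ G E}
    [Module.Finite (MonoidAlgebra ℤ G) ρB.asModule] [Module.Finite (MonoidAlgebra ℤ G) ρK.asModule]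
    [Module.Finite (MonoidAlgebra ℤ G) ρL.asModule]
    (i : K →+ A) (f : A →+ E) (j : L →+ B) (h : B →+ E)
    (hi : ∀ s a, i (ρK s a) = ρA s (i a)) (hf : ∀ s a, f (ρA s a) = ρE s (f a))
    (hj : ∀ s a, j (ρL s a) = ρB s (j a)) (hh : ∀ s a, h (ρB s a) = ρE s (h a))
    (hi' : Function.Injective i) (hif : ∀ a, f a = 0 ↔ ∃ k, i k = a)
    (hj' : Function.Injective j) (hjh : ∀ b, h b = 0 ↔ ∃ l, j l = b)
    (hr : ∀ e, (∃ a, f a = e) ↔ ∃ b, h b = e) :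
    ∃ _ : Module.Finite (MonoidAlgebra ℤ G) ρA.asModule,
      clsRep ρA + clsRep ρL = clsRep ρB + clsRep ρK := by
  let f' := repHom ρA ρE f hf
  let h' := repHom ρB ρE h hh
  have hr' : LinearMap.range f' = LinearMap.range h' := SetLike.ext hr
  have fin1 : Module.Finite (MonoidAlgebra ℤ G) (LinearMap.range h') := Module.Finite.range h'
  have fin2 : Module.Finite (MonoidAlgebra ℤ G) (LinearMap.range f') := hr' ▸ fin1
  have ker1 : LinearMap.ker f' = LinearMap.range (repHom ρK ρA i hi) := SetLike.ext hif
  -- The target E is usually a huge character group, so finiteness of A has to come from its two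
  -- pieces: the kernel, which is the image of K, and the range, which is also a quotient of B.
  have finA : Module.Finite (MonoidAlgebra ℤ G) ρA.asModule := by
    have : Module.Finite (MonoidAlgebra ℤ G) (LinearMap.ker f') := by rw [ker1]; infer_instance
    have := Module.Finite.equiv f'.quotKerEquivRange.symm
    exact Module.Finite.of_submodule_quotient (LinearMap.ker f')
  refine ⟨finA, ?_⟩
  have e1 : clsRep ρA = clsRep ρK + cls (MonoidAlgebra ℤ G) (LinearMap.range f') :=
    cls_of_exact (repHom ρK ρA i hi) f'.rangeRestrict hi'
      (fun a => (by rw [Subtype.ext_iff]; exact hif a)) f'.surjective_rangeRestrict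
  have e2 : clsRep ρB = clsRep ρL + cls (MonoidAlgebra ℤ G) (LinearMap.range h') :=
    cls_of_exact (repHom ρL ρB j hj) h'.rangeRestrict hj'
      (fun a => (by rw [Subtype.ext_iff]; exact hjh a)) h'.surjective_rangeRestrict
  rw [e1, e2, cls_congr (LinearEquiv.ofEq _ _ hr')]
  abel

end Representations

end G0

/-! ### Traces and characters of lattices -/

namespace LatticeTrace

theorem trace_eq_of_equiv {R A B : Type*} [CommRing R] [AddCommGroup A] [Module R A]
    [AddCommGroup B] [Module R B] (e : A ≃ₗ[R] B) (a : Module.End R A) (b : Module.End R B)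
    (h : ∀ x, e (a x) = b (e x)) : LinearMap.trace R A a = LinearMap.trace R B b := by
  rw [← LinearMap.trace_conj' a e]
  congr 1
  ext x
  rw [LinearEquiv.conj_apply_apply, h, e.apply_symm_apply]

/-- Traces are compatible with extension of scalars. -/
theorem trace_eq_of_baseChange_equiv {K A V : Type*} [CommRing K] [AddCommGroup A]
    [Module.Free ℤ A] [Module.Finite ℤ A] [AddCommGroup V] [Module K V] (e : K ⊗[ℤ] A ≃ₗ[K] V)
    (a : Module.End ℤ A) (T : Module.End K V) (h : ∀ x, e (1 ⊗ₜ a x) = T (e (1 ⊗ₜ x))) :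
    LinearMap.trace K V T = (LinearMap.trace ℤ A a : ℤ) := by
  rw [← eq_intCast (algebraMap ℤ K), ← LinearMap.trace_baseChange]
  symm
  refine trace_eq_of_equiv e _ _ fun x => ?_
  induction x using TensorProduct.induction_on with
  | zero => simp
  | tmul k x =>
    have hk : ∀ y : A, k ⊗ₜ[ℤ] y = k • ((1 : K) ⊗ₜ[ℤ] y) := fun y => by
      rw [TensorProduct.smul_tmul', smul_eq_mul, mul_one]
    rw [LinearMap.baseChange_tmul, hk, hk, map_smul, map_smul, map_smul, h]
  | add x y hx hy => simp only [map_add, hx, hy]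

theorem bijective_baseChange_rat_of_finite_index {A B : Type*} [AddCommGroup A] [AddCommGroup B]
    [Module.Free ℤ B] (f : A →ₗ[ℤ] B)
    (hf : Function.Injective f) (n : ℤ) (hn : n ≠ 0) (hB : ∀ b, ∃ a, f a = n • b) :
    Function.Bijective (f.baseChange ℚ) := by
  have hinj : Function.Injective (f.baseChange ℚ) :=
    Module.Flat.lTensor_preserves_injective_linearMap (M := ℚ) f hf
  have hsurj : Function.Surjective (f.baseChange ℚ) := by
    intro x
    induction x using TensorProduct.induction_on with
    | zero => exact ⟨0, map_zero _⟩
    | tmul q b =>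
      obtain ⟨a, ha⟩ := hB b
      refine ⟨(q / n) ⊗ₜ a, ?_⟩
      rw [LinearMap.baseChange_tmul, ha, ← TensorProduct.smul_tmul]
      congr 1
      rw [zsmul_eq_mul]
      field_simp
    | add x y hx hy =>
      obtain ⟨x, rfl⟩ := hx
      obtain ⟨y, rfl⟩ := hy
      exact ⟨x + y, map_add _ _ _⟩
  exact ⟨hinj, hsurj⟩

/-- An injection whose cokernel is killed by a nonzero integer becomes an isomorphism over ℚ, and
the traces can be compared there. -/
theorem trace_eq_of_finite_index {A B : Type*} [AddCommGroup A] [AddCommGroup B]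
    [Module.Free ℤ A] [Module.Free ℤ B] [Module.Finite ℤ A] [Module.Finite ℤ B] (f : A →ₗ[ℤ] B)
    (hf : Function.Injective f) (n : ℤ) (hn : n ≠ 0) (hB : ∀ b, ∃ a, f a = n • b)
    (a : Module.End ℤ A) (b : Module.End ℤ B) (hab : ∀ x, f (a x) = b (f x)) :
    LinearMap.trace ℤ A a = LinearMap.trace ℤ B b := by
  have h1 := trace_eq_of_baseChange_equiv
    (LinearEquiv.ofBijective _ (bijective_baseChange_rat_of_finite_index f hf n hn hB)) a
    (b.baseChange ℚ) (fun x => congrArg (fun y => (1 : ℚ) ⊗ₜ[ℤ] y) (hab x))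
  rw [LinearMap.trace_baseChange] at h1
  exact Int.cast_injective (α := ℚ) ((h1.symm.trans (eq_intCast _ _)))

/-- A ℤ-splitting of the sequence makes the middle endomorphism block triangular, with the two outer
endomorphisms on the diagonal. -/
theorem trace_eq_add_of_exact {A B C : Type*} [AddCommGroup A] [AddCommGroup B] [AddCommGroup C]
    [Module.Free ℤ A] [Module.Free ℤ C] [Module.Finite ℤ A]
    [Module.Finite ℤ C] (f : A →ₗ[ℤ] B) (g : B →ₗ[ℤ] C) (hf : Function.Injective f)
    (hfg : Function.Exact f g) (hg : Function.Surjective g)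
    (a : Module.End ℤ A) (b : Module.End ℤ B) (c : Module.End ℤ C)
    (hab : ∀ x, f (a x) = b (f x)) (hbc : ∀ x, g (b x) = c (g x)) :
    LinearMap.trace ℤ B b = LinearMap.trace ℤ A a + LinearMap.trace ℤ C c := by
  obtain ⟨s, hs⟩ := Module.projective_lifting_property g (LinearMap.id : C →ₗ[ℤ] C) hg
  have hs' : ∀ c, g (s c) = c := fun c => LinearMap.congr_fun hs c
  have hgf : ∀ x, g (f x) = 0 := hfg.apply_apply_eq_zero
  let e : (A × C) ≃ₗ[ℤ] B := LinearEquiv.ofBijective (f.coprod s) (by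
    constructor
    · rw [injective_iff_map_eq_zero]
      rintro ⟨x, y⟩ h
      have h' : f x + s y = 0 := h
      have hy : y = 0 := by simpa [hgf, hs'] using congrArg g h'
      subst hy
      rw [map_zero, add_zero] at h'
      rw [hf (h'.trans (map_zero f).symm)]
      rfl
    · intro y
      obtain ⟨x, hx⟩ := (hfg (y - s (g y))).1 (by simp [hs'])
      exact ⟨(x, g y), by simp [hx]⟩)
  have he : ∀ x y, e (x, y) = f x + s y := fun _ _ => rfl
  have hr : ∀ y, ∃ x, f x = b (s y) - s (c y) := fun y => (hfg _).1 (by simp [hs', hbc])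
  choose r hr using hr
  let r' : C →ₗ[ℤ] A := AddMonoidHom.toIntLinearMap
    { toFun := r
      map_zero' := hf (by simp [hr])
      map_add' := fun x y => hf (by simp only [hr, map_add]; abel) }
  -- The splitting need not commute with the endomorphisms; r measures its defect and is the
  -- off-diagonal block, which is traceless because the composite of inclusion and projection is
  -- zero.
  let T : Module.End ℤ (A × C) := a.prodMap c + (LinearMap.inl ℤ A C ∘ₗ r' ∘ₗ LinearMap.snd ℤ A C)
  have hT : LinearMap.trace ℤ (A × C) T = LinearMap.trace ℤ A a + LinearMap.trace ℤ C c := by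
    rw [map_add, LinearMap.trace_prodMap', LinearMap.trace_comp_comm', LinearMap.comp_assoc,
      LinearMap.snd_comp_inl, LinearMap.comp_zero, map_zero, add_zero]
  rw [← hT]
  symm
  refine trace_eq_of_equiv e _ _ ?_
  rintro ⟨x, y⟩
  have : T (x, y) = (a x + r y, c y) := by simp [T, r']
  rw [this, he, he, map_add, map_add, hr, hab]
  abel

section

variable {G : Type*} [Group G]

/-- A representation on a lattice has a nonzero invariant if and only if the sum of its character
is nonzero. -/
theorem exists_invariant_iff {W : Type*} [AddCommGroup W] [Module.Free ℤ W] [Module.Finite ℤ W]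
    (ρ : Representation ℤ G W) [Fintype G] :
    (∃ w ≠ 0, ∀ g, ρ g w = w) ↔ ∑ g, LinearMap.trace ℤ W (ρ g) ≠ 0 := by
  have hN : LinearMap.trace ℤ W ρ.norm = ∑ g, LinearMap.trace ℤ W (ρ g) := map_sum _ _ _
  rw [← hN]
  constructor
  · rintro ⟨w, hw, h⟩ h0
    -- The norm divided by |G| is the projector onto the invariants. An idempotent of trace zero in
    -- characteristic zero vanishes, whereas this one fixes the nonzero vector 1 ⊗ w.
    let P : Module.End ℚ (ℚ ⊗[ℤ] W) := (Fintype.card G : ℚ)⁻¹ • ρ.norm.baseChange ℚ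
    have hc : (Fintype.card G : ℚ) ≠ 0 := by simp
    have hNN : ρ.norm * ρ.norm = (Fintype.card G) • ρ.norm := by
      conv_lhs => enter [1]; rw [Representation.norm]
      have hg : ∀ g, ρ g * ρ.norm = ρ.norm := ρ.self_comp_norm
      simp [Finset.sum_mul, hg]
    have hP : IsIdempotentElem P := by
      change P * P = P
      have : ρ.norm.baseChange ℚ * ρ.norm.baseChange ℚ =
          (Fintype.card G : ℚ) • ρ.norm.baseChange ℚ := by
        rw [← LinearMap.baseChange_mul, hNN, Nat.cast_smul_eq_nsmul]
        exact map_nsmul (LinearMap.baseChangeHom ℤ ℚ W W) _ _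
      simp only [P]
      rw [smul_mul_smul_comm, this, smul_smul]
      congr 1
      field_simp
    have hP0 : P = 0 := LinearMap.IsIdempotentElem.eq_zero_of_trace_eq_zero hP (by
      simp [P, LinearMap.trace_baseChange, h0])
    have h1 : ρ.norm.baseChange ℚ ((1 : ℚ) ⊗ₜ w) = 0 := by
      have := LinearMap.congr_fun hP0 ((1 : ℚ) ⊗ₜ w)
      simpa [P, hc] using this
    have h2 : ρ.norm w = (Fintype.card G : ℤ) • w := by
      simp [Representation.norm, h]
    rw [LinearMap.baseChange_tmul, h2] at h1
    have h3 := Module.Flat.tensorProduct_mk_injective (R := ℤ) (S := ℚ) (M := W)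
      (h1.trans (TensorProduct.tmul_zero W (1 : ℚ)).symm)
    exact hw ((smul_eq_zero.1 h3).resolve_left (by simp))
  · intro h0
    have hne : ρ.norm ≠ 0 := fun h => h0 (by rw [h, map_zero])
    obtain ⟨w, hw⟩ : ∃ w, ρ.norm w ≠ 0 := by
      by_contra! h
      exact hne (LinearMap.ext h)
    exact ⟨_, hw, fun g => by simp⟩

/-- Identify Hom(V, W) with V* ⊗ W; the transpose accounts for the inverse of g. -/
theorem trace_linHom {V W : Type*} [AddCommGroup V] [Module.Free ℤ V] [Module.Finite ℤ V]
    [AddCommGroup W] [Module.Free ℤ W] [Module.Finite ℤ W] (ρ : Representation ℤ G V)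
    (σ : Representation ℤ G W) (g : G) :
    LinearMap.trace ℤ (V →ₗ[ℤ] W) (Representation.linHom ρ σ g) =
      LinearMap.trace ℤ V (ρ g⁻¹) * LinearMap.trace ℤ W (σ g) := by
  rw [← LinearMap.trace_transpose' (ρ g⁻¹), ← LinearMap.trace_tensorProduct']
  symm
  refine trace_eq_of_equiv (dualTensorHomEquiv ℤ V W) _ _ fun x => ?_
  exact LinearMap.congr_fun (Representation.dualTensorHom_comm ρ σ g) x

end

section Lattices

open G0

variable {G : Type u} [Group G] [Finite G]

/-- The character of a `ℤ[G]`-module. -/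
def chi (M : Type*) [AddCommGroup M] [Module (MonoidAlgebra ℤ G) M] (g : G) : ℤ :=
  LinearMap.trace ℤ M (modRep G M g)

theorem chi_eq_add_of_exact {A B C : Type*} [AddCommGroup A] [AddCommGroup B] [AddCommGroup C]
    [Module (MonoidAlgebra ℤ G) A] [Module (MonoidAlgebra ℤ G) B] [Module (MonoidAlgebra ℤ G) C]
    [Module.Finite (MonoidAlgebra ℤ G) A] [Module.Finite (MonoidAlgebra ℤ G) C]
    [Module.Free ℤ A] [Module.Free ℤ C] (f : A →ₗ[MonoidAlgebra ℤ G] B)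
    (h : B →ₗ[MonoidAlgebra ℤ G] C) (hf : Function.Injective f) (hfh : Function.Exact f h)
    (hh : Function.Surjective h) (g : G) : chi B g = chi A g + chi C g := by
  have := IntegralDual.finite_int (G := G) A
  have := IntegralDual.finite_int (G := G) C
  exact trace_eq_add_of_exact f.toAddMonoidHom.toIntLinearMap h.toAddMonoidHom.toIntLinearMap
    hf hfh hh _ _ _ (fun x => by simp) (fun x => by simp)

theorem chi_eq_of_finite_index {A B : Type*} [AddCommGroup A] [AddCommGroup B]
    [Module (MonoidAlgebra ℤ G) A] [Module (MonoidAlgebra ℤ G) B]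
    [Module.Finite (MonoidAlgebra ℤ G) A] [Module.Finite (MonoidAlgebra ℤ G) B]
    [Module.Free ℤ A] [Module.Free ℤ B] (f : A →ₗ[MonoidAlgebra ℤ G] B)
    (hf : Function.Injective f) [Finite (B ⧸ LinearMap.range f)] (g : G) :
    chi A g = chi B g := by
  have := IntegralDual.finite_int (G := G) A
  have := IntegralDual.finite_int (G := G) B
  refine trace_eq_of_finite_index f.toAddMonoidHom.toIntLinearMap hf
    (Nat.card (B ⧸ LinearMap.range f)) (by exact_mod_cast Nat.card_pos.ne') (fun b => ?_) _ _
    (fun x => by simp)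
  have : Submodule.Quotient.mk (p := LinearMap.range f) ((Nat.card (B ⧸ LinearMap.range f)) • b) =
      0 := by
    rw [Submodule.Quotient.mk_smul]
    exact card_nsmul_eq_zero'
  rw [natCast_zsmul]
  exact (Submodule.Quotient.mk_eq_zero _).1 this

/-- Equivariant homomorphisms are the invariants of Hom_ℤ(S, A), so their existence is decided by
the characters alone. This stands in for the orthogonality relations and semisimplicity over ℚ. -/
theorem exists_hom_iff {S A : Type*} [AddCommGroup S] [AddCommGroup A]
    [Module (MonoidAlgebra ℤ G) S] [Module (MonoidAlgebra ℤ G) A]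
    [Module.Finite (MonoidAlgebra ℤ G) S] [Module.Finite (MonoidAlgebra ℤ G) A]
    [Module.Free ℤ S] [Module.Free ℤ A] [Fintype G] :
    (∃ f : S →ₗ[MonoidAlgebra ℤ G] A, f ≠ 0) ↔
      ∑ g : G, chi S g⁻¹ * chi A g ≠ 0 := by
  have := IntegralDual.finite_int (G := G) S
  have := IntegralDual.finite_int (G := G) A
  have hs : ∑ g : G, chi S g⁻¹ * chi A g = ∑ g : G, LinearMap.trace ℤ (S →ₗ[ℤ] A)
      (Representation.linHom (modRep G S) (modRep G A) g) :=
    Finset.sum_congr rfl (fun g _ => (trace_linHom (modRep G S) (modRep G A) g).symm)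
  rw [hs, ← exists_invariant_iff]
  constructor
  · rintro ⟨f, hf⟩
    refine ⟨f.toAddMonoidHom.toIntLinearMap, fun h => hf (LinearMap.ext fun x =>
      LinearMap.congr_fun h x), fun g => LinearMap.ext fun x => ?_⟩
    have h1 : f (MonoidAlgebra.of ℤ G g⁻¹ • x) = MonoidAlgebra.of ℤ G g⁻¹ • f x := f.map_smul _ _
    rw [Representation.linHom_apply]
    change modRep G A g (f (modRep G S g⁻¹ x)) = f x
    rw [modRep_apply, modRep_apply, h1, ← mul_smul, ← map_mul, mul_inv_cancel, map_one, one_smul]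
  · rintro ⟨f, hf, h⟩
    refine ⟨equivariantHom f.toAddMonoidHom fun g x => ?_, fun h0 => hf (LinearMap.ext fun x =>
      LinearMap.congr_fun h0 x)⟩
    have := LinearMap.congr_fun (h g) (MonoidAlgebra.of ℤ G g • x)
    rw [Representation.linHom_apply] at this
    simp only [LinearMap.comp_apply, modRep_apply, ← mul_smul, ← map_mul, inv_mul_cancel, map_one,
      one_smul] at this
    exact this.symm

/-- The elements having a nonzero multiple in a submodule. -/
def saturation {A : Type*} [AddCommGroup A] [Module (MonoidAlgebra ℤ G) A]
    (S : Submodule (MonoidAlgebra ℤ G) A) : Submodule (MonoidAlgebra ℤ G) A where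
  carrier := {a | ∃ n : ℤ, n ≠ 0 ∧ n • a ∈ S}
  zero_mem' := ⟨1, one_ne_zero, by simp⟩
  add_mem' := by
    rintro a b ⟨m, hm, ha⟩ ⟨n, hn, hb⟩
    refine ⟨m * n, mul_ne_zero hm hn, ?_⟩
    rw [smul_add]
    refine S.add_mem ?_ ?_
    · rw [mul_comm, mul_smul]; exact zsmul_mem ha n
    · rw [mul_smul]; exact zsmul_mem hb m
  smul_mem' := by
    rintro r a ⟨n, hn, ha⟩
    refine ⟨n, hn, ?_⟩
    rw [smul_comm]
    exact S.smul_mem r ha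

theorem le_saturation {A : Type*} [AddCommGroup A] [Module (MonoidAlgebra ℤ G) A]
    (S : Submodule (MonoidAlgebra ℤ G) A) : S ≤ saturation S :=
  fun a ha => ⟨1, one_ne_zero, by simpa using ha⟩

theorem free_quotient_saturation {A : Type*} [AddCommGroup A] [Module (MonoidAlgebra ℤ G) A]
    [Module.Finite (MonoidAlgebra ℤ G) A]
    (S : Submodule (MonoidAlgebra ℤ G) A) : Module.Free ℤ (A ⧸ saturation S) := by
  have := IntegralDual.finite_int (G := G) (A ⧸ saturation S)
  have : Module.IsTorsionFree ℤ (A ⧸ saturation S) := by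
    refine Module.isTorsionFree_iff_smul_eq_zero.2 ?_
    intro n x h
    obtain ⟨x, rfl⟩ := Submodule.Quotient.mk_surjective _ x
    rw [← Submodule.Quotient.mk_smul, Submodule.Quotient.mk_eq_zero] at h
    obtain ⟨m, hm, hx⟩ := h
    by_cases hn : n = 0
    · exact Or.inl hn
    · exact Or.inr ((Submodule.Quotient.mk_eq_zero _).2
        ⟨m * n, mul_ne_zero hm hn, by rwa [mul_smul]⟩)
  infer_instance

theorem finite_quotient_saturation {A : Type*} [AddCommGroup A] [Module (MonoidAlgebra ℤ G) A]
    [Module.Finite (MonoidAlgebra ℤ G) A] (S : Submodule (MonoidAlgebra ℤ G) A) :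
    Finite (saturation S ⧸ LinearMap.range (Submodule.inclusion (le_saturation S))) := by
  have := IntegralDual.finite_int (G := G)
    (saturation S ⧸ LinearMap.range (Submodule.inclusion (le_saturation S)))
  refine Module.finite_of_fg_torsion _ ?_
  intro y
  obtain ⟨⟨x, n, hn, hx⟩, rfl⟩ := Submodule.Quotient.mk_surjective _ y
  refine ⟨⟨n, mem_nonZeroDivisors_of_ne_zero hn⟩, ?_⟩
  exact (Submodule.Quotient.mk_eq_zero _).2 ⟨⟨n • x, hx⟩, rfl⟩

theorem finrank_eq_chi_one {A : Type*} [AddCommGroup A] [Module (MonoidAlgebra ℤ G) A]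
    [Module.Finite (MonoidAlgebra ℤ G) A] [Module.Free ℤ A] :
    chi A (1 : G) = Module.finrank ℤ A := by
  have := IntegralDual.finite_int (G := G) A
  rw [chi, map_one, LinearMap.trace_one]

theorem finrank_eq_add {A : Type*} [AddCommGroup A] [Module (MonoidAlgebra ℤ G) A]
    [Module.Finite (MonoidAlgebra ℤ G) A]
    (S : Submodule (MonoidAlgebra ℤ G) A) :
    Module.finrank ℤ (A ⧸ S) + Module.finrank ℤ S = Module.finrank ℤ A := by
  have := IntegralDual.finite_int (G := G) A
  exact Submodule.finrank_quotient_add_finrank (S.restrictScalars ℤ)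

/-- A nonzero kernel would have full rank in S by minimality. Then S modulo the kernel is of rank
zero, yet it embeds in the torsion-free B, so f is zero. This is Schur's lemma for lattices. -/
theorem injective_of_minimal {A B : Type*} [AddCommGroup A] [AddCommGroup B]
    [Module (MonoidAlgebra ℤ G) A] [Module (MonoidAlgebra ℤ G) B]
    [Module.Finite (MonoidAlgebra ℤ G) A] [Module.Free ℤ A] [Module.Free ℤ B]
    (S : Submodule (MonoidAlgebra ℤ G) A)
    (hS : ∀ S' : Submodule (MonoidAlgebra ℤ G) A, S' ≠ ⊥ →
      Module.finrank ℤ S ≤ Module.finrank ℤ S')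
    (f : S →ₗ[MonoidAlgebra ℤ G] B) (hf : f ≠ 0) : Function.Injective f := by
  by_contra hinj
  have hker : LinearMap.ker f ≠ ⊥ := fun h => hinj (LinearMap.ker_eq_bot.1 h)
  have e := Submodule.equivMapOfInjective S.subtype S.injective_subtype (LinearMap.ker f)
  have h1 := hS ((LinearMap.ker f).map S.subtype) (fun h => hker (le_bot_iff.1 fun x hx =>
    S.injective_subtype ((Submodule.eq_bot_iff _).1 h _ (Submodule.mem_map_of_mem hx))))
  have h0 := (e.restrictScalars ℤ).finrank_eq
  rw [← h0, ← finrank_eq_add (LinearMap.ker f)] at h1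
  have h2 : Module.finrank ℤ (S ⧸ LinearMap.ker f) = 0 := by omega
  have := IntegralDual.finite_int (G := G) (S ⧸ LinearMap.ker f)
  have : Module.Free ℤ (S ⧸ LinearMap.ker f) := by
    have h3 : Module.IsTorsionFree ℤ (S ⧸ LinearMap.ker f) := by
      let e := f.quotKerEquivRange
      refine Function.Injective.moduleIsTorsionFree
        (fun x => (e x : B)) (fun x y hxy => e.injective (Subtype.ext hxy)) (fun n x => ?_)
      rw [map_zsmul]
      rfl
    infer_instance
  have := Module.finrank_zero_iff.1 h2
  refine hf (LinearMap.ext fun x => ?_)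
  exact (Submodule.Quotient.mk_eq_zero (LinearMap.ker f)).1 (Subsingleton.elim _ _)

/-- A function on lattices which is additive on short exact sequences and insensitive to
sublattices of finite index only depends on the character. -/
theorem eq_of_chi_eq {T : Type*} [AddCommGroup T] (Θ : FGModuleCat.{u} (MonoidAlgebra ℤ G) → T)
    (hadd : ∀ (A B C : FGModuleCat.{u} (MonoidAlgebra ℤ G)) (f : A →ₗ[MonoidAlgebra ℤ G] B)
      (g : B →ₗ[MonoidAlgebra ℤ G] C), Module.Free ℤ A → Module.Free ℤ B → Module.Free ℤ C →
      Function.Injective f → Function.Exact f g → Function.Surjective g → Θ B = Θ A + Θ C)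
    (hfin : ∀ (A B : FGModuleCat.{u} (MonoidAlgebra ℤ G)) (f : A →ₗ[MonoidAlgebra ℤ G] B),
      Module.Free ℤ A → Module.Free ℤ B → Function.Injective f →
      Finite (B ⧸ LinearMap.range f) → Θ A = Θ B)
    (A B : Type u) [AddCommGroup A] [AddCommGroup B]
    [Module (MonoidAlgebra ℤ G) A] [Module (MonoidAlgebra ℤ G) B]
    [Module.Finite (MonoidAlgebra ℤ G) A] [Module.Finite (MonoidAlgebra ℤ G) B]
    [Module.Free ℤ A] [Module.Free ℤ B] (h : ∀ g : G, chi A g = chi B g) :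
    Θ (.of (MonoidAlgebra ℤ G) A) = Θ (.of (MonoidAlgebra ℤ G) B) := by
  have := Fintype.ofFinite G
  induction hn : Module.finrank ℤ A using Nat.strong_induction_on generalizing A B with
  | _ n ih =>
  subst hn
  have hAf := IntegralDual.finite_int (G := G) A
  have hBf := IntegralDual.finite_int (G := G) B
  have hrank : Module.finrank ℤ A = Module.finrank ℤ B := by
    have := h 1
    rw [finrank_eq_chi_one, finrank_eq_chi_one] at this
    exact_mod_cast this
  by_cases h0 : Module.finrank ℤ A = 0
  · have : Subsingleton A := Module.finrank_zero_iff.1 h0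
    have : Subsingleton B := Module.finrank_zero_iff.1 (hrank ▸ h0)
    refine hfin (.of _ A) (.of _ B) (0 : A →ₗ[MonoidAlgebra ℤ G] B) ‹_› ‹_›
      (fun x y _ => Subsingleton.elim (α := A) x y) ?_
    change Finite (B ⧸ _)
    infer_instance
  have hA : Nontrivial A := Module.finrank_pos_iff.1 (Nat.pos_of_ne_zero h0)
  -- A nonzero submodule of least rank plays the part of an irreducible constituent of ℚ ⊗ A.
  obtain ⟨S, hS0, hS⟩ : ∃ S : Submodule (MonoidAlgebra ℤ G) A, S ≠ ⊥ ∧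
      ∀ S' : Submodule (MonoidAlgebra ℤ G) A, S' ≠ ⊥ →
        Module.finrank ℤ S ≤ Module.finrank ℤ S' := by
    obtain ⟨S, hS0, hS⟩ := exists_minimalFor_of_wellFoundedLT
      (fun S : Submodule (MonoidAlgebra ℤ G) A => S ≠ ⊥) (fun S => Module.finrank ℤ S)
      ⟨⊤, top_ne_bot⟩
    refine ⟨S, hS0, fun S' hS' => ?_⟩
    by_contra hlt
    exact hlt (hS hS' (le_of_not_ge hlt))
  have hSfree := IntegralDual.free_submodule S
  -- The inclusion of S in A shows that the character sum for S and A is nonzero. Since A and B have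
  -- the same character, S also maps nontrivially to B.
  obtain ⟨f, hf⟩ : ∃ f : S →ₗ[MonoidAlgebra ℤ G] B, f ≠ 0 := by
    simp_rw [exists_hom_iff, ← h]
    rw [← exists_hom_iff]
    refine ⟨S.subtype, fun h => hS0 ?_⟩
    rw [← Submodule.range_subtype S, h, LinearMap.range_zero]
  have hfi := injective_of_minimal S hS f hf
  have hRfree := IntegralDual.free_submodule (LinearMap.range f)
  have hS1 := IntegralDual.free_submodule (saturation S)
  have hR1 := IntegralDual.free_submodule (saturation (LinearMap.range f))
  have hS2 := free_quotient_saturation S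
  have hR2 := free_quotient_saturation (LinearMap.range f)
  have hS3 := finite_quotient_saturation S
  have hR3 := finite_quotient_saturation (LinearMap.range f)
  let j : S →ₗ[MonoidAlgebra ℤ G] saturation (LinearMap.range f) :=
    Submodule.inclusion (le_saturation _) ∘ₗ f.rangeRestrict
  have hj : Function.Injective j :=
    (Submodule.inclusion_injective (le_saturation _)).comp (fun x y hxy => hfi (congrArg Subtype.val hxy))
  have hj2 : LinearMap.range j =
      LinearMap.range (Submodule.inclusion (le_saturation (LinearMap.range f))) :=
    LinearMap.range_comp_of_range_eq_top _ f.range_rangeRestrict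
  have hj3 : Finite (saturation (LinearMap.range f) ⧸ LinearMap.range j) := by rwa [hj2]
  have key : ∀ (C : Type u) [AddCommGroup C] [Module (MonoidAlgebra ℤ G) C]
      [Module.Finite (MonoidAlgebra ℤ G) C] (N : Submodule (MonoidAlgebra ℤ G) C),
      Module.Free ℤ N → Module.Free ℤ C → Module.Free ℤ (C ⧸ N) →
      Θ (.of _ C) = Θ (.of _ N) + Θ (.of _ (C ⧸ N)) := fun C _ _ _ N h1 h2 h3 =>
    hadd (.of _ N) (.of _ C) (.of _ (C ⧸ N)) N.subtype N.mkQ h1 h2 h3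
      N.injective_subtype (LinearMap.exact_subtype_mkQ N) N.mkQ_surjective
  have e1 := key A (saturation S) hS1 ‹_› hS2
  have e2 := key B (saturation (LinearMap.range f)) hR1 ‹_› hR2
  have e3 : Θ (.of _ S) = Θ (.of _ (saturation S)) :=
    hfin _ _ (Submodule.inclusion (le_saturation S)) hSfree hS1
      (Submodule.inclusion_injective _) hS3
  have e4 : Θ (.of _ S) = Θ (.of _ (saturation (LinearMap.range f))) :=
    hfin _ _ j hSfree hR1 hj hj3
  -- S has finite index in its saturation in A and, through j, in the saturation of its image in B.
  -- These parts cancel, and the torsion-free quotients have equal characters and smaller rank.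
  rw [e1, e2, ← e3, ← e4]
  congr 1
  refine ih _ ?_ _ _ ?_ rfl
  · rw [← finrank_eq_add (saturation S)]
    have : Nontrivial (saturation S) := by
      rw [Submodule.nontrivial_iff_ne_bot]
      exact fun h => hS0 (le_bot_iff.1 (h ▸ le_saturation S))
    have := IntegralDual.finite_int (G := G) (saturation S)
    have := Module.finrank_pos (R := ℤ) (M := saturation S)
    omega
  · intro g
    have h1 := chi_eq_add_of_exact (saturation S).subtype (saturation S).mkQ
      (Submodule.injective_subtype _) (LinearMap.exact_subtype_mkQ _)
      (Submodule.mkQ_surjective _) g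
    have h2 := chi_eq_add_of_exact (saturation (LinearMap.range f)).subtype
      (saturation (LinearMap.range f)).mkQ
      (Submodule.injective_subtype _) (LinearMap.exact_subtype_mkQ _)
      (Submodule.mkQ_surjective _) g
    have h3 := chi_eq_of_finite_index _ (Submodule.inclusion_injective (le_saturation S)) g
    have h4 := chi_eq_of_finite_index j hj g
    have := h g
    omega

end Lattices

end LatticeTrace

/-! ### The class of Hom(A, M) for a lattice A and a finite module M -/

namespace HomClass

open G0

/-- Extension of homomorphisms into a group of exponent `p`. -/
theorem exists_extension_of_exponent_prime {X Y M : Type*} [AddCommGroup X] [AddCommGroup Y]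
    [AddCommGroup M] (p : ℕ) [Fact p.Prime] (hM : ∀ m : M, p • m = 0) (j : X →+ Y) (φ : X →+ M)
    (h : ∀ x y, j x = p • y → φ x = 0) : ∃ ψ : Y →+ M, ∀ x, ψ (j x) = φ x := by
  let P : AddSubgroup Y := (nsmulAddMonoidHom p : Y →+ Y).range
  let π : Y →+ Y ⧸ P := QuotientAddGroup.mk' P
  let : Module (ZMod p) M := AddCommGroup.zmodModule hM
  let : Module (ZMod p) (Y ⧸ P) := AddCommGroup.zmodModule (by
    rintro ⟨y⟩
    exact (QuotientAddGroup.eq_zero_iff (N := P) (p • y)).2 ⟨y, rfl⟩)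
  -- The hypothesis says that φ kills the kernel of X → Y/pY. So φ lives on a subspace of the
  -- 𝔽_p-vector space Y/pY, and extends along a linear retraction onto that subspace.
  let k : X →+ Y ⧸ P := π.comp j
  have hk : k.ker ≤ φ.ker := by
    intro x hx
    obtain ⟨y, hy⟩ := (QuotientAddGroup.eq_zero_iff (N := P) (j x)).1 hx
    exact h x y hy.symm
  let _ : Module (ZMod p) (X ⧸ k.ker) := AddCommGroup.zmodModule (by
    rintro ⟨x⟩
    refine (QuotientAddGroup.eq_zero_iff (N := k.ker) (p • x)).2 ?_
    rw [AddMonoidHom.mem_ker]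
    exact (QuotientAddGroup.eq_zero_iff (N := P) _).2 ⟨j x, (map_nsmul j p x).symm⟩)
  obtain ⟨s, hs⟩ := LinearMap.exists_leftInverse_of_injective
    (AddMonoidHom.toZModLinearMap p (QuotientAddGroup.kerLift k))
    (LinearMap.ker_eq_bot.2 (QuotientAddGroup.kerLift_injective k))
  refine ⟨((QuotientAddGroup.lift k.ker φ hk).comp s.toAddMonoidHom).comp π, fun x => ?_⟩
  exact congrArg (QuotientAddGroup.lift k.ker φ hk) (LinearMap.congr_fun hs (x : X ⧸ k.ker))

theorem finite_hom {A M : Type*} [AddCommGroup A] [AddCommGroup M] [Module.Finite ℤ A] [Finite M] :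
    Finite (A →ₗ[ℤ] M) := by
  obtain ⟨n, f, hf⟩ := Module.Finite.exists_fin' ℤ A
  refine Finite.of_injective (fun φ : A →ₗ[ℤ] M => fun i => φ (f (Pi.single i 1))) ?_
  intro φ ψ h
  have : φ ∘ₗ f = ψ ∘ₗ f := by
    refine LinearMap.pi_ext' fun i => LinearMap.ext_ring ?_
    exact congrFun h i
  ext a
  obtain ⟨x, rfl⟩ := hf a
  exact LinearMap.congr_fun this x

variable {G : Type u} [Group G]

section

variable (M : Type u) [AddCommGroup M]

variable (G) in
/-- `Hom_ℤ(A, M)` with its action of `G`. -/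
abbrev homRep [Module (MonoidAlgebra ℤ G) M] (A : Type*) [AddCommGroup A] [Module (MonoidAlgebra ℤ G) A] :
    Representation ℤ G (A →ₗ[ℤ] M) :=
  Representation.linHom (modRep G A) (modRep G M)

theorem homRep_apply [Module (MonoidAlgebra ℤ G) M] (A : Type*) [AddCommGroup A] [Module (MonoidAlgebra ℤ G) A] (g : G)
    (φ : A →ₗ[ℤ] M) (a : A) :
    homRep G M A g φ a = MonoidAlgebra.of ℤ G g • φ (MonoidAlgebra.of ℤ G g⁻¹ • a) := by
  rw [Representation.linHom_apply, LinearMap.comp_apply, LinearMap.comp_apply, modRep_apply,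
    modRep_apply]

instance finite_homRep [Module (MonoidAlgebra ℤ G) M] [Finite G] [Finite M] (A : Type*) [AddCommGroup A]
    [Module (MonoidAlgebra ℤ G) A] [Module.Finite (MonoidAlgebra ℤ G) A] :
    Module.Finite (MonoidAlgebra ℤ G) (homRep G M A).asModule :=
  have := IntegralDual.finite_int (G := G) A
  have := finite_hom (A := A) (M := M)
  inferInstance

/-- Restriction of homomorphisms. -/
def precomp {A B : Type*} [AddCommGroup A] [AddCommGroup B] [Module (MonoidAlgebra ℤ G) A]
    [Module (MonoidAlgebra ℤ G) B] (f : A →ₗ[MonoidAlgebra ℤ G] B) : (B →ₗ[ℤ] M) →+ (A →ₗ[ℤ] M) where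
  toFun φ := φ ∘ₗ f.restrictScalars ℤ
  map_zero' := rfl
  map_add' _ _ := rfl

theorem precomp_apply {A B : Type*} [AddCommGroup A] [AddCommGroup B]
    [Module (MonoidAlgebra ℤ G) A] [Module (MonoidAlgebra ℤ G) B]
    (f : A →ₗ[MonoidAlgebra ℤ G] B) (φ : B →ₗ[ℤ] M) (a : A) : precomp M f φ a = φ (f a) := rfl

theorem precomp_homRep [Module (MonoidAlgebra ℤ G) M] {A B : Type*} [AddCommGroup A] [AddCommGroup B]
    [Module (MonoidAlgebra ℤ G) A] [Module (MonoidAlgebra ℤ G) B]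
    (f : A →ₗ[MonoidAlgebra ℤ G] B) (g : G) (φ : B →ₗ[ℤ] M) :
    precomp M f (homRep G M B g φ) = homRep G M A g (precomp M f φ) := by
  ext a
  rw [precomp_apply, homRep_apply, homRep_apply, precomp_apply, f.map_smul]

end

variable [Finite G] (M : Type u) [AddCommGroup M] [Module (MonoidAlgebra ℤ G) M] [Finite M]

/-- As C is free over ℤ the sequence splits over ℤ, so Hom_ℤ(-, M) keeps it exact. -/
theorem homCls_of_exact {A B C : Type u} [AddCommGroup A] [AddCommGroup B] [AddCommGroup C]
    [Module (MonoidAlgebra ℤ G) A] [Module (MonoidAlgebra ℤ G) B] [Module (MonoidAlgebra ℤ G) C]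
    [Module.Finite (MonoidAlgebra ℤ G) A] [Module.Finite (MonoidAlgebra ℤ G) B]
    [Module.Finite (MonoidAlgebra ℤ G) C] [Module.Free ℤ C]
    (f : A →ₗ[MonoidAlgebra ℤ G] B) (g : B →ₗ[MonoidAlgebra ℤ G] C)
    (hf : Function.Injective f) (hfg : Function.Exact f g) (hg : Function.Surjective g) :
    clsRep (homRep G M B) = clsRep (homRep G M A) + clsRep (homRep G M C) := by
  rw [add_comm]
  refine clsRep_of_exact (precomp M g) (precomp M f) (precomp_homRep M g) (precomp_homRep M f)
    ?_ ?_ ?_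
  · intro φ ψ h
    ext c
    obtain ⟨b, rfl⟩ := hg c
    exact LinearMap.congr_fun h b
  · intro φ
    constructor
    · intro h
      have hk : LinearMap.ker (g.restrictScalars ℤ) ≤ LinearMap.ker φ := by
        intro b hb
        obtain ⟨a, rfl⟩ := (hfg b).1 hb
        exact LinearMap.congr_fun h a
      obtain ⟨s, hs⟩ := Module.projective_lifting_property (g.restrictScalars ℤ)
        (LinearMap.id : C →ₗ[ℤ] C) hg
      refine ⟨φ ∘ₗ s, LinearMap.ext fun b => ?_⟩
      have : g (s (g b) - b) = 0 := by
        rw [map_sub, sub_eq_zero]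
        exact LinearMap.congr_fun hs (g b)
      have h2 : φ (s (g b) - b) = 0 := hk this
      rw [map_sub, sub_eq_zero] at h2
      exact h2
    · rintro ⟨ψ, rfl⟩
      ext a
      rw [precomp_apply, precomp_apply, hfg.apply_apply_eq_zero, map_zero, LinearMap.zero_apply]
  · intro φ
    obtain ⟨s, hs⟩ := Module.projective_lifting_property (g.restrictScalars ℤ)
      (LinearMap.id : C →ₗ[ℤ] C) hg
    have hr : ∀ b : B, ∃ a : A, f a = b - s (g b) := fun b => (hfg _).1 (by
      rw [map_sub, sub_eq_zero]
      exact (LinearMap.congr_fun hs (g b)).symm)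
    choose r hr using hr
    let rl : B →+ A :=
      { toFun := r
        map_zero' := hf (by simp [hr])
        map_add' := fun x y => hf (by simp only [map_add, hr]; abel) }
    refine ⟨φ ∘ₗ rl.toIntLinearMap, LinearMap.ext fun a => ?_⟩
    have : r (f a) = a := hf (by rw [hr, hfg.apply_apply_eq_zero, map_zero, sub_zero])
    exact congrArg φ this

/-- Multiplication by n is invertible on M, so a homomorphism on A extends uniquely to B: apply it
to n • b and divide by n. -/
theorem homCls_eq_of_coprime {A B : Type u} [AddCommGroup A] [AddCommGroup B]
    [Module (MonoidAlgebra ℤ G) A] [Module (MonoidAlgebra ℤ G) B]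
    [Module.Finite (MonoidAlgebra ℤ G) A] [Module.Finite (MonoidAlgebra ℤ G) B]
    (p : ℕ) (hM : ∀ m : M, p • m = 0) (n : ℕ) (hn : n.Coprime p)
    (f : A →ₗ[MonoidAlgebra ℤ G] B) (hf : Function.Injective f)
    (hB : ∀ b, ∃ a, f a = n • b) : clsRep (homRep G M B) = clsRep (homRep G M A) := by
  obtain ⟨k, hk⟩ : ∃ k : ℤ, ∀ m : M, k • n • m = m := by
    refine ⟨Nat.gcdA n p, fun m => ?_⟩
    have := Nat.gcd_eq_gcd_ab n p
    rw [hn] at this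
    have h2 : ((1 : ℕ) : ℤ) • m = m := by simp
    rw [this, add_smul, mul_comm, mul_smul, mul_comm, mul_smul, natCast_zsmul, natCast_zsmul, hM,
      smul_zero, add_zero] at h2
    exact h2
  choose r hr using hB
  let rl : B →+ A :=
    { toFun := r
      map_zero' := hf (by simp [hr])
      map_add' := fun x y => hf (by simp only [map_add, hr, smul_add]) }
  refine clsRep_congr (AddEquiv.ofBijective (precomp M f) ⟨?_, ?_⟩) (precomp_homRep M f)
  · intro φ ψ h
    ext b
    have := LinearMap.congr_fun h (r b)
    rw [precomp_apply, precomp_apply, hr, map_nsmul, map_nsmul] at this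
    rw [← hk (φ b), this, hk]
  · intro φ
    refine ⟨k • (φ ∘ₗ rl.toIntLinearMap), LinearMap.ext fun a => ?_⟩
    have : r (f a) = n • a := hf (by rw [hr, map_nsmul])
    change k • φ (r (f a)) = φ a
    rw [this, map_nsmul, hk]

/-- With Q = B/A, the restriction map Hom(B, M) → Hom(A, M) has kernel Hom(Q, M) and cokernel
Ext¹(Q, M). As p kills Q and M, the cokernel is again Hom(Q, M), by the explicit map `s`, so the two
contributions cancel. -/
theorem homCls_eq_of_prime {A B : Type u} [AddCommGroup A] [AddCommGroup B]
    [Module (MonoidAlgebra ℤ G) A] [Module (MonoidAlgebra ℤ G) B]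
    [Module.Finite (MonoidAlgebra ℤ G) A] [Module.Finite (MonoidAlgebra ℤ G) B] [Module.Free ℤ B]
    (p : ℕ) [hp : Fact p.Prime] (hM : ∀ m : M, p • m = 0)
    (f : A →ₗ[MonoidAlgebra ℤ G] B) (hf : Function.Injective f)
    (hB : ∀ b, ∃ a, f a = p • b) : clsRep (homRep G M B) = clsRep (homRep G M A) := by
  let Q := B ⧸ LinearMap.range f
  let q : B →ₗ[MonoidAlgebra ℤ G] Q := (LinearMap.range f).mkQ
  have hqf : ∀ a, q (f a) = 0 := fun a => (Submodule.Quotient.mk_eq_zero _).2 ⟨a, rfl⟩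
  have hq : Function.Surjective q := Submodule.mkQ_surjective _
  choose r hr using hB
  let r' : B →ₗ[MonoidAlgebra ℤ G] A :=
    { toFun := r
      map_add' := fun x y => hf (by simp only [map_add, hr, smul_add])
      map_smul' := fun c x => hf (by simp only [map_smul, hr, RingHom.id_apply, smul_comm p c]) }
  have hr' : ∀ b, f (r' b) = p • b := hr
  -- `φ ↦ (b mod A ↦ φ (p b))`
  let s : (A →ₗ[ℤ] M) →+ (Q →ₗ[ℤ] M) :=
    { toFun := fun φ => Submodule.liftQ ((LinearMap.range f).restrictScalars ℤ)
        (φ ∘ₗ r'.restrictScalars ℤ) (by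
          rintro _ ⟨a, rfl⟩
          change φ (r' (f a)) = 0
          have : r' (f a) = p • a := hf (by rw [hr', map_nsmul])
          rw [this, map_nsmul, hM])
      map_zero' := LinearMap.ext fun b => by obtain ⟨b, rfl⟩ := hq b; rfl
      map_add' := fun _ _ => LinearMap.ext fun b => by obtain ⟨b, rfl⟩ := hq b; rfl }
  have hs : ∀ φ b, s φ (q b) = φ (r' b) := fun _ _ => rfl
  -- The image of restriction is at once the quotient of Hom(B, M) by Hom(Q, M) and the kernel of
  -- `s`; it is shared by the two exact sequences below.
  let R := (precomp M f).range.toIntSubmodule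
  have hRmem : ∀ φ, φ ∈ R ↔ ∃ ψ, precomp M f ψ = φ := fun _ => Iff.rfl
  let ρR : Representation ℤ G R := (homRep G M A).subrepresentation R (by
    rintro g _ ⟨ψ, rfl⟩
    exact ⟨homRep G M B g ψ, precomp_homRep M f g ψ⟩)
  have hfinR : Finite R :=
    have := IntegralDual.finite_int (G := G) A
    have := finite_hom (A := A) (M := M)
    inferInstance
  have e1 : clsRep (homRep G M B) = clsRep (homRep G M Q) + clsRep ρR := by
    refine clsRep_of_exact (precomp M q) (precomp M f).rangeRestrict (precomp_homRep M q)
      (fun g φ => Subtype.ext (precomp_homRep M f g φ)) ?_ ?_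
      (precomp M f).rangeRestrict_surjective
    · intro φ ψ h
      refine LinearMap.ext fun c => ?_
      obtain ⟨b, rfl⟩ := hq c
      exact LinearMap.congr_fun h b
    · intro φ
      rw [Subtype.ext_iff]
      constructor
      · intro h
        refine ⟨Submodule.liftQ ((LinearMap.range f).restrictScalars ℤ) φ ?_, rfl⟩
        rintro _ ⟨a, rfl⟩
        exact LinearMap.congr_fun h a
      · rintro ⟨ψ, rfl⟩
        ext a
        change ψ (q (f a)) = 0
        rw [hqf, map_zero]
  have e2 : clsRep (homRep G M A) = clsRep ρR + clsRep (homRep G M Q) := by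
    refine clsRep_of_exact R.subtype.toAddMonoidHom s (fun _ _ => rfl) ?_ Subtype.val_injective
      ?_ ?_
    · intro g φ
      refine LinearMap.ext fun b => ?_
      obtain ⟨b, rfl⟩ := hq b
      rw [hs, homRep_apply, homRep_apply, ← q.map_smul, ← r'.map_smul, hs]
    · intro φ
      have : (∃ a : R, R.subtype.toAddMonoidHom a = φ) ↔ ∃ ψ, precomp M f ψ = φ :=
        ⟨fun ⟨⟨x, ψ, hψ⟩, hx⟩ => ⟨ψ, hψ.trans hx⟩, fun ⟨ψ, hψ⟩ => ⟨⟨φ, ψ, hψ⟩, rfl⟩⟩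
      rw [this]
      constructor
      · intro h
        -- If f a = p • b, then a = r' b, so φ a is the value of s φ at the class of b, which is
        -- zero. This is the extension criterion.
        obtain ⟨ψ, hψ⟩ := exists_extension_of_exponent_prime p hM f.toAddMonoidHom φ.toAddMonoidHom
          (fun a b hab => by
            have h1 : r' b = a := hf ((hr' b).trans hab.symm)
            have h2 := LinearMap.congr_fun h (q b)
            rw [hs, h1] at h2
            exact h2)
        exact ⟨ψ.toIntLinearMap, LinearMap.ext hψ⟩
      · rintro ⟨ψ, rfl⟩
        refine LinearMap.ext fun b => ?_
        obtain ⟨b, rfl⟩ := hq b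
        rw [hs, precomp_apply, hr', map_nsmul, hM]
        rfl
    · intro ψ
      -- The same criterion along r' : B → A. If r' b = p • a, then p • b = p • f a, so b = f a
      -- because B is torsion-free, and ψ vanishes on the class of b.
      obtain ⟨φ, hφ⟩ := exists_extension_of_exponent_prime p hM r'.toAddMonoidHom
        (precomp M q ψ).toAddMonoidHom (fun b a hab => by
          have h1 : p • b = p • f a := by
            rw [← hr', ← map_nsmul]
            exact congrArg f hab
          have h2 : b = f a := by
            rw [← sub_eq_zero, ← smul_sub, ← natCast_zsmul, smul_eq_zero] at h1
            exact sub_eq_zero.1 (h1.resolve_left (by exact_mod_cast hp.out.ne_zero))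
          change ψ (q b) = 0
          rw [h2, hqf, map_zero])
      refine ⟨φ.toIntLinearMap, LinearMap.ext fun b => ?_⟩
      obtain ⟨b, rfl⟩ := hq b
      exact hφ b
  rw [e1, e2, add_comm]

theorem homCls_eq_of_pow_mul (p : ℕ) [hp : Fact p.Prime] (hM : ∀ m : M, p • m = 0)
    {A B : Type u} [AddCommGroup A] [AddCommGroup B]
    [Module (MonoidAlgebra ℤ G) A] [Module (MonoidAlgebra ℤ G) B]
    [Module.Finite (MonoidAlgebra ℤ G) A] [Module.Finite (MonoidAlgebra ℤ G) B]
    [Module.Free ℤ B] (f : A →ₗ[MonoidAlgebra ℤ G] B) (hf : Function.Injective f) (k n : ℕ)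
    (hn : n.Coprime p) (hB : ∀ b, ∃ a, f a = (p ^ k * n) • b) :
    clsRep (homRep G M B) = clsRep (homRep G M A) := by
  induction k generalizing B with
  | zero => exact homCls_eq_of_coprime M p hM n hn f hf (by simpa using hB)
  | succ k ih =>
    -- With C = A + pB, the inclusion of C in B has cokernel killed by p, while p ^ k * n already
    -- kills C/A. So one power of p is removed.
    let C : Submodule (MonoidAlgebra ℤ G) B :=
      LinearMap.range f ⊔ LinearMap.range (p • (LinearMap.id : B →ₗ[MonoidAlgebra ℤ G] B))
    have := IntegralDual.free_submodule C
    have h1 := homCls_eq_of_prime M p hM C.subtype C.injective_subtype (fun b =>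
      ⟨⟨p • b, Submodule.mem_sup_right ⟨b, rfl⟩⟩, rfl⟩)
    rw [h1]
    have hfC : ∀ a, f a ∈ C := fun a => Submodule.mem_sup_left ⟨a, rfl⟩
    refine ih (f.codRestrict C hfC) (fun x y h => hf (congrArg Subtype.val h)) ?_
    rintro ⟨b, hb⟩
    obtain ⟨_, ⟨a, rfl⟩, _, ⟨b', rfl⟩, rfl⟩ := Submodule.mem_sup.1 hb
    obtain ⟨a', ha'⟩ := hB b'
    refine ⟨(p ^ k * n) • a + a', Subtype.ext ?_⟩
    change f ((p ^ k * n) • a + a') = (p ^ k * n) • (f a + p • b')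
    rw [map_add, map_nsmul, ha', smul_add, smul_smul]
    congr 2
    ring

theorem homCls_eq_of_finite_index (p : ℕ) [hp : Fact p.Prime] (hM : ∀ m : M, p • m = 0)
    {A B : Type u} [AddCommGroup A] [AddCommGroup B]
    [Module (MonoidAlgebra ℤ G) A] [Module (MonoidAlgebra ℤ G) B]
    [Module.Finite (MonoidAlgebra ℤ G) A] [Module.Finite (MonoidAlgebra ℤ G) B]
    [Module.Free ℤ B] (f : A →ₗ[MonoidAlgebra ℤ G] B) (hf : Function.Injective f)
    [Finite (B ⧸ LinearMap.range f)] : clsRep (homRep G M B) = clsRep (homRep G M A) := by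
  obtain ⟨k, n, hn, hB⟩ : ∃ k n : ℕ, n.Coprime p ∧ ∀ b, ∃ a, f a = (p ^ k * n) • b := by
    obtain ⟨k, n, hn, h⟩ := Nat.exists_eq_pow_mul_and_not_dvd
      (Nat.card_pos (α := B ⧸ LinearMap.range f)).ne' p hp.out.ne_one
    refine ⟨k, n, ((Nat.Prime.coprime_iff_not_dvd hp.out).2 hn).symm, fun b => ?_⟩
    rw [← h]
    have : Submodule.Quotient.mk (p := LinearMap.range f)
        ((Nat.card (B ⧸ LinearMap.range f)) • b) = 0 := by
      rw [Submodule.Quotient.mk_smul]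
      exact card_nsmul_eq_zero'
    exact (Submodule.Quotient.mk_eq_zero _).1 this
  exact homCls_eq_of_pow_mul M p hM f hf k n hn hB

/-- The function `A ↦ [Hom_ℤ(A, M)]`. -/
def homFun (A : FGModuleCat.{u} (MonoidAlgebra ℤ G)) : G0 (MonoidAlgebra ℤ G) :=
  clsRep (homRep G M A)

/-- For `M` of prime exponent, the class of `Hom_ℤ(A, M)` only depends on the character of the
lattice `A`. -/
theorem homCls_eq_of_chi_eq (p : ℕ) [hp : Fact p.Prime] (hM : ∀ m : M, p • m = 0)
    {A B : Type u} [AddCommGroup A] [AddCommGroup B]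
    [Module (MonoidAlgebra ℤ G) A] [Module (MonoidAlgebra ℤ G) B]
    [Module.Finite (MonoidAlgebra ℤ G) A] [Module.Finite (MonoidAlgebra ℤ G) B]
    [Module.Free ℤ A] [Module.Free ℤ B]
    (h : ∀ g : G, LatticeTrace.chi A g = LatticeTrace.chi B g) :
    clsRep (homRep G M A) = clsRep (homRep G M B) := by
  change homFun M (.of _ A) = homFun M (.of _ B)
  refine LatticeTrace.eq_of_chi_eq (homFun M) ?_ ?_ A B h
  · intro A B C f g _ _ _ hf hfg hg
    exact homCls_of_exact M f g hf hfg hg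
  · intro A B f _ _ hf _
    exact (homCls_eq_of_finite_index M p hM f hf).symm

end HomClass

/-! ### Permutation modules and their characters -/

section PermutationModules

open G0 LatticeTrace HomClass

variable {G : Type u} [Group G]

variable (G) in
/-- The permutation module `ℤ[X]`. -/
abbrev permRep (X : Type*) [MulAction G X] : Representation ℤ G (MonoidAlgebra ℤ X) :=
  Representation.ofMulAction ℤ G X

variable (G) in
/-- The permutation module `ℤ[X]`, as a module over `ℤ[G]`. -/
abbrev PermMod (X : Type*) [MulAction G X] : Type _ := (permRep G X).asModule

instance free_monoidAlgebra (X : Type*) : Module.Free ℤ (MonoidAlgebra ℤ X) :=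
  Module.Free.of_basis (MonoidAlgebra.basis X ℤ)

instance finite_monoidAlgebra (X : Type*) [Finite X] : Module.Finite ℤ (MonoidAlgebra ℤ X) :=
  Module.Finite.of_basis (MonoidAlgebra.basis X ℤ)

instance free_permMod (X : Type*) [MulAction G X] : Module.Free ℤ (PermMod G X) :=
  free_monoidAlgebra X

/-- The character of a permutation module counts fixed points. -/
theorem trace_permRep (X : Type*) [MulAction G X] [Finite X] (g : G) :
    LinearMap.trace ℤ (MonoidAlgebra ℤ X) (permRep G X g) = Nat.card {x : X // g • x = x} := by
  classical
  have := Fintype.ofFinite X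
  rw [LinearMap.trace_eq_matrix_trace ℤ (MonoidAlgebra.basis X ℤ), Matrix.trace, Nat.card_eq_fintype_card,
    Fintype.card_subtype, Finset.card_filter, Nat.cast_sum]
  refine Finset.sum_congr rfl fun x _ => ?_
  rw [Matrix.diag_apply, LinearMap.toMatrix_apply, MonoidAlgebra.basis_apply,
    Representation.ofMulAction_single]
  change (MonoidAlgebra.single (g • x) 1 : MonoidAlgebra ℤ X).coeff x = _
  simp [Finsupp.single_apply]

theorem chi_asModule {A : Type*} [AddCommGroup A] (ρ : Representation ℤ G A) (g : G) :
    chi ρ.asModule g = LinearMap.trace ℤ A (ρ g) := by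
  let e : ρ.asModule ≃+ A := ρ.asModuleEquiv.toAddEquiv
  have he : ∀ x, e (modRep G ρ.asModule g x) = ρ g (e x) := fun x => by
    rw [modRep_apply]
    exact (ρ.asModuleEquiv_map_smul _ _).trans (by rw [Representation.asAlgebraHom_of]; rfl)
  rw [chi]
  exact trace_eq_of_equiv e.toIntLinearEquiv _ _ he

theorem chi_permMod (X : Type*) [MulAction G X] [Finite X] (g : G) :
    chi (PermMod G X) g = Nat.card {x : X // g • x = x} := by
  rw [chi_asModule, trace_permRep]

/-- Homomorphisms from a permutation module are functions. -/
theorem permMod_hom_ext {X M : Type*} [MulAction G X] [AddCommGroup M]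
    {φ ψ : PermMod G X →ₗ[ℤ] M}
    (h : ∀ x, φ ((permRep G X).asModuleEquiv.symm (MonoidAlgebra.single x 1)) =
      ψ ((permRep G X).asModuleEquiv.symm (MonoidAlgebra.single x 1))) : φ = ψ := by
  have : φ.toAddMonoidHom = ψ.toAddMonoidHom := by
    let φ' : MonoidAlgebra ℤ X →ₗ[ℤ] M := φ.toAddMonoidHom.toIntLinearMap
    let ψ' : MonoidAlgebra ℤ X →ₗ[ℤ] M := ψ.toAddMonoidHom.toIntLinearMap
    have h' : φ' = ψ' := (MonoidAlgebra.basis X ℤ).ext h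
    exact congrArg LinearMap.toAddMonoidHom h'
  exact LinearMap.ext fun x => DFunLike.congr_fun this x

/-- The homomorphism from a permutation module with given values. -/
def permModLift (G : Type*) [Group G] {X M : Type*} [MulAction G X] [AddCommGroup M] (v : X → M) :
    PermMod G X →ₗ[ℤ] M :=
  AddMonoidHom.toIntLinearMap
    (((MonoidAlgebra.basis X ℤ).constr ℤ v).toAddMonoidHom : MonoidAlgebra ℤ X →+ M)

theorem permModLift_single {X M : Type*} [MulAction G X] [AddCommGroup M] (v : X → M) (x : X) :
    permModLift G v ((permRep G X).asModuleEquiv.symm (MonoidAlgebra.single x 1)) = v x :=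
  (MonoidAlgebra.basis X ℤ).constr_basis ℤ v x

theorem of_smul_single {X : Type*} [MulAction G X] (g : G) (x : X) :
    MonoidAlgebra.of ℤ G g • (permRep G X).asModuleEquiv.symm (MonoidAlgebra.single x 1) =
      (permRep G X).asModuleEquiv.symm (MonoidAlgebra.single (g • x) 1) := by
  rw [← Representation.asModuleEquiv_symm_map_rho, Representation.ofMulAction_single]

end PermutationModules

/-! ### Coinduction from a subgroup -/

section Coinduction

open G0

variable {G : Type u} [Group G] (H : Subgroup G)

instance finite_coindV [Finite G] {A : Type*} [AddCommGroup A] [Module.Finite ℤ A]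
    (ρ : Representation ℤ H A) : Module.Finite ℤ (Representation.coindV H.subtype ρ) :=
  inferInstance

/-- The homomorphism between coinduced modules induced by an equivariant homomorphism. -/
def coindHom {A B : Type*} [AddCommGroup A] [AddCommGroup B] {ρ : Representation ℤ H A}
    {σ : Representation ℤ H B} (f : A →+ B) (hf : ∀ h a, f (ρ h a) = σ h (f a)) :
    Representation.coindV H.subtype ρ →+ Representation.coindV H.subtype σ where
  toFun φ := ⟨fun x => f (φ.1 x), fun h x => (congrArg f (φ.2 h x)).trans (hf _ _)⟩
  map_zero' := Subtype.ext (funext fun _ => f.map_zero)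
  map_add' _ _ := Subtype.ext (funext fun _ => f.map_add _ _)

/-- G is a free left H-set, so a coinduced function is determined by arbitrary values on
representatives of the cosets Hx. Lift those values and propagate them by H. -/
theorem coindHom_surjective {A B : Type*} [AddCommGroup A] [AddCommGroup B]
    {ρ : Representation ℤ H A} {σ : Representation ℤ H B} (f : A →+ B)
    (hf : ∀ h a, f (ρ h a) = σ h (f a)) (hs : Function.Surjective f) :
    Function.Surjective (coindHom H f hf) := by
  intro φ
  choose s hs using hs
  let t : G → G := fun x => (Quotient.mk (QuotientGroup.rightRel H) x).out
  have ht : ∀ x, x * (t x)⁻¹ ∈ H := fun x =>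
    QuotientGroup.rightRel_apply.1 (Quotient.mk_out (s := QuotientGroup.rightRel H) x)
  have ht2 : ∀ (h : H) x, t (h * x) = t x := fun h x => congrArg Quotient.out (Quotient.sound
    (s := QuotientGroup.rightRel H) (QuotientGroup.rightRel_apply.2 (by simp)))
  refine ⟨⟨fun x => ρ ⟨_, ht x⟩ (s (φ.1 (t x))), fun h x => ?_⟩, ?_⟩
  · have e : (⟨_, ht (h * x)⟩ : H) = h * ⟨_, ht x⟩ := by
      ext
      simp only [Subgroup.coe_mul, ht2, mul_assoc]
    change ρ ⟨_, ht (h * x)⟩ (s (φ.1 (t (h * x)))) = ρ h (ρ ⟨_, ht x⟩ (s (φ.1 (t x))))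
    rw [e, ht2, map_mul]
    rfl
  · refine Subtype.ext (funext fun x => ?_)
    change f (ρ ⟨_, ht x⟩ (s (φ.1 (t x)))) = φ.1 x
    rw [hf, hs]
    refine (φ.2 ⟨_, ht x⟩ (t x)).symm.trans (congrArg φ.1 ?_)
    simp

variable [Finite G]

theorem clsRep_coind_of_exact {A B C : Type u} [AddCommGroup A] [AddCommGroup B] [AddCommGroup C]
    {ρA : Representation ℤ H A} {ρB : Representation ℤ H B} {ρC : Representation ℤ H C}
    [Module.Finite ℤ A] [Module.Finite ℤ B] [Module.Finite ℤ C]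
    (f : A →+ B) (g : B →+ C)
    (hf : ∀ s a, f (ρA s a) = ρB s (f a)) (hg : ∀ s a, g (ρB s a) = ρC s (g a))
    (hi : Function.Injective f) (he : ∀ b, g b = 0 ↔ ∃ a, f a = b) (hs : Function.Surjective g) :
    clsRep (Representation.coind H.subtype ρB) = clsRep (Representation.coind H.subtype ρA) +
      clsRep (Representation.coind H.subtype ρC) := by
  refine clsRep_of_exact (coindHom H f hf) (coindHom H g hg) (fun _ _ => rfl) (fun _ _ => rfl)
    ?_ ?_ (coindHom_surjective H g hg hs)
  · intro φ ψ h
    exact Subtype.ext (funext fun x => hi (congrFun (congrArg Subtype.val h) x))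
  · intro φ
    constructor
    · intro h
      choose r hr using fun x => (he (φ.1 x)).1 (congrFun (congrArg Subtype.val h) x)
      exact ⟨⟨r, fun k x => hi (by rw [hr, hf, hr, φ.2])⟩, Subtype.ext (funext hr)⟩
    · rintro ⟨ψ, rfl⟩
      exact Subtype.ext (funext fun x => (he _).2 ⟨_, rfl⟩)

/-- Coinduction on Grothendieck groups. -/
def coindG0 : G0 (MonoidAlgebra ℤ H) →+ G0 (MonoidAlgebra ℤ G) :=
  G0.lift (fun M =>
    have := IntegralDual.finite_int (G := H) M
    clsRep (Representation.coind H.subtype (modRep H M)))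
    (fun A B C f g hf hfg hg => by
      have := IntegralDual.finite_int (G := H) A
      have := IntegralDual.finite_int (G := H) B
      have := IntegralDual.finite_int (G := H) C
      exact clsRep_coind_of_exact H f.toAddMonoidHom g.toAddMonoidHom (fun _ _ => by simp)
        (fun _ _ => by simp) hf hfg hg)

theorem coindG0_clsRep {A : Type u} [AddCommGroup A] [Module.Finite ℤ A]
    (σ : Representation ℤ H A) :
    coindG0 H (clsRep σ) = clsRep (Representation.coind H.subtype σ) := by
  have := IntegralDual.finite_int (G := H) σ.asModule
  refine (G0.lift_cls _ _ _).trans ?_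
  refine clsRep_congr (AddEquiv.ofBijective (coindHom H (ρ := modRep H σ.asModule) (σ := σ)
    σ.asModuleEquiv.toAddMonoidHom
    (fun g x => congrArg σ.asModuleEquiv (modRep_asModule σ g (σ.asModuleEquiv x)))) ⟨?_, ?_⟩)
    (fun _ _ => rfl)
  · intro φ ψ h
    exact Subtype.ext (funext fun x => congrFun (congrArg Subtype.val h) x)
  · exact coindHom_surjective H _ _ σ.asModuleEquiv.surjective

open HomClass in
/-- `Hom_ℤ(ℤ[G/H], M)` is coinduced from the restriction of `M` to `H`. -/
theorem clsRep_homRep_permMod (M : Type u) [AddCommGroup M] [Module (MonoidAlgebra ℤ G) M]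
    [Finite M] :
    clsRep (homRep G M (PermMod G (G ⧸ H))) =
      coindG0 H (clsRep ((modRep G M).comp H.subtype)) := by
  rw [coindG0_clsRep]
  let b : G → PermMod G (G ⧸ H) := fun x =>
    (permRep G (G ⧸ H)).asModuleEquiv.symm (MonoidAlgebra.single (x : G ⧸ H) 1)
  have hb : ∀ g x, MonoidAlgebra.of ℤ G g • b x = b (g * x) := fun g x =>
    of_smul_single g (x : G ⧸ H)
  have hbH : ∀ x (h : H), b (x * h) = b x := fun x h => by
    have : ((x * h : G) : G ⧸ H) = x := QuotientGroup.mk_mul_of_mem x h.2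
    simp only [b, this]
  -- The homomorphism φ is sent to x ↦ x • φ(x⁻¹H). The inverse in the argument turns left cosets
  -- into the left H-equivariance required of a coinduced function.
  let F : (PermMod G (G ⧸ H) →ₗ[ℤ] M) →+
      Representation.coindV H.subtype ((modRep G M).comp H.subtype) :=
    { toFun := fun φ => ⟨fun x => MonoidAlgebra.of ℤ G x • φ (b x⁻¹), fun h x => by
        change MonoidAlgebra.of ℤ G (h * x) • φ (b (h * x)⁻¹) =
          modRep G M (h : G) (MonoidAlgebra.of ℤ G x • φ (b x⁻¹))
        rw [modRep_apply, mul_inv_rev, ← Subgroup.coe_inv, hbH, map_mul, mul_smul]⟩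
      map_zero' := Subtype.ext (funext fun x => smul_zero _)
      map_add' := fun φ ψ => Subtype.ext (funext fun x => smul_add _ _ _) }
  refine clsRep_congr (AddEquiv.ofBijective F ⟨?_, ?_⟩) ?_
  · intro φ ψ h
    refine permMod_hom_ext fun x => ?_
    obtain ⟨x, rfl⟩ := QuotientGroup.mk_surjective x
    have := congrFun (congrArg Subtype.val h) x⁻¹
    change MonoidAlgebra.of ℤ G x⁻¹ • φ (b x⁻¹⁻¹) = MonoidAlgebra.of ℤ G x⁻¹ • ψ (b x⁻¹⁻¹) at this
    have h2 := congrArg (fun m => MonoidAlgebra.of ℤ G x • m) this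
    simpa only [← mul_smul, ← map_mul, mul_inv_cancel, map_one, one_smul, inv_inv] using h2
  · intro f
    have hf : ∀ (h : H) x, f.1 (h * x) = MonoidAlgebra.of ℤ G (h : G) • f.1 x := fun h x =>
      (f.2 h x).trans (modRep_apply M (h : G) (f.1 x))
    refine ⟨permModLift G (fun x => Quotient.liftOn' x
      (fun x => MonoidAlgebra.of ℤ G x • f.1 x⁻¹) ?_), ?_⟩
    · intro x y hxy
      have hxy' : x⁻¹ * y ∈ H := QuotientGroup.leftRel_apply.1 hxy
      have := hf ⟨_, hxy'⟩ y⁻¹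
      simp only [mul_assoc, mul_inv_cancel, mul_one] at this
      simp only [this, ← mul_smul, ← map_mul, mul_inv_cancel_left]
    · refine Subtype.ext (funext fun x => ?_)
      change MonoidAlgebra.of ℤ G x • permModLift G _ (b x⁻¹) = f.1 x
      rw [permModLift_single]
      change MonoidAlgebra.of ℤ G x • MonoidAlgebra.of ℤ G x⁻¹ • f.1 x⁻¹⁻¹ = f.1 x
      simp only [← mul_smul, ← map_mul, mul_inv_cancel, map_one, one_smul, inv_inv]
  · intro g φ
    refine Subtype.ext (funext fun x => ?_)
    change MonoidAlgebra.of ℤ G x • homRep G M _ g φ (b x⁻¹) =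
      MonoidAlgebra.of ℤ G (x * g) • φ (b (x * g)⁻¹)
    rw [homRep_apply, hb, mul_inv_rev, map_mul, mul_smul]

end Coinduction

/-! ### Finite modules over cyclic groups have torsion class -/

namespace G0

section SmallModules

variable {R : Type u} [Ring R]

variable (R) in
/-- The class of a finitely generated module that lives in the bottom universe. -/
def smallCls (M : Type) [AddCommGroup M] [Module R M] [Module.Finite R M] : G0 R :=
  cls R (ULift.{u} M)

/-- Rings of integers of cyclotomic fields live in `Type`, whereas `G0 R` is built from modules in
the universe of R; the lift is harmless because it preserves exactness. -/
theorem smallCls_of_exact {A B C : Type} [AddCommGroup A] [AddCommGroup B] [AddCommGroup C]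
    [Module R A] [Module R B] [Module R C]
    [Module.Finite R A] [Module.Finite R B] [Module.Finite R C]
    (f : A →ₗ[R] B) (g : B →ₗ[R] C) (hf : Function.Injective f) (hfg : Function.Exact f g)
    (hg : Function.Surjective g) : smallCls R B = smallCls R A + smallCls R C := by
  refine cls_of_exact
    (ULift.moduleEquiv.symm.toLinearMap ∘ₗ f ∘ₗ ULift.moduleEquiv.toLinearMap)
    (ULift.moduleEquiv.symm.toLinearMap ∘ₗ g ∘ₗ ULift.moduleEquiv.toLinearMap) ?_ ?_ ?_
  · rintro ⟨x⟩ ⟨y⟩ h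
    exact congrArg ULift.up (hf (congrArg ULift.down h))
  · rintro ⟨y⟩
    constructor
    · intro h
      obtain ⟨x, hx⟩ := (hfg y).1 (congrArg ULift.down h)
      exact ⟨⟨x⟩, congrArg ULift.up hx⟩
    · rintro ⟨⟨x⟩, hx⟩
      exact congrArg ULift.up ((hfg y).2 ⟨x, congrArg ULift.down hx⟩)
  · rintro ⟨z⟩
    obtain ⟨y, hy⟩ := hg z
    exact ⟨⟨y⟩, congrArg ULift.up hy⟩

theorem smallCls_congr {A B : Type} [AddCommGroup A] [AddCommGroup B] [Module R A] [Module R B]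
    [Module.Finite R A] [Module.Finite R B] (e : A ≃ₗ[R] B) : smallCls R A = smallCls R B :=
  cls_congr (ULift.moduleEquiv.trans (e.trans ULift.moduleEquiv.symm))

end SmallModules

section Dedekind

variable {R : Type u} [CommRing R] [IsNoetherianRing R] {A : Type} [CommRing A]
  [Algebra R A] [Module.Finite R A]

instance finite_ideal (I : Ideal A) : Module.Finite R I :=
  inferInstanceAs (Module.Finite R (I.restrictScalars R))

instance finite_quotient_ideal (I : Ideal A) : Module.Finite R (A ⧸ I) :=
  Module.Finite.of_surjective (I.mkQ.restrictScalars R) I.mkQ_surjective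

/-- The hypotheses say that I/J is generated by the class of a, with annihilator P. The class is
obtained from 0 → P → J × A → I → 0 and 0 → P → A → A/P → 0 without forming I/J. -/
theorem smallCls_eq_of_generator (I J P : Ideal A) (hJ : J ≤ I) (a : A) (ha : a ∈ I)
    (hker : ∀ x, x * a ∈ J ↔ x ∈ P) (hgen : ∀ c ∈ I, ∃ d, d * a - c ∈ J) :
    smallCls R I = smallCls R J + smallCls R (A ⧸ P) := by
  have e1 : smallCls R (J × A) = smallCls R J + smallCls R A :=
    smallCls_of_exact (LinearMap.inl R J A) (LinearMap.snd R J A) LinearMap.inl_injective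
      .inl_snd LinearMap.snd_surjective
  let i : P →ₗ[A] J × A :=
    { toFun := fun x => (⟨-(x * a), neg_mem ((hker x).2 x.2)⟩, x)
      map_add' := fun x y => Prod.ext (Subtype.ext (by simp; ring)) rfl
      map_smul' := fun c x => Prod.ext (Subtype.ext (by simp; ring)) rfl }
  let p : J × A →ₗ[A] I :=
    { toFun := fun x => ⟨x.1 + x.2 * a, add_mem (hJ x.1.2) (I.mul_mem_left _ ha)⟩
      map_add' := fun x y => Subtype.ext (by simp; ring)
      map_smul' := fun c x => Subtype.ext (by simp; ring) }
  have e2 : smallCls R (J × A) = smallCls R P + smallCls R I := by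
    refine smallCls_of_exact (i.restrictScalars R) (p.restrictScalars R) ?_ ?_ ?_
    · intro x y h
      exact Subtype.ext (congrArg Prod.snd h)
    · rintro ⟨⟨j, hj⟩, x⟩
      constructor
      · intro h
        have h' : j + x * a = 0 := congrArg Subtype.val h
        have hx : x * a = -j := by linear_combination h'
        refine ⟨⟨x, (hker x).1 (hx ▸ neg_mem hj)⟩, Prod.ext (Subtype.ext ?_) rfl⟩
        change -(x * a) = j
        rw [hx, neg_neg]
      · rintro ⟨y, hy⟩
        rw [← hy]
        exact Subtype.ext (neg_add_cancel (y.1 * a))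
    · rintro ⟨c, hc⟩
      obtain ⟨d, hd⟩ := hgen c hc
      refine ⟨(⟨c - d * a, by rw [← neg_sub]; exact neg_mem hd⟩, d), Subtype.ext ?_⟩
      exact sub_add_cancel c _
  have e3 : smallCls R A = smallCls R P + smallCls R (A ⧸ P) :=
    smallCls_of_exact (P.subtype.restrictScalars R) (P.mkQ.restrictScalars R)
      Subtype.val_injective (LinearMap.exact_subtype_mkQ P) P.mkQ_surjective
  rw [e1, e3, add_left_comm] at e2
  exact (add_left_cancel e2).symm

variable [IsDedekindDomain A]

/-- In a Dedekind domain P ^ k / P ^ (k + 1) is one-dimensional over A/P, generated by any element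
of P ^ k outside P ^ (k + 1). -/
theorem smallCls_pow_eq (P : Ideal A) [hP : P.IsPrime] (h0 : P ≠ ⊥) (k : ℕ) :
    smallCls R ↥(P ^ k) = smallCls R ↥(P ^ (k + 1)) + smallCls R (A ⧸ P) := by
  obtain ⟨a, ha, ha'⟩ := Ideal.exists_mem_pow_notMem_pow_succ P h0 hP.ne_top k
  refine smallCls_eq_of_generator _ _ P (Ideal.pow_le_pow_right k.le_succ) a ha ?_ ?_
  · intro x
    constructor
    · intro h
      rw [mul_comm] at h
      exact (Ideal.mem_prime_of_mul_mem_pow h0 ha' h)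
    · intro h
      rw [pow_succ']
      exact Ideal.mul_mem_mul h ha
  · intro c hc
    obtain ⟨d, e, he, hde⟩ := Ideal.exists_mul_add_mem_pow_succ h0 a c ha ha' hc
    refine ⟨d, ?_⟩
    rw [← hde, mul_comm d a, sub_add_cancel_left]
    exact neg_mem he

/-- The class of a residue field of a Dedekind domain with finite class group is torsion. -/
theorem smallCls_quotient_mem_torsion [Finite (ClassGroup A)] (P : Ideal A) [hP : P.IsPrime]
    (h0 : P ≠ ⊥) : smallCls R (A ⧸ P) ∈ AddCommGroup.torsion (G0 R) := by
  have hk : ∀ k, smallCls R A = smallCls R ↥(P ^ k) + k • smallCls R (A ⧸ P) := by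
    intro k
    induction k with
    | zero =>
      rw [zero_smul, add_zero, pow_zero, Ideal.one_eq_top]
      exact smallCls_congr (Submodule.topEquiv.restrictScalars R).symm
    | succ k ih => rw [ih, smallCls_pow_eq P h0 k, succ_nsmul]; abel
  let c : ClassGroup A := ClassGroup.mk0 ⟨P, mem_nonZeroDivisors_iff_ne_zero.2 h0⟩
  have hc : 0 < orderOf c := orderOf_pos c
  have hpr : (P ^ orderOf c).IsPrincipal := by
    have h := pow_orderOf_eq_one c
    rw [← map_pow] at h
    exact (ClassGroup.mk0_eq_one_iff _).1 h
  obtain ⟨x, hx⟩ := hpr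
  have hx0 : x ≠ 0 := by
    rintro rfl
    have : P ^ orderOf c = 0 := by rw [hx]; simp
    exact h0 (eq_zero_of_pow_eq_zero this)
  -- A nonzero principal ideal is isomorphic to A. So for the order h of the ideal class of P, the
  -- relation [A] = [P ^ h] + h[A/P] becomes h[A/P] = 0.
  have e : smallCls R ↥(P ^ orderOf c) = smallCls R A := by
    rw [hx]
    exact smallCls_congr ((LinearEquiv.toSpanNonzeroSingleton A A x hx0).restrictScalars R).symm
  have := hk (orderOf c)
  rw [e, left_eq_add] at this
  exact isOfFinAddOrder_iff_nsmul_eq_zero.2 ⟨_, hc, this⟩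

end Dedekind

section Cyclic

variable {C : Type u} [CommGroup C] [Finite C] [IsCyclic C]

/-- A residue field of `ℤ[C]`, for a finite cyclic group `C`, that is finite, has torsion class. -/
theorem cls_quotient_maximal_mem_torsion (I : Ideal (MonoidAlgebra ℤ C)) [hI : I.IsMaximal]
    [Finite (MonoidAlgebra ℤ C ⧸ I)] :
    cls (MonoidAlgebra ℤ C) (MonoidAlgebra ℤ C ⧸ I) ∈
      AddCommGroup.torsion (G0 (MonoidAlgebra ℤ C)) := by
  let _ : Field (MonoidAlgebra ℤ C ⧸ I) := Ideal.Quotient.field I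
  obtain ⟨c, hc⟩ := IsCyclic.exists_generator (α := C)
  set q := Ideal.Quotient.mk I
  set x := q (MonoidAlgebra.of ℤ C c) with hxdef
  set n := Nat.card C with hn
  have hn0 : 0 < n := Nat.card_pos
  have hx : x ^ n = 1 := by rw [hxdef, ← map_pow, ← map_pow, pow_card_eq_one', map_one, map_one]
  -- X ^ n - 1 is the product of the cyclotomic polynomials of the divisors of n, and the residue
  -- ring is a field, so one factor vanishes at x. The order of x may be a proper divisor of d if
  -- the characteristic divides n.
  have hcyc : ∃ d ∈ n.divisors,
      Polynomial.aeval x (Polynomial.cyclotomic d ℤ) = 0 := by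
    have h := congrArg (Polynomial.aeval x) (Polynomial.prod_cyclotomic_eq_X_pow_sub_one hn0 ℤ)
    rw [map_prod, map_sub, map_pow, Polynomial.aeval_X, map_one, hx, sub_self,
      Finset.prod_eq_zero_iff] at h
    exact h
  obtain ⟨d, hd, hxd⟩ := hcyc
  have hd0 : d ≠ 0 := (Nat.pos_of_mem_divisors hd).ne'
  have : NeZero d := ⟨hd0⟩
  let E := CyclotomicField d ℚ
  have : IsCyclotomicExtension {d} ℚ E := CyclotomicField.isCyclotomicExtension d ℚ
  have : NumberField E := IsCyclotomicExtension.numberField {d} ℚ E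
  have hζ : IsPrimitiveRoot (IsCyclotomicExtension.zeta d ℚ E) d :=
    IsCyclotomicExtension.zeta_spec d ℚ E
  have hζ' : IsPrimitiveRoot hζ.toInteger d := hζ.toInteger_isPrimitiveRoot
  let pb := hζ.integralPowerBasis
  have hgen : pb.gen = hζ.toInteger := hζ.integralPowerBasis_gen
  have hmin : minpoly ℤ pb.gen = Polynomial.cyclotomic d ℤ := by
    rw [hgen, Polynomial.cyclotomic_eq_minpoly hζ (Nat.pos_of_ne_zero hd0)]
    exact (minpoly.algebraMap_eq (B := 𝓞 E) (B' := E) (FaithfulSMul.algebraMap_injective _ _) _).symm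
  -- The ring of integers is ℤ[ζ], with minimal polynomial the cyclotomic one, so ζ ↦ x defines a
  -- ring homomorphism. It factors the quotient map of ℤ[C] through c ↦ ζ, exhibiting the residue
  -- field of ℤ[C] as one of 𝓞 E.
  let ψ : 𝓞 E →ₐ[ℤ] (MonoidAlgebra ℤ C ⧸ I) := pb.lift x (by rw [hmin]; exact hxd)
  have hψ : ψ hζ.toInteger = x := by rw [← hgen]; exact pb.lift_gen _ _
  let u : (𝓞 E)ˣ := hζ'.isUnit hd0 |>.unit
  have hu : orderOf u ∣ orderOf c := by
    rw [orderOf_eq_card_of_forall_mem_zpowers hc]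
    refine orderOf_dvd_of_pow_eq_one (Units.ext ?_)
    obtain ⟨k, hk⟩ := Nat.dvd_of_mem_divisors hd
    change hζ.toInteger ^ n = 1
    rw [hk, pow_mul, hζ'.pow_eq_one, one_pow]
  let θ : MonoidAlgebra ℤ C →ₐ[ℤ] 𝓞 E := MonoidAlgebra.lift ℤ (𝓞 E) C
    ((Units.coeHom (𝓞 E)).comp (monoidHomOfForallMemZpowers hc hu))
  have hθ : θ (MonoidAlgebra.of ℤ C c) = hζ.toInteger := by
    refine (MonoidAlgebra.lift_of _ _).trans ?_
    change ((monoidHomOfForallMemZpowers hc hu c : (𝓞 E)ˣ) : 𝓞 E) = _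
    rw [monoidHomOfForallMemZpowers_apply_gen]
    rfl
  have hψθ : ∀ r, ψ (θ r) = q r := by
    intro r
    induction r using MonoidAlgebra.induction_on with
    | of y =>
      obtain ⟨k, rfl⟩ := mem_powers_iff_mem_zpowers.2 (hc y)
      change ψ (θ (MonoidAlgebra.of ℤ C (c ^ k))) = q (MonoidAlgebra.of ℤ C (c ^ k))
      rw [map_pow, map_pow, map_pow, map_pow, hθ, hψ]
    | add a b ha hb => rw [map_add, map_add, map_add, ha, hb]
    | smul z a ha => rw [map_zsmul, map_zsmul, map_zsmul, ha]
  let _ : Algebra (MonoidAlgebra ℤ C) (𝓞 E) := θ.toRingHom.toAlgebra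
  have hsm : ∀ (r : MonoidAlgebra ℤ C) (y : 𝓞 E), r • y = θ r * y := fun r y => rfl
  have : IsScalarTower ℤ (MonoidAlgebra ℤ C) (𝓞 E) :=
    IsScalarTower.of_algebraMap_eq fun z => (map_intCast θ z).symm ▸ by simp
  have : Module.Finite (MonoidAlgebra ℤ C) (𝓞 E) := Module.Finite.of_restrictScalars_finite ℤ _ _
  let ψl : 𝓞 E →ₗ[MonoidAlgebra ℤ C] (MonoidAlgebra ℤ C ⧸ I) :=
    { toFun := ψ
      map_add' := map_add ψ
      map_smul' := fun r y => by
        rw [hsm, map_mul, hψθ, RingHom.id_apply]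
        rfl }
  have hsurj : Function.Surjective ψ := fun y => by
    obtain ⟨r, rfl⟩ := Ideal.Quotient.mk_surjective y
    exact ⟨θ r, hψθ r⟩
  let P : Ideal (𝓞 E) := RingHom.ker ψ.toRingHom
  have : P.IsPrime := RingHom.ker_isPrime _
  -- Otherwise the infinite ring 𝓞 E would embed in a finite field.
  have hP0 : P ≠ ⊥ := by
    intro h
    have hinj : Function.Injective ψ := (RingHom.injective_iff_ker_eq_bot ψ.toRingHom).2 h
    have : Finite (𝓞 E) := Finite.of_injective _ hinj
    exact not_finite (𝓞 E)
  have key := smallCls_quotient_mem_torsion (R := MonoidAlgebra ℤ C) P hP0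
  have hker : LinearMap.ker ψl = P.restrictScalars (MonoidAlgebra ℤ C) := rfl
  have e : (𝓞 E ⧸ P) ≃ₗ[MonoidAlgebra ℤ C] (MonoidAlgebra ℤ C ⧸ I) :=
    (Submodule.Quotient.restrictScalarsEquiv (MonoidAlgebra ℤ C) P).symm.trans
      (ψl.quotKerEquivOfSurjective hsurj)
  rwa [smallCls, cls_congr (ULift.moduleEquiv.trans e)] at key

/-- Induction on the order: split off a simple submodule, which is a residue field of the
commutative ring ℤ[C]. -/
theorem cls_mem_torsion_of_commGroup (M : Type u) [AddCommGroup M] [Module (MonoidAlgebra ℤ C) M]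
    [Finite M] : cls (MonoidAlgebra ℤ C) M ∈ AddCommGroup.torsion (G0 (MonoidAlgebra ℤ C)) := by
  induction hn : Nat.card M using Nat.strong_induction_on generalizing M with
  | _ n ih =>
    subst hn
    rcases subsingleton_or_nontrivial M with h | h
    · rw [cls_of_subsingleton]
      exact zero_mem _
    obtain ⟨S, hS, -⟩ := (IsAtomic.eq_bot_or_exists_atom_le
      (⊤ : Submodule (MonoidAlgebra ℤ C) M)).resolve_left top_ne_bot
    have : Finite (M ⧸ S) := Quotient.finite _
    rw [cls_eq_submodule_add_quotient S]
    refine add_mem ?_ (ih _ ?_ _ rfl)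
    · obtain ⟨I, hI, ⟨e⟩⟩ := isSimpleModule_iff_quot_maximal.1 (isSimpleModule_iff_isAtom.2 hS)
      have : Finite (MonoidAlgebra ℤ C ⧸ I) := Finite.of_equiv _ e.toEquiv
      rw [cls_congr e]
      exact cls_quotient_maximal_mem_torsion I
    · rw [Submodule.card_eq_card_quotient_mul_card S, mul_comm]
      have : Nontrivial S := (Submodule.nontrivial_iff_ne_bot).2 hS.1
      have h1 : 1 < Nat.card S := Finite.one_lt_card
      have h2 : 0 < Nat.card (M ⧸ S) := Nat.card_pos
      nlinarith

end Cyclic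

/-- Finite modules over a finite cyclic group have torsion class. -/
theorem cls_mem_torsion_of_isCyclic {C : Type u} [Group C] [Finite C] [IsCyclic C] (M : Type u)
    [AddCommGroup M] [Module (MonoidAlgebra ℤ C) M] [Finite M] :
    cls (MonoidAlgebra ℤ C) M ∈ AddCommGroup.torsion (G0 (MonoidAlgebra ℤ C)) := by
  let _ : CommGroup C := IsCyclic.commGroup
  exact cls_mem_torsion_of_commGroup M

end G0

/-! ### Artin induction -/

namespace ArtinInduction

open G0 LatticeTrace HomClass

section Counting

variable {G : Type u} [Group G]

/-- The number of conjugates of `g` that lie in `C`. -/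
def conjCount (C : Subgroup G) (g : G) : ℤ := Nat.card {y : G // y⁻¹ * g * y ∈ C}

/-- The number of conjugates of `g` that generate `C`. -/
def genCount (C : Subgroup G) (g : G) : ℤ := Nat.card {y : G // Subgroup.zpowers (y⁻¹ * g * y) = C}

theorem genCount_eq_zero (C : Subgroup G) (hC : ¬ IsCyclic C) (g : G) : genCount C g = 0 := by
  have : IsEmpty {y : G // Subgroup.zpowers (y⁻¹ * g * y) = C} :=
    ⟨fun ⟨y, hy⟩ => hC (hy ▸ inferInstance)⟩
  rw [genCount, Nat.card_of_isEmpty, Nat.cast_zero]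

variable [Finite G]

/-- The condition y⁻¹gy ∈ C says that g fixes the coset yC, and each fixed coset has |C|
representatives y. -/
theorem conjCount_eq_chi (C : Subgroup G) (g : G) :
    conjCount C g = Nat.card C * chi (PermMod G (G ⧸ C)) g := by
  rw [chi_permMod, conjCount, ← Nat.cast_mul, ← Nat.card_prod]
  congr 1
  have e := QuotientGroup.preimageMkEquivSubgroupProdSet C {x : G ⧸ C | g • x = x}
  refine (Nat.card_congr (Equiv.subtypeEquivRight fun y => ?_)).trans (Nat.card_congr e)
  change _ ↔ ((g * y : G) : G ⧸ C) = (y : G ⧸ C)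
  rw [eq_comm, QuotientGroup.eq, mul_assoc]

open Classical in
theorem conjCount_eq_sum [Fintype (Subgroup G)] (C : Subgroup G) (g : G) :
    conjCount C g = ∑ B with B ≤ C, genCount B g := by
  have := Fintype.ofFinite G
  simp only [conjCount, genCount, Nat.card_eq_fintype_card, Fintype.card_subtype]
  rw [Finset.card_eq_sum_card_fiberwise (f := fun y => Subgroup.zpowers (y⁻¹ * g * y))
    (t := Finset.univ.filter (· ≤ C)), Nat.cast_sum]
  · refine Finset.sum_congr rfl fun B hB => ?_
    rw [Finset.filter_filter]
    congr 2
    ext y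
    simp only [Finset.mem_filter, Finset.mem_univ, true_and, and_iff_right_iff_imp]
    rintro rfl
    exact Subgroup.zpowers_le.1 (Finset.mem_filter.1 hB).2
  · intro y hy
    simp only [Finset.coe_filter, Finset.mem_univ, true_and, Set.mem_ofPred_eq] at hy ⊢
    exact Subgroup.zpowers_le.2 hy

theorem sum_genCount [Fintype (Subgroup G)] (g : G) :
    ∑ B : Subgroup G, genCount B g = Nat.card G := by
  classical
  have h := conjCount_eq_sum ⊤ g
  simp only [le_top, Finset.filter_true] at h
  rw [← h, conjCount]
  simp

/-- A group of integral class functions containing the characters of the permutation modules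
`ℤ[G/C]`, for all cyclic `C`, contains the constant `|G|`. -/
theorem card_mem_of_cyclic (E : AddSubgroup (G → ℤ))
    (hE : ∀ C : Subgroup G, IsCyclic C → (fun g => chi (PermMod G (G ⧸ C)) g) ∈ E) :
    (fun _ => (Nat.card G : ℤ)) ∈ E := by
  classical
  have := Fintype.ofFinite (Subgroup G)
  have hgen : ∀ C : Subgroup G, genCount C ∈ E := by
    intro C
    induction C using WellFoundedLT.induction with
    | _ C ih =>
      by_cases hC : IsCyclic C
      -- A conjugate of g lies in C exactly when it generates some subgroup B of C. Isolating B = C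
      -- gives a recursion over smaller subgroups; those that are not cyclic contribute zero.
      · have h1 : genCount C =
            Nat.card C • (fun g => chi (PermMod G (G ⧸ C)) g) -
              ∑ B with B < C, genCount B := by
          rw [eq_sub_iff_add_eq]
          funext g
          rw [Pi.add_apply, Finset.sum_apply, Pi.smul_apply, nsmul_eq_mul, ← conjCount_eq_chi,
            conjCount_eq_sum]
          have : (Finset.univ.filter (· ≤ C)) = insert C (Finset.univ.filter (· < C)) := by
            ext B
            simp [le_iff_eq_or_lt]
          rw [this, Finset.sum_insert (by simp)]
        rw [h1]
        exact sub_mem (nsmul_mem (hE C hC) _)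
          (sum_mem fun B hB => ih B (Finset.mem_filter.1 hB).2)
      · rw [funext (genCount_eq_zero C hC)]
        exact zero_mem _
  -- Each conjugate y⁻¹gy generates exactly one subgroup, so the counts add up to the number of all
  -- y.
  have : (fun _ => (Nat.card G : ℤ)) = ∑ B : Subgroup G, genCount B := by
    funext g
    rw [Finset.sum_apply, sum_genCount]
  rw [this]
  exact sum_mem fun B _ => hgen B

end Counting

section Torsion

variable {G : Type u} [Group G] [Finite G]

variable (M : Type u) [AddCommGroup M] [Module (MonoidAlgebra ℤ G) M] [Finite M]

/-- The graph of `χ_A - χ_B ↦ [Hom(A, M)] - [Hom(B, M)]`, for lattices `A` and `B`. -/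
def characterGraph : AddSubgroup ((G → ℤ) × G0 (MonoidAlgebra ℤ G)) where
  carrier := {x | ∃ A B : FGModuleCat.{u} (MonoidAlgebra ℤ G), Module.Free ℤ A ∧ Module.Free ℤ B ∧
    (∀ g, x.1 g = chi A g - chi B g) ∧ x.2 = homFun M A - homFun M B}
  zero_mem' := by
    refine ⟨.of _ PUnit, .of _ PUnit, inferInstanceAs (Module.Free ℤ PUnit.{u + 1}),
      inferInstanceAs (Module.Free ℤ PUnit.{u + 1}), fun g => ?_, ?_⟩
    · rw [sub_self]; rfl
    · rw [sub_self]; rfl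
  neg_mem' := by
    rintro x ⟨A, B, hA, hB, h1, h2⟩
    refine ⟨B, A, hB, hA, fun g => ?_, ?_⟩
    · rw [Prod.fst_neg, Pi.neg_apply, h1, neg_sub]
    · rw [Prod.snd_neg, h2, neg_sub]
  add_mem' := by
    have hfree : ∀ A B : FGModuleCat.{u} (MonoidAlgebra ℤ G), Module.Free ℤ A → Module.Free ℤ B →
        Module.Free ℤ (A × B) := fun A B _ _ =>
      inferInstance
    have hchi : ∀ A B : FGModuleCat.{u} (MonoidAlgebra ℤ G), Module.Free ℤ A → Module.Free ℤ B →
        ∀ g : G, chi (A × B) g = chi A g + chi B g := fun A B _ _ g =>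
      chi_eq_add_of_exact (LinearMap.inl _ A B) (LinearMap.snd _ A B) LinearMap.inl_injective
        .inl_snd LinearMap.snd_surjective g
    have hhom : ∀ A B : FGModuleCat.{u} (MonoidAlgebra ℤ G), Module.Free ℤ A → Module.Free ℤ B →
        homFun M (.of _ (A × B)) = homFun M A + homFun M B := fun A B _ _ =>
      homCls_of_exact M (LinearMap.inl _ A B) (LinearMap.snd _ A B) LinearMap.inl_injective
        .inl_snd LinearMap.snd_surjective
    rintro x y ⟨A, B, hA, hB, h1, h2⟩ ⟨A', B', hA', hB', h1', h2'⟩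
    refine ⟨.of _ (A × A'), .of _ (B × B'), hfree _ _ hA hA', hfree _ _ hB hB', fun g => ?_, ?_⟩
    · refine Eq.trans ?_ (congrArg₂ (· - ·) (hchi A A' hA hA' g) (hchi B B' hB hB' g)).symm
      rw [Prod.fst_add, Pi.add_apply, h1, h1']
      ring
    · rw [Prod.snd_add, h2, h2', hhom _ _ hA hA', hhom _ _ hB hB']
      abel

/-- This is what makes the graph that of a function of virtual characters: the class of Hom(A, M)
depends only on the character of A. -/
theorem eq_zero_of_mem_characterGraph (p : ℕ) [Fact p.Prime] (hM : ∀ m : M, p • m = 0)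
    {t : G0 (MonoidAlgebra ℤ G)} (h : (0, t) ∈ characterGraph (G := G) M) : t = 0 := by
  obtain ⟨A, B, hA, hB, h1, h2⟩ := h
  have : homFun M A = homFun M B := homCls_eq_of_chi_eq M p hM (A := A) (B := B)
    (fun g => sub_eq_zero.1 (h1 g).symm)
  exact h2.trans (sub_eq_zero.2 this)

theorem permMod_mem_characterGraph (X : Type u) [MulAction G X] [Finite X] :
    ((fun g => chi (PermMod G X) g), clsRep (homRep G M (PermMod G X))) ∈
      characterGraph (G := G) M := by
  refine ⟨.of _ (PermMod G X), .of _ PUnit, free_permMod X,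
    inferInstanceAs (Module.Free ℤ PUnit.{u + 1}), fun g => ?_, ?_⟩
  · have : chi (PUnit.{u + 1}) g = 0 := by
      rw [chi, Subsingleton.elim (modRep G PUnit g) 0, map_zero]
    exact (sub_eq_self.2 this).symm
  · have : homFun M (.of (MonoidAlgebra ℤ G) PUnit) = 0 := by
      have : Subsingleton ((homRep G M PUnit.{u + 1}).asModule) :=
        inferInstanceAs (Subsingleton (PUnit.{u + 1} →ₗ[ℤ] M))
      exact cls_of_subsingleton _
    exact (sub_eq_self.2 this).symm

theorem clsRep_homRep_trivial : clsRep (homRep G M (PermMod G PUnit.{u + 1})) =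
    cls (MonoidAlgebra ℤ G) M := by
  rw [← clsRep_modRep (G := G) M]
  let e := (permRep G PUnit.{u + 1}).asModuleEquiv.symm (MonoidAlgebra.single PUnit.unit 1)
  refine clsRep_congr (AddEquiv.ofBijective
    ({ toFun := fun φ => φ e
       map_zero' := rfl
       map_add' := fun _ _ => rfl } : (PermMod G PUnit.{u + 1} →ₗ[ℤ] M) →+ M) ⟨?_, ?_⟩) ?_
  · intro φ ψ h
    exact permMod_hom_ext fun _ => h
  · intro m
    exact ⟨permModLift G fun _ => m, permModLift_single _ _⟩
  · intro g φ
    change homRep G M _ g φ e = modRep G M g (φ e)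
    rw [homRep_apply, modRep_apply, of_smul_single]

/-- By Artin induction |G| times the trivial character is an integral combination of characters of
ℤ[G/C] with C cyclic. Applying A ↦ [Hom(A, M)] gives |G|[M] as a combination of classes coinduced
from cyclic subgroups, which are torsion. -/
theorem cls_mem_torsion_of_exponent_prime (p : ℕ) [Fact p.Prime] (hM : ∀ m : M, p • m = 0) :
    cls (MonoidAlgebra ℤ G) M ∈ AddCommGroup.torsion (G0 (MonoidAlgebra ℤ G)) := by
  -- The virtual characters to which the graph attaches some torsion class.
  let E : AddSubgroup (G → ℤ) :=
    ((characterGraph (G := G) M) ⊓ (AddSubgroup.prod ⊤ (AddCommGroup.torsion _))).map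
      (AddMonoidHom.fst _ _)
  obtain ⟨⟨f, t⟩, ⟨h1, -, ht⟩, hf⟩ := card_mem_of_cyclic E (fun C hC => by
    refine ⟨_, ⟨permMod_mem_characterGraph M (G ⧸ C), trivial, ?_⟩, rfl⟩
    rw [clsRep_homRep_permMod]
    let ρ : Representation ℤ C M := (modRep G M).comp C.subtype
    have : Finite ρ.asModule := inferInstanceAs (Finite M)
    exact AddMonoidHom.isOfFinAddOrder (coindG0 C) (cls_mem_torsion_of_isCyclic ρ.asModule))
  have h2 := permMod_mem_characterGraph M PUnit.{u + 1} (G := G)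
  rw [clsRep_homRep_trivial] at h2
  -- Two points of the graph lie over the constant |G|: one with second coordinate |G|[M], from the
  -- trivial module, and one with the torsion class t. Their difference lies over zero.
  have h3 := sub_mem (nsmul_mem h2 (Nat.card G)) h1
  have h4 : Nat.card G • cls (MonoidAlgebra ℤ G) M - t = 0 := by
    refine eq_zero_of_mem_characterGraph M p hM ?_
    convert h3 using 1
    refine Prod.ext (funext fun g => ?_) rfl
    have hg : f g = Nat.card G := congrFun hf g
    change 0 = Nat.card G • chi (PermMod G PUnit.{u + 1}) g - f g
    rw [hg, chi_permMod]
    have : Nat.card {x : PUnit.{u + 1} // g • x = x} = 1 := by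
      have : Unique {x : PUnit.{u + 1} // g • x = x} := ⟨⟨⟨PUnit.unit, rfl⟩⟩, fun x => rfl⟩
      exact Nat.card_unique
    rw [this, Nat.cast_one, nsmul_eq_mul, mul_one, sub_self]
  rw [sub_eq_zero] at h4
  obtain ⟨n, hn, hnt⟩ := isOfFinAddOrder_iff_nsmul_eq_zero.1 ht
  refine isOfFinAddOrder_iff_nsmul_eq_zero.2 ⟨n * Nat.card G, Nat.mul_pos hn Nat.card_pos, ?_⟩
  rw [mul_smul, h4]
  exact hnt

/-- The class of a finite module over a finite group is torsion in `G₀(ℤ[G])`. -/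
theorem cls_mem_torsion_of_finite :
    cls (MonoidAlgebra ℤ G) M ∈ AddCommGroup.torsion (G0 (MonoidAlgebra ℤ G)) := by
  induction hn : Nat.card M using Nat.strong_induction_on generalizing M with
  | _ n ih =>
    subst hn
    rcases subsingleton_or_nontrivial M with h | h
    · rw [cls_of_subsingleton]
      exact zero_mem _
    obtain ⟨p, hp, hpM⟩ := Nat.exists_prime_and_dvd (Finite.one_lt_card (α := M)).ne'
    have : Fact p.Prime := ⟨hp⟩
    -- The p-torsion of M for a prime p dividing |M|; it is nonzero by Cauchy's theorem, so M/S is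
    -- smaller than M.
    let S : Submodule (MonoidAlgebra ℤ G) M :=
      LinearMap.ker (p • (LinearMap.id : M →ₗ[MonoidAlgebra ℤ G] M))
    have : Finite (M ⧸ S) := Quotient.finite _
    rw [cls_eq_submodule_add_quotient S]
    refine add_mem (cls_mem_torsion_of_exponent_prime S p fun m => Subtype.ext m.2)
      (ih _ ?_ _ rfl)
    obtain ⟨x, hx⟩ := exists_prime_addOrderOf_dvd_card' p hpM
    have : Nontrivial S := by
      refine ⟨⟨⟨x, ?_⟩, 0, fun h => ?_⟩⟩
      · change p • x = 0
        rw [← hx, addOrderOf_nsmul_eq_zero]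
      · have h0 : x = 0 := congrArg Subtype.val h
        rw [h0, addOrderOf_zero] at hx
        exact hp.one_lt.ne hx
    rw [Submodule.card_eq_card_quotient_mul_card S]
    have h1 : 1 < Nat.card S := Finite.one_lt_card
    have h2 : 0 < Nat.card (M ⧸ S) := Nat.card_pos
    nlinarith

/-- The class of a module modulo torsion. -/
def clsModTorsion (A : FGModuleCat.{u} (MonoidAlgebra ℤ G)) :
    G0 (MonoidAlgebra ℤ G) ⧸ AddCommGroup.torsion (G0 (MonoidAlgebra ℤ G)) :=
  QuotientAddGroup.mk (cls (MonoidAlgebra ℤ G) A)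

/-- Lattices with equal characters have equal classes modulo torsion. -/
theorem cls_sub_cls_mem_torsion (A B : Type u) [AddCommGroup A] [AddCommGroup B]
    [Module (MonoidAlgebra ℤ G) A] [Module (MonoidAlgebra ℤ G) B]
    [Module.Finite (MonoidAlgebra ℤ G) A] [Module.Finite (MonoidAlgebra ℤ G) B]
    [Module.Free ℤ A] [Module.Free ℤ B] (h : ∀ g : G, chi A g = chi B g) :
    cls (MonoidAlgebra ℤ G) A - cls (MonoidAlgebra ℤ G) B ∈
      AddCommGroup.torsion (G0 (MonoidAlgebra ℤ G)) := by
  have : clsModTorsion (.of (MonoidAlgebra ℤ G) A) = clsModTorsion (.of (MonoidAlgebra ℤ G) B) := by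
    refine eq_of_chi_eq clsModTorsion ?_ ?_ A B h
    · intro A B C f g _ _ _ hf hfg hg
      exact congrArg _ (cls_of_exact f g hf hfg hg)
    · intro A B f _ _ hf _
      -- For a sublattice of finite index the class changes by that of the finite cokernel, which is
      -- torsion.
      refine (QuotientAddGroup.eq).2 ?_
      have h1 := cls_of_exact f (LinearMap.range f).mkQ hf
        (LinearMap.exact_map_mkQ_range f) (Submodule.mkQ_surjective _)
      have h2 := cls_mem_torsion_of_finite (G := G) (B ⧸ LinearMap.range f)
      change -cls (MonoidAlgebra ℤ G) A + cls (MonoidAlgebra ℤ G) B ∈ _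
      rw [h1, neg_add_cancel_left]
      exact h2
  rw [← neg_mem_iff, neg_sub, sub_eq_neg_add]
  exact (QuotientAddGroup.eq).1 this

end Torsion

end ArtinInduction

/-! ### The duality automorphism -/

namespace G0

section Sigma

variable {G : Type u} [Group G] [Finite G]

/-- A presentation by a free module has a lattice as kernel, so every class is a difference of two
classes of lattices. -/
theorem hom_ext_lattice {T : Type*} [AddCommGroup T] {φ ψ : G0 (MonoidAlgebra ℤ G) →+ T}
    (h : ∀ (M : Type u) [AddCommGroup M] [Module (MonoidAlgebra ℤ G) M]
      [Module.Finite (MonoidAlgebra ℤ G) M] [Module.Free ℤ M],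
      φ (cls (MonoidAlgebra ℤ G) M) = ψ (cls (MonoidAlgebra ℤ G) M)) : φ = ψ := by
  refine QuotientAddGroup.addMonoidHom_ext _ (FreeAbelianGroup.lift_ext _ _ fun M => ?_)
  change φ (cls (MonoidAlgebra ℤ G) M) = ψ (cls (MonoidAlgebra ℤ G) M)
  obtain ⟨n, p, hp⟩ := Module.Finite.exists_fin' (MonoidAlgebra ℤ G) M
  have := IntegralDual.free_submodule (LinearMap.ker p)
  have e := cls_of_exact (LinearMap.ker p).subtype p Subtype.val_injective
    (LinearMap.exact_subtype_ker_map p) hp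
  rw [← sub_eq_iff_eq_add'] at e
  rw [← e, map_sub, map_sub, h, h]

theorem sigma_clsRep {A : Type u} [AddCommGroup A] [Module.Finite ℤ A] [Module.Free ℤ A]
    (ρ : Representation ℤ G A) : sigma G (clsRep ρ) = clsRep ρ.dual := by
  have : Module.Free ℤ ρ.asModule := inferInstanceAs (Module.Free ℤ A)
  refine (sigma_lattice ρ.asModule).trans ?_
  let e : ρ.asModule ≃+ A := ρ.asModuleEquiv.toAddEquiv
  have he : ∀ g x, e (modRep G ρ.asModule g x) = ρ g (e x) := fun g x => by
    rw [modRep_apply]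
    exact (ρ.asModuleEquiv_map_smul _ _).trans (by rw [Representation.asAlgebraHom_of]; rfl)
  let F : Module.Dual ℤ ρ.asModule ≃+ Module.Dual ℤ A :=
    { toFun := fun φ => (φ.toAddMonoidHom.comp e.symm.toAddMonoidHom).toIntLinearMap
      invFun := fun φ => (φ.toAddMonoidHom.comp e.toAddMonoidHom).toIntLinearMap
      left_inv := fun φ => LinearMap.ext fun x => congrArg φ (e.symm_apply_apply x)
      right_inv := fun φ => LinearMap.ext fun x => congrArg φ (e.apply_symm_apply x)
      map_add' := fun _ _ => rfl }
  refine clsRep_congr F fun g φ => LinearMap.ext fun a => ?_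
  change φ (modRep G ρ.asModule g⁻¹ (e.symm a)) = φ (e.symm (ρ g⁻¹ a))
  congr 1
  apply e.injective
  rw [he, e.apply_symm_apply, e.apply_symm_apply]

/-- Biduality of lattices: evaluation M → M** is an equivariant isomorphism. -/
theorem sigma_sigma (x : G0 (MonoidAlgebra ℤ G)) : sigma G (sigma G x) = x := by
  have : (sigma G).comp (sigma G) = AddMonoidHom.id _ := by
    refine hom_ext_lattice fun M _ _ _ _ => ?_
    have := IntegralDual.finite_int (G := G) M
    change sigma G (sigma G (cls (MonoidAlgebra ℤ G) M)) = cls (MonoidAlgebra ℤ G) M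
    rw [sigma_lattice, sigma_clsRep, ← clsRep_modRep]
    refine (clsRep_congr (Module.evalEquiv ℤ M).toAddEquiv fun g m => ?_).symm
    refine LinearMap.ext fun φ => ?_
    change φ (modRep G M g m) = φ (modRep G M (g⁻¹)⁻¹ m)
    rw [inv_inv]
  exact DFunLike.congr_fun this x

/-- The pairing for which the standard basis is orthonormal is G-invariant, so a permutation lattice
is self-dual. -/
theorem sigma_permRep (X : Type u) [MulAction G X] [Finite X] :
    sigma G (clsRep (permRep G X)) = clsRep (permRep G X) := by
  classical
  rw [sigma_clsRep]
  let b := MonoidAlgebra.basis X ℤ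
  have hb : ∀ x, b x = MonoidAlgebra.single x 1 := fun x => by simp [b]
  have hg : ∀ (g : G) x, permRep G X g (b x) = b (g • x) := fun g x => by
    rw [hb, hb, Representation.ofMulAction_single]
  have key : ∀ g : G, b.toDual ∘ₗ permRep G X g = (permRep G X).dual g ∘ₗ b.toDual := by
    intro g
    refine b.ext fun x => b.ext fun y => ?_
    change b.toDual (permRep G X g (b x)) (b y) = b.toDual (b x) (permRep G X g⁻¹ (b y))
    rw [hg, hg, b.toDual_apply, b.toDual_apply]
    simp only [eq_inv_smul_iff]
  exact (clsRep_congr b.toDualEquiv.toAddEquiv fun g x => LinearMap.congr_fun (key g) x).symm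

theorem sigma_trivial :
    sigma G (clsRep (Representation.trivial ℤ G (ULift.{u} ℤ))) =
      clsRep (Representation.trivial ℤ G (ULift.{u} ℤ)) := by
  have : Module.Free ℤ (ULift.{u} ℤ) := Module.Free.of_equiv ULift.moduleEquiv.symm
  rw [sigma_clsRep]
  let F : ULift.{u} ℤ ≃+ Module.Dual ℤ (ULift.{u} ℤ) :=
    { toFun := fun n => n.down • ULift.moduleEquiv.toLinearMap
      invFun := fun φ => ⟨φ ⟨1⟩⟩
      left_inv := fun n => congrArg ULift.up (mul_one n.down)
      right_inv := fun φ => LinearMap.ext fun m => by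
        change φ ⟨1⟩ * m.down = φ m
        rw [mul_comm, ← smul_eq_mul, ← map_smul]
        exact congrArg φ (congrArg ULift.up (mul_one m.down))
      map_add' := fun m n => add_smul _ _ _ }
  refine (clsRep_congr F fun g x => LinearMap.ext fun y => ?_).symm
  rfl

end Sigma

end G0

/-! ### Characters of finite modules -/

/-- The homomorphism `t ↦ exp(2πit)`. -/
def circleExp : ℝ →+ Additive Circle where
  toFun t := Additive.ofMul (Circle.exp (2 * Real.pi * t))
  map_zero' := by rw [mul_zero, Circle.exp_zero]; rfl
  map_add' s t := by rw [mul_add, Circle.exp_add]; rfl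

theorem circleExp_eq_zero_iff (t : ℝ) : circleExp t = 0 ↔ ∃ n : ℤ, t = n := by
  change Circle.exp (2 * Real.pi * t) = 1 ↔ _
  rw [Circle.exp_eq_one]
  have hpi : (2 * Real.pi) ≠ 0 := by positivity
  refine exists_congr fun n => ?_
  rw [mul_comm (n : ℝ), mul_right_inj' hpi]

theorem circleExp_surjective : Function.Surjective circleExp := by
  intro z
  obtain ⟨t, ht⟩ := Circle.exp_surjective (Additive.toMul z)
  refine ⟨t / (2 * Real.pi), ?_⟩
  change Additive.ofMul (Circle.exp _) = z
  rw [mul_div_cancel₀ _ (by positivity), ht]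
  rfl

/-- Characters of free abelian groups lift to real-valued homomorphisms. -/
theorem exists_circleExp_lift {P : Type*} [AddCommGroup P] [Module.Free ℤ P]
    (χ : P →+ Additive Circle) : ∃ Φ : P →+ ℝ, ∀ p, circleExp (Φ p) = χ p := by
  obtain ⟨Φ, hΦ⟩ := Module.projective_lifting_property circleExp.toIntLinearMap χ.toIntLinearMap
    circleExp_surjective
  exact ⟨Φ.toAddMonoidHom, fun p => LinearMap.congr_fun hΦ p⟩

/-- An integer-valued real homomorphism comes from an integral one. -/
theorem exists_int_hom {P : Type*} [AddCommGroup P] (Φ : P →+ ℝ) (h : ∀ p, ∃ n : ℤ, Φ p = n) :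
    ∃ f : P →+ ℤ, ∀ p, (f p : ℝ) = Φ p := by
  choose f hf using h
  exact ⟨⟨⟨f, by exact_mod_cast (hf 0).symm.trans (map_zero Φ)⟩, fun x y => by
    have := hf (x + y)
    rw [map_add, hf, hf] at this
    exact_mod_cast this.symm⟩, fun p => (hf p).symm⟩

section Characters

variable (G : Type u) [Group G] (A : Type u) [CommGroup A] [MulDistribMulAction G A]

/-- The characters `A → 𝕊¹` of an abelian group with an action of `G`, with
`(g χ)(a) = χ(g⁻¹ a)`. -/
def charRep : Representation ℤ G (Additive (A →* Circle)) where
  toFun g := AddMonoidHom.toIntLinearMap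
    { toFun := fun χ => Additive.ofMul
        ((Additive.toMul χ).comp (MulDistribMulAction.toMonoidHom A g⁻¹))
      map_zero' := rfl
      map_add' := fun _ _ => rfl }
  map_one' := LinearMap.ext fun χ => by
    refine Additive.toMul.injective (MonoidHom.ext fun a => ?_)
    change Additive.toMul χ ((1 : G)⁻¹ • a) = Additive.toMul χ a
    rw [inv_one, one_smul]
  map_mul' g h := LinearMap.ext fun χ => by
    refine Additive.toMul.injective (MonoidHom.ext fun a => ?_)
    change Additive.toMul χ ((g * h)⁻¹ • a) = Additive.toMul χ (h⁻¹ • g⁻¹ • a)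
    rw [mul_inv_rev, mul_smul]

end Characters

section FiniteDual

variable {G : Type u} [Group G] [Finite G]

open G0 IntegralDual

/-- The connecting homomorphism `Hom(K, ℤ) → Hom(A, ℝ/ℤ)` of a presentation `0 → K → P → A → 0`
of a finite group. -/
theorem exists_connecting {P A : Type*} [AddCommGroup P] [Module.Free ℤ P] [CommGroup A] [Finite A]
    (p : P →+ Additive A) (hp : Function.Surjective p) :
    ∃ δ : (p.ker →+ ℤ) →+ Additive (A →* Circle),
      (∀ f : p.ker →+ ℤ, ∃ Φ : P →+ ℝ, ∀ k : p.ker, Φ k = f k) ∧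
      (∀ (f : p.ker →+ ℤ) (Φ : P →+ ℝ), (∀ k : p.ker, Φ k = f k) → ∀ x : P,
        Additive.ofMul (Additive.toMul (δ f) (Additive.toMul (p x))) = circleExp (Φ x)) ∧
      Function.Surjective δ ∧ ∀ f, δ f = 0 ↔ ∃ F : P →+ ℤ, ∀ k : p.ker, F k = f k := by
  set N := Nat.card A with hN
  have hN0 : (N : ℝ) ≠ 0 := by exact_mod_cast (Nat.card_pos (α := A)).ne'
  have hmem : ∀ x, N • x ∈ p.ker := fun x => by
    rw [AddMonoidHom.mem_ker, map_nsmul]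
    exact pow_card_eq_one' (x := Additive.toMul (p x))
  -- Since N = |A| kills A, multiplication by N maps P into the kernel. An integral f on the kernel
  -- therefore has the unique real extension x ↦ f(Nx)/N, and its values modulo ℤ define a character
  -- of A.
  let m : P →+ p.ker :=
    { toFun := fun x => ⟨N • x, hmem x⟩
      map_zero' := Subtype.ext (smul_zero _)
      map_add' := fun x y => Subtype.ext (smul_add _ _ _) }
  have hm : ∀ k : p.ker, m k = N • k := fun k => rfl
  -- the real extension of an integral homomorphism
  let ext : (p.ker →+ ℤ) → P →+ ℝ := fun f =>
    { toFun := fun x => (f (m x) : ℝ) / N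
      map_zero' := by simp
      map_add' := fun x y => by rw [map_add, map_add]; push_cast; ring }
  have hext : ∀ f (k : p.ker), ext f k = f k := fun f k => by
    change (f (m k) : ℝ) / N = f k
    rw [hm, map_nsmul, nsmul_eq_mul]
    push_cast
    rw [mul_div_cancel_left₀ _ hN0]
  have huniq : ∀ f (Φ : P →+ ℝ), (∀ k : p.ker, Φ k = f k) → Φ = ext f := fun f Φ h => by
    ext x
    have := h (m x)
    change Φ (N • x) = _ at this
    rw [map_nsmul, nsmul_eq_mul] at this
    change Φ x = (f (m x) : ℝ) / N
    rw [← this, mul_div_cancel_left₀ _ hN0]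
  let χ : (p.ker →+ ℤ) → Additive A →+ Additive Circle := fun f =>
    p.liftOfSurjective hp ⟨circleExp.comp (ext f), fun k hk => by
      rw [AddMonoidHom.mem_ker, AddMonoidHom.comp_apply, circleExp_eq_zero_iff]
      exact ⟨f ⟨k, hk⟩, hext f ⟨k, hk⟩⟩⟩
  have hχ : ∀ f x, χ f (p x) = circleExp (ext f x) := fun f x =>
    AddMonoidHom.liftOfRightInverse_comp_apply _ _ _ _ x
  let δ : (p.ker →+ ℤ) →+ Additive (A →* Circle) :=
    { toFun := fun f => Additive.ofMul (MonoidHom.toAdditive.symm (χ f))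
      map_zero' := by
        refine Additive.toMul.injective (MonoidHom.ext fun a => ?_)
        obtain ⟨x, hx⟩ := hp (Additive.ofMul a)
        change Additive.toMul (χ 0 (Additive.ofMul a)) = 1
        rw [← hx, hχ]
        have : ext 0 x = 0 := by simp [ext]
        rw [this, map_zero]
        rfl
      map_add' := fun f g => by
        refine Additive.toMul.injective (MonoidHom.ext fun a => ?_)
        obtain ⟨x, hx⟩ := hp (Additive.ofMul a)
        change Additive.toMul (χ (f + g) (Additive.ofMul a)) =
          Additive.toMul (χ f (Additive.ofMul a)) * Additive.toMul (χ g (Additive.ofMul a))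
        rw [← hx, hχ, hχ, hχ, ← toMul_add, ← map_add]
        congr 2
        simp [ext, add_div] }
  refine ⟨δ, fun f => ⟨ext f, hext f⟩, fun f Φ h x => ?_, fun χ' => ?_, fun f => ⟨fun h => ?_, ?_⟩⟩
  · rw [huniq f Φ h]
    exact hχ f x
  -- Surjectivity: lift the character from P to ℝ. On the kernel of p the lift is integral, and this
  -- restriction is the required f.
  · obtain ⟨Φ, hΦ⟩ := exists_circleExp_lift ((MonoidHom.toAdditive (Additive.toMul χ')).comp p)
    obtain ⟨f, hf⟩ := exists_int_hom (Φ.comp p.ker.subtype) (fun k => by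
      rw [← circleExp_eq_zero_iff]
      refine (hΦ k).trans ?_
      rw [AddMonoidHom.comp_apply, (AddMonoidHom.mem_ker).1 k.2, map_zero])
    refine ⟨f, Additive.toMul.injective (MonoidHom.ext fun a => ?_)⟩
    obtain ⟨x, hx⟩ := hp (Additive.ofMul a)
    change Additive.toMul (χ f (Additive.ofMul a)) = Additive.toMul χ' a
    rw [← hx, hχ, ← huniq f Φ fun k => (hf k).symm, hΦ, AddMonoidHom.comp_apply, hx]
    rfl
  · obtain ⟨F, hF⟩ := exists_int_hom (ext f) (fun x => by
      rw [← circleExp_eq_zero_iff, ← hχ]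
      exact congrArg (fun ψ : Additive (A →* Circle) =>
        Additive.ofMul (Additive.toMul ψ (Additive.toMul (p x)))) h)
    refine ⟨F, fun k => ?_⟩
    exact_mod_cast (hF k).trans (hext f k)
  · rintro ⟨F, hF⟩
    have h1 := huniq f ((Int.castAddHom ℝ).comp F) (fun k => by
      rw [AddMonoidHom.comp_apply, hF]; rfl)
    refine Additive.toMul.injective (MonoidHom.ext fun a => ?_)
    obtain ⟨x, hx⟩ := hp (Additive.ofMul a)
    change Additive.toMul (χ f (Additive.ofMul a)) = 1
    rw [← hx, hχ, ← h1, (circleExp_eq_zero_iff (((Int.castAddHom ℝ).comp F) x)).2 ⟨F x, rfl⟩]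
    rfl

/-- If `A` is finite, then `σ[A] = -[Hom(A, ℝ/ℤ)]`. -/
theorem exists_finite_charRep (A : Type u) [CommGroup A] [MulDistribMulAction G A] [Finite A]
    [Module.Finite (MonoidAlgebra ℤ G) (Representation.ofMulDistribMulAction G A).asModule] :
    ∃ _ : Module.Finite (MonoidAlgebra ℤ G) (charRep G A).asModule,
      sigma G (clsRep (Representation.ofMulDistribMulAction G A)) = -clsRep (charRep G A) := by
  let ρ := Representation.ofMulDistribMulAction G A
  obtain ⟨n, p, hp⟩ := Module.Finite.exists_fin' (MonoidAlgebra ℤ G) ρ.asModule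
  let P := Fin n → MonoidAlgebra ℤ G
  have := free_submodule (LinearMap.ker p)
  have hσ : sigma G (clsRep ρ) = presentationClass p := by
    rw [clsRep, sigma, lift_cls]
    exact sigmaFun_eq p hp
  let q : P →+ Additive A := ρ.asModuleEquiv.toAddEquiv.toAddMonoidHom.comp p.toAddMonoidHom
  have hq : ∀ (g : G) x, q (MonoidAlgebra.of ℤ G g • x) =
      Additive.ofMul (g • Additive.toMul (q x)) := fun g x => by
    change ρ.asModuleEquiv (p _) = _
    rw [map_smul]
    refine (ρ.asModuleEquiv_map_smul _ _).trans ?_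
    rw [Representation.asAlgebraHom_of]
    rfl
  obtain ⟨δ, hext, hδ, hsurj, hker⟩ := exists_connecting q
    (ρ.asModuleEquiv.surjective.comp hp)
  let ι : q.ker →+ LinearMap.ker p :=
    ⟨⟨fun x => ⟨x, x.2⟩, rfl⟩, fun _ _ => rfl⟩
  let D : Module.Dual ℤ (LinearMap.ker p) →+ Additive (A →* Circle) :=
    { toFun := fun φ => δ (φ.toAddMonoidHom.comp ι)
      map_zero' := δ.map_zero
      map_add' := fun φ ψ => δ.map_add (φ.toAddMonoidHom.comp ι) (ψ.toAddMonoidHom.comp ι) }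
  let r : Module.Dual ℤ P →+ Module.Dual ℤ (LinearMap.ker p) :=
    { toFun := fun φ => φ.comp ((LinearMap.ker p).subtype.restrictScalars ℤ)
      map_zero' := rfl
      map_add' := fun _ _ => rfl }
  have hD : ∀ g φ, D (dualRep G (LinearMap.ker p) g φ) = charRep G A g (D φ) := by
    intro g φ
    obtain ⟨Φ, hΦ⟩ := hext (φ.toAddMonoidHom.comp ι)
    refine Additive.toMul.injective (MonoidHom.ext fun a => ?_)
    obtain ⟨x, hx⟩ := (ρ.asModuleEquiv.surjective.comp hp) (Additive.ofMul a)
    have hx' : Additive.toMul (q x) = a := hx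
    -- Equivariance holds by uniqueness of the real extension: Φ ∘ g⁻¹ extends g φ if Φ extends φ.
    let Ψ : P →+ ℝ := Φ.comp (modRep G P g⁻¹).toAddMonoidHom
    have h1 := hδ ((dualRep G (LinearMap.ker p) g φ).toAddMonoidHom.comp ι) Ψ (fun k => by
      have h2 := hΦ ⟨MonoidAlgebra.of ℤ G g⁻¹ • (k : P), by
        have hk : q k = 0 := k.2
        rw [AddMonoidHom.mem_ker, hq, hk]
        exact congrArg Additive.ofMul (smul_one g⁻¹ : g⁻¹ • (1 : A) = 1)⟩
      change Φ (modRep G P g⁻¹ k) = (φ (modRep G (LinearMap.ker p) g⁻¹ (ι k)) : ℝ)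
      rw [modRep_apply, modRep_apply]
      exact h2) x
    have h3 := hδ _ Φ hΦ (MonoidAlgebra.of ℤ G g⁻¹ • x)
    rw [hq] at h3
    change Additive.toMul (δ _) a = Additive.toMul (δ _) (g⁻¹ • a)
    rw [← hx']
    refine Additive.ofMul.injective (h1.trans (Eq.trans ?_ h3.symm))
    change circleExp (Φ (modRep G P g⁻¹ x)) = _
    rw [modRep_apply]
  have hr : ∀ g φ, r (dualRep G P g φ) = dualRep G (LinearMap.ker p) g (r φ) := by
    intro g φ
    refine LinearMap.ext fun k => ?_
    change φ (modRep G P g⁻¹ k) = φ ((modRep G (LinearMap.ker p) g⁻¹ k : LinearMap.ker p) : P)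
    rw [modRep_apply, modRep_apply]
    rfl
  have hD' : Function.Surjective D := fun χ => by
    obtain ⟨f, rfl⟩ := hsurj χ
    let ι' : LinearMap.ker p →+ q.ker := ⟨⟨fun x => ⟨x, x.2⟩, rfl⟩, fun _ _ => rfl⟩
    exact ⟨(f.comp ι').toIntLinearMap, rfl⟩
  have fin : Module.Finite (MonoidAlgebra ℤ G) (charRep G A).asModule :=
    Module.Finite.of_surjective (repHom (dualRep G (LinearMap.ker p)) (charRep G A) D hD) hD'
  refine ⟨fin, ?_⟩
  -- The dual of the presentation is 0 → P* → (ker p)* → A^∨ → 0, so [P*] - [(ker p)*] is -[A^∨].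
  rw [hσ, presentationClass, clsRep_of_exact r D hr hD ?_ ?_ hD']
  · abel
  · intro φ ψ h
    refine LinearMap.ext fun x => ?_
    have hx : Nat.card A • x ∈ LinearMap.ker p := by
      refine LinearMap.mem_ker.2 (ρ.asModuleEquiv.injective ?_)
      rw [map_nsmul, map_zero]
      exact (map_nsmul q _ x).symm.trans ((map_nsmul q _ x).trans
        (pow_card_eq_one' (x := Additive.toMul (q x))))
    have h2 : φ (Nat.card A • x) = ψ (Nat.card A • x) := LinearMap.congr_fun h ⟨_, hx⟩
    rw [map_nsmul, map_nsmul] at h2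
    exact smul_right_injective ℤ (Nat.card_pos (α := A)).ne' h2
  · intro φ
    refine (hker _).trans ⟨fun ⟨F, hF⟩ => ⟨F.toIntLinearMap, ?_⟩, fun ⟨ψ, hψ⟩ => ?_⟩
    · exact LinearMap.ext fun k => hF ⟨k, k.2⟩
    · exact ⟨ψ.toAddMonoidHom, fun k => LinearMap.congr_fun hψ (ι k)⟩

end FiniteDual

/-! ### The logarithmic space of a number field -/

namespace NumberField.Units

open NumberField.InfinitePlace Module

variable (F : Type u) [Field F]

/-- The units modulo roots of unity. -/
def ModTorsion : Type u := (𝓞 F)ˣ ⧸ torsion F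

instance : CommGroup (ModTorsion F) := inferInstanceAs (CommGroup ((𝓞 F)ˣ ⧸ torsion F))

/-- The projection of the units to the units modulo roots of unity. -/
def toModTorsion : (𝓞 F)ˣ →* ModTorsion F := QuotientGroup.mk' (torsion F)

theorem toModTorsion_surjective : Function.Surjective (toModTorsion F) :=
  QuotientGroup.mk'_surjective (torsion F)

theorem toModTorsion_eq_one_iff (x : (𝓞 F)ˣ) : toModTorsion F x = 1 ↔ x ∈ torsion F :=
  QuotientGroup.eq_one_iff x

variable [NumberField F]

/-- A basis of the units modulo roots of unity. -/
def modTorsionBasis : Basis (Fin (rank F)) ℤ (Additive (ModTorsion F)) := basisModTorsion F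

theorem modTorsionBasis_eq (i) :
    modTorsionBasis F i = Additive.ofMul (toModTorsion F (fundSystem F i)) :=
  (fundSystem_mk F i).symm

instance : Module.Free ℤ (Additive (ModTorsion F)) := .of_basis (modTorsionBasis F)
instance : Module.Finite ℤ (Additive (ModTorsion F)) := .of_basis (modTorsionBasis F)

/-- The logarithms `(m_w log |x|_w)_w` of a unit modulo roots of unity. -/
def placeLog : Additive (ModTorsion F) →+ (InfinitePlace F → ℝ) :=
  MonoidHom.toAdditiveLeft (QuotientGroup.lift (torsion F)
    ({ toFun := fun x => Multiplicative.ofAdd fun w : InfinitePlace F => mult w * Real.log (w x)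
       map_one' := congrArg Multiplicative.ofAdd (funext fun w => by simp)
       map_mul' := fun x y =>
        congrArg Multiplicative.ofAdd (funext fun w => by simp [Real.log_mul, mul_add]) } :
      (𝓞 F)ˣ →* Multiplicative (InfinitePlace F → ℝ))
    (fun x hx => congrArg Multiplicative.ofAdd (funext fun w => by
      have hw : w x = 1 := (mem_torsion F).1 hx w
      change mult w * Real.log (w x) = 0
      rw [hw, Real.log_one, mul_zero])))

theorem placeLog_mk (x : (𝓞 F)ˣ) (w : InfinitePlace F) :
    placeLog F (Additive.ofMul (toModTorsion F x)) w = mult w * Real.log (w x) := rfl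

/-- By Dirichlet the logarithms of fundamental units are independent even after one coordinate is
dropped. Their coordinates sum to zero by the product formula, whereas those of (1, …, 1) do not. -/
theorem linearIndependent_placeLog : LinearIndependent ℝ
    (fun o : Option (Fin (rank F)) =>
      o.elim (1 : InfinitePlace F → ℝ) fun i => placeLog F (modTorsionBasis F i)) := by
  have hb : ∀ i, placeLog F (modTorsionBasis F i) = fun w : InfinitePlace F =>
      mult w * Real.log (w (fundSystem F i : 𝓞 F)) := fun i => by
    rw [modTorsionBasis_eq]
    rfl
  rw [linearIndependent_option]
  constructor
  · let r : (InfinitePlace F → ℝ) →ₗ[ℝ] dirichletUnitTheorem.logSpace F :=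
      LinearMap.funLeft ℝ ℝ Subtype.val
    refine LinearIndependent.of_comp r ?_
    have h : LinearIndependent ℝ fun i => logEmbedding F (Additive.ofMul (fundSystem F i)) :=
      isMaxRank_fundSystem F
    convert! h using 1
    funext i
    change r (placeLog F (modTorsionBasis F i)) = _
    rw [hb]
    rfl
  · intro h
    let s : (InfinitePlace F → ℝ) →ₗ[ℝ] ℝ := ∑ w, LinearMap.proj w
    have hs : ∀ v, s v = ∑ w, v w := fun v => by simp [s]
    have hle : Submodule.span ℝ (Set.range ((fun o : Option (Fin (rank F)) =>
        o.elim (1 : InfinitePlace F → ℝ) fun i => placeLog F (modTorsionBasis F i)) ∘ some)) ≤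
        LinearMap.ker s := by
      rw [Submodule.span_le]
      rintro _ ⟨i, rfl⟩
      change s (placeLog F (modTorsionBasis F i)) = 0
      rw [hs, hb]
      exact sum_mult_mul_log _
    have h1 : s 1 = 0 := hle h
    rw [hs] at h1
    simp at h1

/-- The basis of the logarithmic space that consists of the logarithms of a system of fundamental
units and the vector `(1, …, 1)`. -/
def logBasis : Basis (Option (Fin (rank F))) ℝ (InfinitePlace F → ℝ) :=
  basisOfLinearIndependentOfCardEqFinrank (linearIndependent_placeLog F) (by
    rw [Fintype.card_option, Fintype.card_fin, Module.finrank_fintype_fun_eq_card, rank,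
      Nat.sub_add_cancel Fintype.card_pos])

theorem logBasis_none : logBasis F none = 1 := by
  simp [logBasis]

theorem logBasis_some (i) : logBasis F (some i) = placeLog F (modTorsionBasis F i) := by
  simp [logBasis]

/-- A real-valued homomorphism on the units modulo torsion extends uniquely to a linear form on the
logarithmic space that vanishes at `(1, …, 1)`. -/
theorem existsUnique_logForm (f : Additive (ModTorsion F) →+ ℝ) :
    ∃! ℓ : (InfinitePlace F → ℝ) →ₗ[ℝ] ℝ, ℓ 1 = 0 ∧ ∀ x, ℓ (placeLog F x) = f x := by
  refine ⟨(logBasis F).constr ℝ (fun o => o.elim 0 fun i => f (modTorsionBasis F i)),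
    ⟨?_, fun x => ?_⟩, ?_⟩
  · rw [← logBasis_none, Basis.constr_basis]
    rfl
  · set ℓ := (logBasis F).constr ℝ (fun o => o.elim 0 fun i => f (modTorsionBasis F i))
    have : (ℓ.toAddMonoidHom.comp (placeLog F)).toIntLinearMap = f.toIntLinearMap := by
      refine (modTorsionBasis F).ext fun i => ?_
      change ℓ (placeLog F (modTorsionBasis F i)) = _
      rw [← logBasis_some, Basis.constr_basis]
      rfl
    exact LinearMap.congr_fun this x
  · rintro ℓ ⟨h1, h2⟩
    refine (logBasis F).ext fun o => ?_
    rw [Basis.constr_basis]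
    cases o with
    | none => rw [logBasis_none, h1]; rfl
    | some i => rw [logBasis_some, h2]; rfl

end NumberField.Units

/-! ### The character of the units, and the torsion of Ψ -/

section UnitCharacter

open NumberField NumberField.Units NumberField.InfinitePlace Module G0 LatticeTrace

variable (K : Type v) (F : Type u) [Field K] [Field F] [NumberField F] [Algebra K F]

instance : MulDistribMulAction Gal(F/K) (ModTorsion F) :=
  quotientAction (torsion F) (fun g _ ha =>
    MonoidHom.isOfFinOrder (MulDistribMulAction.toMonoidHom (𝓞 F)ˣ g) ha)

/-- The units modulo roots of unity as a Galois module. -/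
abbrev unitsModTorsionRep : Representation ℤ Gal(F/K) (Additive (ModTorsion F)) :=
  Representation.ofMulDistribMulAction Gal(F/K) (ModTorsion F)

theorem mult_smul {K : Type v} {F : Type u} [Field K] [Field F] [Algebra K F] (g : Gal(F/K))
    (w : InfinitePlace F) : mult (g • w) = mult w := by
  classical
  unfold mult
  exact if_congr isReal_smul_iff rfl rfl

theorem placeLog_smul (g : Gal(F/K)) (x : Additive (ModTorsion F)) (w : InfinitePlace F) :
    placeLog F (unitsModTorsionRep K F g x) w = placeLog F x (g⁻¹ • w) := by
  obtain ⟨y, hy⟩ := toModTorsion_surjective F (Additive.toMul x)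
  obtain rfl : Additive.ofMul (toModTorsion F y) = x := hy
  change placeLog F (Additive.ofMul (toModTorsion F (g • y))) w = _
  rw [placeLog_mk, placeLog_mk, mult_smul]
  rfl

instance : Module.Finite ℤ (Additive (torsion F)) :=
  have : Finite (Additive (torsion F)) := inferInstanceAs (Finite (torsion F))
  inferInstance

instance : Module.Finite ℤ (Additive (Cl F)) :=
  have : Finite (Additive (Cl F)) := inferInstanceAs (Finite (Cl F))
  inferInstance

theorem clsRep_unitsRep : clsRep (unitsRep K F) =
    clsRep (rootsRep K F) + clsRep (unitsModTorsionRep K F) := by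
  refine clsRep_of_exact (MonoidHom.toAdditive (torsion F).subtype)
    (MonoidHom.toAdditive (toModTorsion F)) (fun _ _ => rfl) (fun _ _ => rfl)
    Subtype.val_injective (fun b => ?_) (toModTorsion_surjective F)
  refine (toModTorsion_eq_one_iff F (Additive.toMul b)).trans ?_
  exact ⟨fun h => ⟨Additive.ofMul ⟨_, h⟩, rfl⟩, by rintro ⟨a, rfl⟩; exact (Additive.toMul a).2⟩

/-- The linear isomorphism of the logarithmic space with `(𝓞ˣ/μ × ℤ) ⊗ ℝ`. -/
theorem exists_baseChange_logSpace :
    ∃ e : ℝ ⊗[ℤ] (Additive (ModTorsion F) × ℤ) ≃ₗ[ℝ] (InfinitePlace F → ℝ),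
      ∀ x n, e (1 ⊗ₜ (x, n)) = placeLog F x + fun _ => (n : ℝ) := by
  let b := (modTorsionBasis F).prod (Basis.singleton Unit ℤ)
  let v := (logBasis F).reindex (Equiv.optionEquivSumPUnit.{0} (Fin (rank F)))
  let e := (b.baseChange ℝ).equiv v (Equiv.refl _)
  refine ⟨e, fun x n => ?_⟩
  let f₁ : Additive (ModTorsion F) × ℤ →+ (InfinitePlace F → ℝ) :=
    e.toLinearMap.toAddMonoidHom.comp (TensorProduct.mk ℤ ℝ (Additive (ModTorsion F) × ℤ) 1).toAddMonoidHom
  let f₂ : Additive (ModTorsion F) × ℤ →+ (InfinitePlace F → ℝ) :=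
    (placeLog F).coprod ⟨⟨fun n _ => (n : ℝ), funext fun _ => Int.cast_zero⟩,
      fun m n => funext fun _ => Int.cast_add m n⟩
  have h : f₁.toIntLinearMap = f₂.toIntLinearMap := by
    refine b.ext fun i => ?_
    change e (1 ⊗ₜ b i) = f₂ (b i)
    rw [← Basis.baseChange_apply ℝ b i, Basis.equiv_apply]
    cases i with
    | inl i =>
      have : v (Sum.inl i) = logBasis F (some i) := by simp [v]
      change v (Sum.inl i) = _
      rw [this, logBasis_some]
      have hb : b (Sum.inl i) = (modTorsionBasis F i, 0) := by simp [b]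
      rw [hb]
      refine funext fun w => ?_
      change _ = placeLog F (modTorsionBasis F i) w + ((0 : ℤ) : ℝ)
      rw [Int.cast_zero, add_zero]
    | inr i =>
      have : v (Sum.inr i) = logBasis F none := by simp [v]
      change v (Sum.inr i) = _
      rw [this, logBasis_none]
      have hb : b (Sum.inr i) = (0, 1) := by simp [b]
      rw [hb]
      refine funext fun w => ?_
      change _ = placeLog F 0 w + ((1 : ℤ) : ℝ)
      rw [map_zero, Int.cast_one, Pi.zero_apply, zero_add]
      rfl
  exact LinearMap.congr_fun h (x, n)

/-- The trace of a permutation of the coordinates is the number of fixed points. -/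
theorem trace_funLeft {X : Type*} [Finite X] (f : X → X) :
    LinearMap.trace ℝ (X → ℝ) (LinearMap.funLeft ℝ ℝ f) = Nat.card {x // f x = x} := by
  classical
  have := Fintype.ofFinite X
  rw [LinearMap.trace_eq_matrix_trace ℝ (Pi.basisFun ℝ X), Matrix.trace, Nat.card_eq_fintype_card,
    Fintype.card_subtype, Finset.card_filter, Nat.cast_sum]
  refine Finset.sum_congr rfl fun x _ => ?_
  rw [Matrix.diag_apply, LinearMap.toMatrix_apply, Pi.basisFun_apply, Pi.basisFun_repr,
    LinearMap.funLeft_apply, Pi.single_apply]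
  simp

/-- Logarithms identify (U ⊕ ℤ) ⊗ ℝ equivariantly with the functions on the places, where ℤ goes to
the constants. The trace of a permutation there counts fixed points, the same for g and g⁻¹. -/
theorem trace_unitsModTorsionRep (g : Gal(F/K)) :
    LinearMap.trace ℤ (Additive (ModTorsion F)) (unitsModTorsionRep K F g) + 1 =
      Nat.card {w : InfinitePlace F // g • w = w} := by
  obtain ⟨e, he⟩ := exists_baseChange_logSpace F
  have h := trace_eq_of_baseChange_equiv e ((unitsModTorsionRep K F g).prodMap LinearMap.id)
    (LinearMap.funLeft ℝ ℝ (g⁻¹ • · : InfinitePlace F → InfinitePlace F)) (by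
      rintro ⟨x, n⟩
      change e (1 ⊗ₜ (unitsModTorsionRep K F g x, n)) = _
      rw [he, he]
      refine funext fun w => ?_
      rw [LinearMap.funLeft_apply, Pi.add_apply, Pi.add_apply, placeLog_smul])
  rw [trace_funLeft, LinearMap.trace_prodMap', LinearMap.trace_id, Module.finrank_self] at h
  have h2 : Nat.card {w : InfinitePlace F // g⁻¹ • w = w} =
      Nat.card {w : InfinitePlace F // g • w = w} :=
    Nat.card_congr (Equiv.subtypeEquivRight fun w => by rw [inv_smul_eq_iff, eq_comm])
  rw [h2] at h
  exact_mod_cast h.symm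

variable [NumberField K]

theorem clsRep_placesRep : clsRep (placesRep K F) =
    clsRep (xRep K F) + clsRep (trivialRep K F) := by
  have : Module.Finite ℤ (LinearMap.ker (placesAugmentation F)) := inferInstance
  have haug : ∀ w, placesAugmentation F (MonoidAlgebra.single w 1) = 1 := fun w => by
    simp [placesAugmentation]
  refine clsRep_of_exact (LinearMap.ker (placesAugmentation F)).subtype.toAddMonoidHom
    ((ULift.moduleEquiv (R := ℤ)).symm.toAddEquiv.toAddMonoidHom.comp
      (placesAugmentation F).toAddMonoidHom)
    (fun _ _ => rfl) (fun g b => ?_) Subtype.val_injective (fun b => ?_) ?_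
  · exact congrArg ULift.up (LinearMap.congr_fun (placesAugmentation_comp K F g) b)
  · constructor
    · intro h
      exact ⟨⟨b, congrArg ULift.down h⟩, rfl⟩
    · rintro ⟨a, rfl⟩
      exact congrArg ULift.up a.2
  · rintro ⟨n⟩
    refine ⟨n • MonoidAlgebra.single (Classical.arbitrary (InfinitePlace F)) 1, ?_⟩
    refine congrArg ULift.up ?_
    change placesAugmentation F _ = n
    rw [map_smul, haug, smul_eq_mul, mul_one]

theorem Psi_eq : Psi K F = clsRep (rootsRep K F) + clsRep (unitsModTorsionRep K F) +
    clsRep (trivialRep K F) - clsRep (placesRep K F) - clsRep (clRep K F) := by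
  rw [Psi, clsRep_unitsRep, clsRep_placesRep]
  abel

/-- The roots of unity and the class group are finite. What remains of Ψ is the difference between
the lattices U ⊕ ℤ and ℤ[S_∞], which have equal characters. -/
theorem Psi_mem_torsion : Psi K F ∈ AddCommGroup.torsion (G0 (MonoidAlgebra ℤ Gal(F/K))) := by
  have : Finite (rootsRep K F).asModule := inferInstanceAs (Finite (torsion F))
  have : Finite (clRep K F).asModule := inferInstanceAs (Finite (Cl F))
  have h1 : clsRep (rootsRep K F) ∈ AddCommGroup.torsion _ :=
    ArtinInduction.cls_mem_torsion_of_finite (G := Gal(F/K)) (rootsRep K F).asModule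
  have h2 : clsRep (clRep K F) ∈ AddCommGroup.torsion _ :=
    ArtinInduction.cls_mem_torsion_of_finite (G := Gal(F/K)) (clRep K F).asModule
  have : Module.Free ℤ (unitsModTorsionRep K F).asModule :=
    inferInstanceAs (Module.Free ℤ (Additive (ModTorsion F)))
  have : Module.Free ℤ (ULift.{u} ℤ) := Module.Free.of_equiv ULift.moduleEquiv.symm
  have : Module.Free ℤ (trivialRep K F).asModule := inferInstanceAs (Module.Free ℤ (ULift.{u} ℤ))
  have hfree : Module.Free ℤ ((unitsModTorsionRep K F).asModule × (trivialRep K F).asModule) :=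
    inferInstance
  have h3 := ArtinInduction.cls_sub_cls_mem_torsion (G := Gal(F/K))
    ((unitsModTorsionRep K F).asModule × (trivialRep K F).asModule)
    (PermMod Gal(F/K) (InfinitePlace F)) (fun g => by
      rw [chi_eq_add_of_exact (LinearMap.inl _ _ _)
        (LinearMap.snd _ (unitsModTorsionRep K F).asModule (trivialRep K F).asModule)
        LinearMap.inl_injective .inl_snd LinearMap.snd_surjective, chi_permMod, chi_asModule,
        chi_asModule, ← trace_unitsModTorsionRep]
      congr 1
      change LinearMap.trace ℤ (ULift.{u} ℤ) LinearMap.id = 1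
      rw [LinearMap.trace_id, LinearEquiv.finrank_eq ULift.moduleEquiv, Module.finrank_self,
        Nat.cast_one])
  rw [cls_prod] at h3
  change clsRep (unitsModTorsionRep K F) + clsRep (trivialRep K F) - clsRep (placesRep K F) ∈ _
    at h3
  have h4 := sub_mem (add_mem h1 h3) h2
  rw [Psi_eq]
  convert h4 using 1
  abel

end UnitCharacter

/-! ### Characters with values in the circle -/

section CircleCharacters

/-- A continuous character of a finite-dimensional real vector space is `v ↦ exp(2πi ℓ(v))`. -/
theorem exists_linearMap_of_continuous_character {V : Type*} [NormedAddCommGroup V]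
    [NormedSpace ℝ V] (χ : V →+ Additive Circle)
    (hχ : Continuous fun v => Additive.toMul (χ v)) :
    ∃ ℓ : V →ₗ[ℝ] ℝ, ∀ v, circleExp (ℓ v) = χ v := by
  let f : C(V, Circle) := ⟨_, hχ⟩
  obtain ⟨L, ⟨hL0, hL⟩, -⟩ := Circle.isCoveringMap_exp.existsUnique_continuousMap_lifts f 0 0
    (by change Circle.exp 0 = Additive.toMul (χ 0); rw [map_zero χ, Circle.exp_zero]; rfl)
  have hL' : ∀ v, Circle.exp (L v) = Additive.toMul (χ v) := fun v => congrFun hL v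
  have hadd : ∀ v w, L (v + w) = L v + L w := by
    -- The defect of additivity of the lift L is itself a lift of the constant character on V × V
    -- that vanishes at 0, so it is zero by uniqueness of lifts.
    let D : C(V × V, ℝ) := ⟨fun x => L (x.1 + x.2) - L x.1 - L x.2, by fun_prop⟩
    have h := (Circle.isCoveringMap_exp.existsUnique_continuousMap_lifts
      (⟨fun _ => 1, continuous_const⟩ : C(V × V, Circle)) 0 0 Circle.exp_zero).unique
      (y₁ := D) (y₂ := ⟨fun _ => 0, continuous_const⟩)
      ⟨by simp [D, hL0], funext fun x => by
        change Circle.exp (L (x.1 + x.2) - L x.1 - L x.2) = 1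
        rw [Circle.exp_sub, Circle.exp_sub, hL', hL', hL', map_add, toMul_add]
        simp⟩
      ⟨rfl, funext fun x => Circle.exp_zero⟩
    intro v w
    have h2 : L (v + w) - L v - L w = 0 := DFunLike.congr_fun h (v, w)
    linarith
  let ℓ : V →L[ℝ] ℝ := AddMonoidHom.toRealLinearMap ⟨⟨L, hL0⟩, hadd⟩ L.continuous
  refine ⟨(2 * Real.pi)⁻¹ • ℓ.toLinearMap, fun v => ?_⟩
  change Additive.ofMul (Circle.exp (2 * Real.pi * ((2 * Real.pi)⁻¹ * L v))) = χ v
  rw [mul_inv_cancel_left₀ (by positivity), hL']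
  rfl

/-- A continuous endomorphism of the circle is a power map. -/
theorem exists_zpow_of_continuous_character (c : Circle →* Circle) (hc : Continuous c) :
    ∃ n : ℤ, ∀ z, c z = z ^ n := by
  have hcont : Continuous fun t : ℝ => Additive.toMul (circleExp t) := by
    change Continuous fun t : ℝ => Circle.exp (2 * Real.pi * t)
    fun_prop
  obtain ⟨ℓ, hℓ⟩ := exists_linearMap_of_continuous_character
    ((MonoidHom.toAdditive c).comp circleExp) (hc.comp hcont)
  have h1 : circleExp 1 = 0 := (circleExp_eq_zero_iff 1).2 ⟨1, by simp⟩
  -- Pulled back to ℝ the character is t ↦ exp(2πi ℓ(t)). It is trivial at t = 1, so the slope ℓ(1)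
  -- is an integer.
  obtain ⟨n, hn⟩ := (circleExp_eq_zero_iff (ℓ 1)).1 (by
    rw [hℓ, AddMonoidHom.comp_apply, h1, map_zero])
  refine ⟨n, fun z => ?_⟩
  obtain ⟨t, ht⟩ := circleExp_surjective (Additive.ofMul z)
  have h2 : ℓ t = n • t := by
    rw [zsmul_eq_mul, ← hn, mul_comm, ← smul_eq_mul, ← map_smul, smul_eq_mul, mul_one]
  have h3 := hℓ t
  rw [h2, map_zsmul, AddMonoidHom.comp_apply, ht] at h3
  exact (congrArg Additive.toMul h3).symm

/-- The circle is divisible, hence characters extend. -/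
theorem exists_character_extension {A B : Type*} [CommGroup A] [CommGroup B] (φ : B →* A)
    (ψ : B →* Circle) (h : ∀ b, φ b = 1 → ψ b = 1) : ∃ χ : A →* Circle, ∀ b, χ (φ b) = ψ b := by
  let _ : DivisibleBy (Additive Circle) ℤ :=
    circleExp_surjective.divisibleBy circleExp fun a n => map_zsmul _ _ _
  let ψ' : φ.range →* Circle := φ.rangeRestrict.liftOfSurjective φ.rangeRestrict_surjective
    ⟨ψ, fun b hb => h b (congrArg Subtype.val hb)⟩
  have hψ' : ∀ b, ψ' (φ.rangeRestrict b) = ψ b := fun b =>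
    MonoidHom.liftOfRightInverse_comp_apply _ _ _ _ b
  obtain ⟨χ, hχ⟩ := (Module.Baer.of_divisible (Additive Circle)).extension_property_addMonoidHom
    (MonoidHom.toAdditive φ.range.subtype) Subtype.val_injective (MonoidHom.toAdditive ψ')
  refine ⟨MonoidHom.toAdditive.symm χ, fun b => ?_⟩
  rw [← hψ']
  exact congrArg Additive.toMul (DFunLike.congr_fun hχ (Additive.ofMul (φ.rangeRestrict b)))

end CircleCharacters

/-! ### Coordinates on `F_ℝ` -/

section Coordinates

open NumberField NumberField.ComplexEmbedding Module ComplexConjugate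

variable (F : Type u) [Field F] [NumberField F]

variable {F} in
theorem extendEmbedding_tmul (φ : F →+* ℂ) (r : ℝ) (a : F) :
    extendEmbedding φ (r ⊗ₜ[ℚ] a : ℝ ⊗[ℚ] F) = r * φ a :=
  Algebra.TensorProduct.lift_tmul _ _ _ _ _

variable {F} in
theorem extendEmbedding_toRealAlgebra (φ : F →+* ℂ) (a : F) :
    extendEmbedding φ (toRealAlgebra F a) = φ a := by
  refine (extendEmbedding_tmul φ 1 a).trans ?_
  rw [Complex.ofReal_one, one_mul]

variable {F} in
theorem extendEmbedding_conjugate (φ : F →+* ℂ) (x : RealAlgebra F) :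
    extendEmbedding (conjugate φ) x = conj (extendEmbedding φ x) := by
  have : extendEmbedding (conjugate φ) = (Complex.conjAe : ℂ →ₐ[ℝ] ℂ).comp (extendEmbedding φ) := by
    refine Algebra.TensorProduct.ext (by ext) ?_
    ext a
    refine (extendEmbedding_toRealAlgebra (conjugate φ) a).trans ?_
    exact (congrArg conj (extendEmbedding_toRealAlgebra φ a)).symm
  exact DFunLike.congr_fun this x

theorem continuous_extendEmbedding (φ : F →+* ℂ) : Continuous (extendEmbedding φ) :=
  IsModuleTopology.continuous_of_linearMap (extendEmbedding φ).toLinearMap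

/-- The coordinates `(φ(x))_φ` of an element of `F_ℝ`. -/
def realCoord : RealAlgebra F →ₗ[ℝ] ((F →+* ℂ) → ℂ) :=
  LinearMap.pi fun φ => (extendEmbedding φ).toLinearMap

theorem realCoord_apply (x : RealAlgebra F) (φ : F →+* ℂ) :
    realCoord F x φ = extendEmbedding φ x := rfl

/-- An integral basis of `F`, as a real basis of `F_ℝ`. -/
def realBasis : Basis (Free.ChooseBasisIndex ℤ (𝓞 F)) ℝ (RealAlgebra F) :=
  ((integralBasis F).baseChange ℝ : Basis _ ℝ (ℝ ⊗[ℚ] F))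

theorem realCoord_realBasis (i) :
    realCoord F (realBasis F i) = canonicalEmbedding.latticeBasis F i := by
  funext φ
  rw [canonicalEmbedding.latticeBasis_apply, realCoord_apply]
  have : realBasis F i = toRealAlgebra F (integralBasis F i) :=
    Basis.baseChange_apply ℝ (integralBasis F) i
  rw [this, extendEmbedding_toRealAlgebra]
  rfl

theorem realCoord_eq_sum (x : RealAlgebra F) :
    realCoord F x = ∑ i, ((realBasis F).repr x i : ℂ) • canonicalEmbedding.latticeBasis F i := by
  conv_lhs => rw [← (realBasis F).sum_repr x]
  rw [map_sum]
  refine Finset.sum_congr rfl fun i _ => ?_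
  rw [map_smul, realCoord_realBasis]
  rfl

/-- An integral basis gives both a real basis of F_ℝ and a complex basis of the tuples indexed by
embeddings, and an element has the same coordinates in both. This gives injectivity, and later the
image and the norm. -/
theorem realCoord_repr (x : RealAlgebra F) (i) :
    (canonicalEmbedding.latticeBasis F).repr (realCoord F x) i = ((realBasis F).repr x i : ℂ) := by
  rw [realCoord_eq_sum, Basis.repr_sum_self]

theorem realCoord_injective : Function.Injective (realCoord F) := by
  intro x y h
  refine (realBasis F).repr.injective (Finsupp.ext fun i => ?_)
  have := realCoord_repr F x i
  rw [h, realCoord_repr] at this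
  exact_mod_cast this.symm

variable {F} in
theorem realAlgebra_ext {x y : RealAlgebra F}
    (h : ∀ φ : F →+* ℂ, extendEmbedding φ x = extendEmbedding φ y) : x = y :=
  realCoord_injective F (funext h)

variable {F} in
theorem realUnits_ext {x y : (RealAlgebra F)ˣ}
    (h : ∀ φ : F →+* ℂ, extendEmbedding φ (x : RealAlgebra F) = extendEmbedding φ y) : x = y :=
  Units.ext (realAlgebra_ext h)

/-- The real subspace of tuples compatible with complex conjugation. -/
def conjCompatible : Submodule ℝ ((F →+* ℂ) → ℂ) where
  carrier := {z | ∀ φ, z (conjugate φ) = conj (z φ)}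
  add_mem' hx hy φ := by simp [hx φ, hy φ]
  zero_mem' φ := by simp
  smul_mem' r x hx φ := by simp [hx φ]

/-- The lattice basis consists of conjugation-compatible vectors, so a tuple is compatible only if
its coordinates in that basis are real. -/
theorem range_realCoord : LinearMap.range (realCoord F) = conjCompatible F := by
  refine le_antisymm ?_ fun z hz => ?_
  · rintro _ ⟨x, rfl⟩ φ
    exact extendEmbedding_conjugate φ x
  · let B := canonicalEmbedding.latticeBasis F
    have hB : ∀ i φ, B i (conjugate φ) = conj (B i φ) := fun i φ => by
      simp only [B, ← realCoord_realBasis]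
      exact extendEmbedding_conjugate φ _
    have hz' : ∀ φ, z φ = ∑ i, B.repr z i * B i φ := fun φ => by
      conv_lhs => rw [← B.sum_repr z]
      simp
    have hc : ∀ i, conj (B.repr z i) = B.repr z i := by
      have : ∑ i, conj (B.repr z i) • B i = z := by
        funext φ
        have h1 := congrArg conj (hz (conjugate φ))
        rw [RingHomCompTriple.comp_apply, RingHom.id_apply] at h1
        have h2 : conjugate (conjugate φ) = φ := star_star φ
        rw [h2] at h1
        rw [← Complex.conj_conj (z φ), h1, hz' (conjugate φ)]
        simp [hB]
      intro i
      conv_rhs => rw [← this]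
      rw [Basis.repr_sum_self]
    refine ⟨∑ i, (B.repr z i).re • realBasis F i, ?_⟩
    rw [map_sum]
    conv_rhs => rw [← B.sum_repr z]
    refine Finset.sum_congr rfl fun i _ => ?_
    rw [map_smul, realCoord_realBasis, ← Complex.conj_eq_iff_re.1 (hc i)]
    rfl

/-- The norm on `F_ℝ` is the product of the coordinates. -/
theorem norm_eq_prod_extendEmbedding (x : RealAlgebra F) :
    (Algebra.norm ℝ x : ℂ) = ∏ φ : F →+* ℂ, extendEmbedding φ x := by
  classical
  let B := canonicalEmbedding.latticeBasis F
  let T : ((F →+* ℂ) → ℂ) →ₗ[ℂ] ((F →+* ℂ) → ℂ) := LinearMap.mulLeft ℂ (realCoord F x)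
  -- Coordinatewise multiplication by x has, in the lattice basis, the real matrix of multiplication
  -- by x on F_ℝ. In the standard basis it is diagonal, and the determinant does not depend on the
  -- basis.
  have h1 : LinearMap.toMatrix B B T =
      (Algebra.leftMulMatrix (realBasis F) x).map Complex.ofRealHom := by
    ext i j
    rw [LinearMap.toMatrix_apply, Matrix.map_apply, Algebra.leftMulMatrix_eq_repr_mul]
    have : T (B j) = realCoord F (x * realBasis F j) := by
      change realCoord F x * B j = _
      simp only [B, ← realCoord_realBasis]
      exact funext fun φ => (map_mul (extendEmbedding φ) _ _).symm
    rw [this, realCoord_repr]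
    rfl
  have h2 : LinearMap.toMatrix (Pi.basisFun ℂ _) (Pi.basisFun ℂ _) T =
      Matrix.diagonal (realCoord F x) := by
    ext φ ψ
    rw [LinearMap.toMatrix_apply, Pi.basisFun_apply, Pi.basisFun_repr, Matrix.diagonal_apply]
    change realCoord F x φ * (Pi.single ψ 1 : (F →+* ℂ) → ℂ) φ = _
    rw [Pi.single_apply]
    split_ifs <;> simp
  rw [Algebra.norm_eq_matrix_det (realBasis F), ← Complex.ofRealHom_eq_coe, RingHom.map_det]
  change Matrix.det ((Algebra.leftMulMatrix (realBasis F) x).map Complex.ofRealHom) = _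
  rw [← h1, LinearMap.det_toMatrix, ← LinearMap.det_toMatrix (Pi.basisFun ℂ _), h2,
    Matrix.det_diagonal]
  rfl

/-- Continuous families of tuples compatible with complex conjugation define continuous
homomorphisms to `F_ℝˣ`. -/
theorem exists_continuous_unitHom {T : Type*} [Group T] [TopologicalSpace T]
    [IsTopologicalGroup T] (γ : (F →+* ℂ) → T →* ℂ) (hγ : ∀ φ, Continuous (γ φ))
    (hconj : ∀ φ t, γ (conjugate φ) t = conj (γ φ t)) :
    ∃ s : T →* (RealAlgebra F)ˣ, Continuous s ∧
      ∀ φ t, extendEmbedding φ (s t : RealAlgebra F) = γ φ t := by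
  let e : RealAlgebra F ≃ₗ[ℝ] conjCompatible F :=
    (LinearEquiv.ofInjective (realCoord F) (realCoord_injective F)).trans
      (LinearEquiv.ofEq _ _ (range_realCoord F))
  let z : T → conjCompatible F := fun t => ⟨fun φ => γ φ t, fun φ => hconj φ t⟩
  have hz : Continuous z := Continuous.subtype_mk (continuous_pi hγ) _
  have hφ : ∀ φ t, extendEmbedding φ (e.symm (z t)) = γ φ t := fun φ t => by
    have : (e (e.symm (z t)) : (F →+* ℂ) → ℂ) φ = γ φ t := by rw [e.apply_symm_apply]
    exact this
  let s₀ : T →* RealAlgebra F :=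
    { toFun := fun t => e.symm (z t)
      map_one' := realAlgebra_ext fun φ => by rw [hφ, map_one, map_one]
      map_mul' := fun a b => realAlgebra_ext fun φ => by rw [map_mul, hφ, hφ, hφ, map_mul] }
  have hs₀ : Continuous s₀ := by
    have he : Continuous e.symm := LinearMap.continuous_of_finiteDimensional e.symm.toLinearMap
    exact he.comp hz
  -- The unit group carries the topology in which inverses also vary continuously; for a
  -- homomorphism the inverse of s(t) is s(t⁻¹).
  refine ⟨s₀.toHomUnits, Units.continuous_iff.2 ⟨hs₀, ?_⟩, hφ⟩
  have : (fun t => ((s₀.toHomUnits t)⁻¹ : (RealAlgebra F)ˣ).val) = fun t => s₀ t⁻¹ := by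
    funext t
    rw [← map_inv]
    rfl
  exact this ▸ hs₀.comp continuous_inv

end Coordinates

/-! ### The norm-one group and its image in the Arakelov class group -/

section NormOne

open NumberField NumberField.Units NumberField.InfinitePlace NumberField.ComplexEmbedding Module
  ComplexConjugate

variable (F : Type u) [Field F] [NumberField F]

/-- The group of elements of `F_ℝˣ` of norm `±1`. -/
def normOne : Subgroup (RealAlgebra F)ˣ := (realNorm F).ker

theorem extendEmbedding_units_ne_zero (φ : F →+* ℂ) (x : (RealAlgebra F)ˣ) :
    extendEmbedding φ (x : RealAlgebra F) ≠ 0 :=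
  (x.isUnit.map (extendEmbedding φ)).ne_zero

theorem realNorm_eq_prod (x : (RealAlgebra F)ˣ) :
    realNorm F x = ∏ φ : F →+* ℂ, ‖extendEmbedding φ (x : RealAlgebra F)‖ := by
  change |Algebra.norm ℝ (x : RealAlgebra F)| = _
  rw [← norm_prod, ← norm_eq_prod_extendEmbedding, Complex.norm_real, Real.norm_eq_abs]

theorem norm_extendEmbedding_eq {φ ψ : F →+* ℂ} (h : mk φ = mk ψ) (x : RealAlgebra F) :
    ‖extendEmbedding φ x‖ = ‖extendEmbedding ψ x‖ := by
  rcases mk_eq_iff.1 h with rfl | rfl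
  · rfl
  · rw [extendEmbedding_conjugate, RCLike.norm_conj]

/-- The logarithms `(m_w log |x|_w)_w` of an element of `F_ℝˣ`. -/
def realLog : Additive (RealAlgebra F)ˣ →+ (InfinitePlace F → ℝ) where
  toFun x w := mult w * Real.log ‖extendEmbedding w.embedding ((Additive.toMul x : (RealAlgebra F)ˣ) : RealAlgebra F)‖
  map_zero' := funext fun w => by
    change mult w * Real.log ‖extendEmbedding w.embedding (1 : RealAlgebra F)‖ = 0
    simp
  map_add' x y := funext fun w => by
    change mult w * Real.log ‖extendEmbedding w.embedding
      (((Additive.toMul x : (RealAlgebra F)ˣ) : RealAlgebra F) * ((Additive.toMul y : (RealAlgebra F)ˣ) : RealAlgebra F))‖ = _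
    rw [map_mul, norm_mul, Real.log_mul (norm_ne_zero_iff.2 (extendEmbedding_units_ne_zero F _ _))
      (norm_ne_zero_iff.2 (extendEmbedding_units_ne_zero F _ _)), mul_add]
    rfl

theorem realLog_apply (x : (RealAlgebra F)ˣ) (w : InfinitePlace F) :
    realLog F (Additive.ofMul x) w =
      mult w * Real.log ‖extendEmbedding w.embedding (x : RealAlgebra F)‖ := rfl

theorem continuous_realLog : Continuous fun x : (RealAlgebra F)ˣ => realLog F (Additive.ofMul x) := by
  refine continuous_pi fun w => continuous_const.mul (Continuous.log ?_ fun x =>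
    norm_ne_zero_iff.2 (extendEmbedding_units_ne_zero F _ _))
  exact ((continuous_extendEmbedding F _).comp Units.continuous_val).norm

/-- The multiplicity m_w is the number of embeddings above w, all of which have the same absolute
value. -/
theorem sum_realLog (x : (RealAlgebra F)ˣ) :
    ∑ w, realLog F (Additive.ofMul x) w = Real.log (realNorm F x) := by
  classical
  rw [realNorm_eq_prod, Real.log_prod fun φ _ =>
    norm_ne_zero_iff.2 (extendEmbedding_units_ne_zero F φ x),
    ← Finset.sum_fiberwise (f := fun φ : F →+* ℂ => Real.log ‖extendEmbedding φ (x : RealAlgebra F)‖)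
      Finset.univ mk]
  refine Finset.sum_congr rfl fun w _ => ?_
  rw [Finset.sum_congr rfl (g := fun _ => Real.log ‖extendEmbedding w.embedding (x : RealAlgebra F)‖),
    Finset.sum_const, card_filter_mk_eq, nsmul_eq_mul, realLog_apply]
  intro φ hφ
  rw [norm_extendEmbedding_eq F ((Finset.mem_filter.1 hφ).2.trans (mk_embedding w).symm)]

theorem mem_normOne_iff (x : (RealAlgebra F)ˣ) :
    x ∈ normOne F ↔ ∑ w, realLog F (Additive.ofMul x) w = 0 := by
  have hpos : 0 < realNorm F x := by
    rw [realNorm_eq_prod]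
    exact Finset.prod_pos fun φ _ => norm_pos_iff.2 (extendEmbedding_units_ne_zero F φ x)
  rw [sum_realLog]
  change realNorm F x = 1 ↔ _
  constructor
  · intro h
    rw [h, Real.log_one]
  · intro h
    exact Real.eq_one_of_pos_of_log_eq_zero hpos h

theorem mem_maxCompact_iff (x : (RealAlgebra F)ˣ) :
    x ∈ maxCompact F ↔ realLog F (Additive.ofMul x) = 0 := by
  constructor
  · intro h
    funext w
    rw [realLog_apply, h w.embedding, Real.log_one, mul_zero]
    rfl
  · intro h φ
    rw [norm_extendEmbedding_eq F (mk_embedding (mk φ)).symm]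
    have h1 : (mult (mk φ) : ℝ) * Real.log ‖extendEmbedding (mk φ).embedding (x : RealAlgebra F)‖ = 0 :=
      congrFun h (mk φ)
    exact Real.eq_one_of_pos_of_log_eq_zero
      (norm_pos_iff.2 (extendEmbedding_units_ne_zero F _ x))
      ((mul_eq_zero.1 h1).resolve_left mult_coe_ne_zero)

theorem maxCompact_le_normOne : maxCompact F ≤ normOne F := fun x hx => by
  rw [mem_normOne_iff, (mem_maxCompact_iff F x).1 hx]
  exact Finset.sum_const_zero

/-- The units of `𝓞_F` in `F_ℝˣ`. -/
def unitsToReal : (𝓞 F)ˣ →* (RealAlgebra F)ˣ :=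
  (Units.map (toRealAlgebra F : F →* RealAlgebra F)).comp
    (Units.map (algebraMap (𝓞 F) F : 𝓞 F →* F))

theorem extendEmbedding_unitsToReal (φ : F →+* ℂ) (ε : (𝓞 F)ˣ) :
    extendEmbedding φ (unitsToReal F ε : RealAlgebra F) = φ (ε : F) :=
  extendEmbedding_toRealAlgebra φ _

theorem realLog_unitsToReal (ε : (𝓞 F)ˣ) :
    realLog F (Additive.ofMul (unitsToReal F ε)) =
      placeLog F (Additive.ofMul (toModTorsion F ε)) := by
  funext w
  rw [realLog_apply, placeLog_mk, extendEmbedding_unitsToReal, norm_embedding_eq]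

theorem unitsToReal_mem_normOne (ε : (𝓞 F)ˣ) : unitsToReal F ε ∈ normOne F := by
  rw [mem_normOne_iff, realLog_unitsToReal]
  exact sum_mult_mul_log ε

/-- Kronecker's theorem: a unit is a root of unity exactly when all its absolute values are 1. -/
theorem unitsToReal_mem_maxCompact (ε : (𝓞 F)ˣ) :
    unitsToReal F ε ∈ maxCompact F ↔ ε ∈ torsion F := by
  rw [mem_torsion, eq_iff_eq]
  exact forall_congr' fun φ => by rw [extendEmbedding_unitsToReal]

/-- Totally positive elements of `F_ℝˣ` with prescribed logarithms. -/
theorem exists_realExp : ∃ s : Multiplicative (InfinitePlace F → ℝ) →* (RealAlgebra F)ˣ,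
    Continuous s ∧ ∀ v, realLog F (Additive.ofMul (s (Multiplicative.ofAdd v))) = v := by
  -- Division by m_w undoes the weight in the definition of `realLog`.
  let γ : (F →+* ℂ) → Multiplicative (InfinitePlace F → ℝ) →* ℂ := fun φ =>
    { toFun := fun v => (Real.exp (Multiplicative.toAdd v (mk φ) / mult (mk φ)) : ℂ)
      map_one' := by simp
      map_mul' := fun v w => by simp [add_div, Complex.exp_add] }
  obtain ⟨s, hs, hsγ⟩ := exists_continuous_unitHom F γ (fun φ => by
    refine Complex.continuous_ofReal.comp (Real.continuous_exp.comp (Continuous.div_const ?_ _))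
    exact (continuous_apply (mk φ)).comp continuous_toAdd) (fun φ v => by
      change ((Real.exp _ : ℝ) : ℂ) = conj ((Real.exp _ : ℝ) : ℂ)
      rw [Complex.conj_ofReal, mk_conjugate_eq])
  refine ⟨s, hs, fun v => funext fun w => ?_⟩
  rw [realLog_apply, hsγ]
  change mult w * Real.log ‖((Real.exp (v (mk w.embedding) / mult (mk w.embedding)) : ℝ) : ℂ)‖ = v w
  rw [Complex.norm_real, Real.norm_eq_abs, Real.abs_exp, Real.log_exp, mk_embedding,
    mul_div_cancel₀ _ mult_coe_ne_zero]

/-- The map from the norm-one group to the oriented Arakelov class group. -/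
def normOneToFibre : normOne F →* normFibre F where
  toFun x := ⟨(1, x), (map_one (idealNorm F)).trans (Eq.symm x.2)⟩
  map_one' := rfl
  map_mul' _ _ := Subtype.ext (Prod.ext (one_mul (1 : IdealGroup F)).symm rfl)

/-- The projection to the oriented Arakelov class group. -/
def toPic : normFibre F →* OrientedPic F := QuotientGroup.mk' (diagonalMap F).range

theorem toPic_surjective : Function.Surjective (toPic F) := QuotientGroup.mk'_surjective _

theorem toPic_eq_one_iff (x : normFibre F) : toPic F x = 1 ↔ ∃ a, diagonalMap F a = x :=
  QuotientGroup.eq_one_iff x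

theorem continuous_toPic_iff {T : Type*} [TopologicalSpace T] (f : OrientedPic F → T) :
    Continuous f ↔ Continuous (f ∘ toPic F) :=
  (isQuotientMap_quot_mk (r := _)).continuous_iff

/-- Both a and its inverse generate the unit ideal, hence both are integral. -/
theorem exists_unit_of_toPrincipalIdeal_eq_one (a : Fˣ) (h : toPrincipalIdeal (𝓞 F) F a = 1) :
    ∃ ε : (𝓞 F)ˣ, Units.map (algebraMap (𝓞 F) F : 𝓞 F →* F) ε = a := by
  have key : ∀ b : Fˣ, toPrincipalIdeal (𝓞 F) F b = 1 → ∃ z : 𝓞 F, algebraMap (𝓞 F) F z = b := by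
    intro b hb
    have h1 : (b : F) ∈ (toPrincipalIdeal (𝓞 F) F b : FractionalIdeal (𝓞 F)⁰ F) := by
      rw [coe_toPrincipalIdeal]
      exact FractionalIdeal.mem_spanSingleton_self _ _
    rw [hb] at h1
    exact (FractionalIdeal.mem_one_iff _).1 h1
  obtain ⟨z, hz⟩ := key a h
  obtain ⟨y, hy⟩ := key a⁻¹ (by rw [map_inv, h, inv_one])
  have hinj := FaithfulSMul.algebraMap_injective (𝓞 F) F
  refine ⟨⟨z, y, hinj ?_, hinj ?_⟩, Units.ext hz⟩
  · rw [map_mul, hz, hy, Units.mul_inv, map_one]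
  · rw [map_mul, hz, hy, Units.inv_mul, map_one]

/-- The element (1, x) is principal when it is the image of some α with trivial ideal, that is, of a
unit. So the norm-one group modulo units embeds in the oriented class group. -/
theorem toPic_normOneToFibre_eq_one_iff (x : normOne F) :
    toPic F (normOneToFibre F x) = 1 ↔ ∃ ε, unitsToReal F ε = x := by
  rw [toPic_eq_one_iff]
  constructor
  · rintro ⟨a, ha⟩
    have h1 := congrArg Subtype.val ha
    obtain ⟨ε, rfl⟩ := exists_unit_of_toPrincipalIdeal_eq_one F a (congrArg Prod.fst h1)
    exact ⟨ε, congrArg Prod.snd h1⟩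
  · rintro ⟨ε, hε⟩
    refine ⟨Units.map (algebraMap (𝓞 F) F : 𝓞 F →* F) ε, Subtype.ext (Prod.ext ?_ hε)⟩
    change toPrincipalIdeal (𝓞 F) F _ = 1
    refine Units.ext ?_
    rw [coe_toPrincipalIdeal]
    refine SetLike.ext fun z => ?_
    rw [FractionalIdeal.mem_spanSingleton, Units.val_one, FractionalIdeal.mem_one_iff]
    constructor
    · rintro ⟨y, rfl⟩
      exact ⟨y * ε, by rw [map_mul, Algebra.smul_def]; rfl⟩
    · rintro ⟨y, rfl⟩
      refine ⟨y * (ε⁻¹ : (𝓞 F)ˣ), ?_⟩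
      rw [Algebra.smul_def]
      change algebraMap (𝓞 F) F _ * algebraMap (𝓞 F) F ε = _
      rw [← map_mul, mul_assoc, Units.inv_mul, mul_one]

instance : IsTopologicalGroup (IdealGroup F) where
  continuous_mul := continuous_of_discreteTopology
  continuous_inv := continuous_of_discreteTopology

/-- A continuous character of `F_ℝˣ` that is trivial on the units of `𝓞_F` defines a continuous
character of the oriented Arakelov class group. -/
theorem exists_pic_character (ψ : (RealAlgebra F)ˣ →* Circle) (hψ : Continuous ψ)
    (h : ∀ ε, ψ (unitsToReal F ε) = 1) :
    ∃ χ : PontryaginDual (OrientedPic F), ∀ x : normOne F, χ (toPic F (normOneToFibre F x)) = ψ x := by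
  -- The extension is purely algebraic, by divisibility of the circle; continuity is checked
  -- afterwards.
  obtain ⟨χ, hχ⟩ := exists_character_extension ((toPic F).comp (normOneToFibre F))
    (ψ.comp (normOne F).subtype) (fun x hx => by
      obtain ⟨ε, hε⟩ := (toPic_normOneToFibre_eq_one_iff F x).1 hx
      rw [MonoidHom.comp_apply, Subgroup.subtype_apply, ← hε, h])
  refine ⟨(⟨χ, ?_⟩ : OrientedPic F →ₜ* Circle), hχ⟩
  refine (continuous_toPic_iff F χ).2 ?_
  -- Continuity is needed only at the identity. Fractional ideals are discrete, so near the identity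
  -- the ideal component is 1, and there the character agrees with ψ of the second component.
  refine continuous_of_continuousAt_one (χ.comp (toPic F)) ?_
  have hc : ContinuousAt (fun x : normFibre F => ψ x.1.2) 1 :=
    (hψ.comp (continuous_snd.comp continuous_subtype_val)).continuousAt
  refine ContinuousAt.congr hc ?_
  have hopen : {x : normFibre F | x.1.1 = 1} ∈ nhds (1 : normFibre F) := by
    refine IsOpen.mem_nhds ?_ rfl
    exact (isOpen_discrete ({1} : Set (IdealGroup F))).preimage
      (continuous_fst.comp continuous_subtype_val)
  filter_upwards [hopen] with x hx
  obtain ⟨⟨I, y⟩, hy⟩ := x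
  obtain rfl : I = 1 := hx
  exact (hχ ⟨y, Eq.trans (Eq.symm hy) (map_one (idealNorm F))⟩).symm

end NormOne

/-! ### Characters of the norm-one group -/

section LogCharacters

open NumberField NumberField.Units NumberField.InfinitePlace NumberField.ComplexEmbedding Module
  ComplexConjugate

theorem eq_zero_of_forall_circleExp {a : ℝ} (h : ∀ t : ℝ, circleExp (t * a) = 0) : a = 0 := by
  by_contra ha
  -- At t = 1/(2a) the product t * a is 1/2, which is not an integer.
  obtain ⟨n, hn⟩ := (circleExp_eq_zero_iff _).1 (h (1 / 2 / a))
  rw [div_mul_cancel₀ _ ha] at hn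
  have h2 : (2 * n : ℤ) = 1 := by exact_mod_cast (by linarith : (2 : ℝ) * n = 1)
  omega

section Galois

variable {K : Type v} {F : Type u} [Field K] [Field F] [NumberField F] [Algebra K F]

theorem extendEmbedding_smul (φ : F →+* ℂ) (g : Gal(F/K)) (x : RealAlgebra F) :
    extendEmbedding φ (g • x) = extendEmbedding (φ.comp (g : F →+* F)) x := by
  have key : (extendEmbedding φ).comp (galReal g).toAlgHom =
      extendEmbedding (φ.comp (g : F →+* F)) := by
    refine Algebra.TensorProduct.ext (by ext) ?_
    ext y
    change extendEmbedding φ (galReal g ((1 : ℝ) ⊗ₜ[ℚ] y : ℝ ⊗[ℚ] F)) = _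
    rw [galReal_tmul, extendEmbedding_tmul]
    exact (extendEmbedding_tmul (φ.comp (g : F →+* F)) 1 y).symm
  exact DFunLike.congr_fun key x

theorem realLog_smul (g : Gal(F/K)) (x : (RealAlgebra F)ˣ) (w : InfinitePlace F) :
    realLog F (Additive.ofMul (g • x)) w = realLog F (Additive.ofMul x) (g⁻¹ • w) := by
  rw [realLog_apply, realLog_apply, mult_smul]
  change mult w * Real.log ‖extendEmbedding w.embedding (g • (x : RealAlgebra F))‖ = _
  rw [extendEmbedding_smul, norm_extendEmbedding_eq F (ψ := (g⁻¹ • w).embedding)]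
  rw [mk_embedding]
  conv_rhs => rw [← mk_embedding w]
  rfl

instance : MulDistribMulAction Gal(F/K) (normOne F) :=
  subgroupAction (normOne F) fun g x hx => (realNorm_smul g x).trans hx

theorem normOneToFibre_smul (g : Gal(F/K)) (x : normOne F) :
    normOneToFibre F (g • x) = g • normOneToFibre F x :=
  Subtype.ext (Prod.ext (smul_one g : g • (1 : IdealGroup F) = 1).symm rfl)

end Galois

variable (F : Type u) [Field F] [NumberField F]

/-- The linear form on the logarithmic space that extends a homomorphism on the units. -/
def logForm (f : Additive (ModTorsion F) →+ ℝ) : (InfinitePlace F → ℝ) →ₗ[ℝ] ℝ :=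
  (existsUnique_logForm F f).choose

theorem logForm_one (f) : logForm F f 1 = 0 := (existsUnique_logForm F f).choose_spec.1.1

theorem logForm_placeLog (f) (x) : logForm F f (placeLog F x) = f x :=
  (existsUnique_logForm F f).choose_spec.1.2 x

theorem eq_logForm {f} {ℓ : (InfinitePlace F → ℝ) →ₗ[ℝ] ℝ} (h1 : ℓ 1 = 0)
    (h2 : ∀ x, ℓ (placeLog F x) = f x) : ℓ = logForm F f :=
  (existsUnique_logForm F f).unique ⟨h1, h2⟩ ⟨logForm_one F f, logForm_placeLog F f⟩

theorem logForm_zero : logForm F 0 = 0 :=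
  (eq_logForm F rfl fun _ => rfl).symm

theorem logForm_add (f f') : logForm F (f + f') = logForm F f + logForm F f' := by
  refine (eq_logForm F ?_ fun x => ?_).symm
  · rw [LinearMap.add_apply, logForm_one, logForm_one, add_zero]
  · rw [LinearMap.add_apply, logForm_placeLog, logForm_placeLog]
    rfl

/-- The character `x ↦ exp(2πi f(Log x))` of `F_ℝˣ`. -/
def logChar (f : Additive (ModTorsion F) →+ ℝ) : (RealAlgebra F)ˣ →* Circle :=
  MonoidHom.toAdditive.symm (circleExp.comp ((logForm F f).toAddMonoidHom.comp (realLog F)))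

theorem logChar_apply (f) (x : (RealAlgebra F)ˣ) :
    Additive.ofMul (logChar F f x) = circleExp (logForm F f (realLog F (Additive.ofMul x))) := rfl

theorem continuous_circleExp : Continuous fun t : ℝ => Additive.toMul (circleExp t) := by
  change Continuous fun t : ℝ => Circle.exp (2 * Real.pi * t)
  fun_prop

theorem continuous_logChar (f) : Continuous (logChar F f) :=
  continuous_circleExp.comp
    ((LinearMap.continuous_of_finiteDimensional (logForm F f)).comp (continuous_realLog F))

theorem logChar_unitsToReal (f) (ε : (𝓞 F)ˣ) :
    Additive.ofMul (logChar F f (unitsToReal F ε)) =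
      circleExp (f (Additive.ofMul (toModTorsion F ε))) := by
  rw [logChar_apply, realLog_unitsToReal, logForm_placeLog]

theorem logChar_maxCompact (f) {x : (RealAlgebra F)ˣ} (hx : x ∈ maxCompact F) :
    logChar F f x = 1 := by
  refine Additive.ofMul.injective ?_
  rw [logChar_apply, (mem_maxCompact_iff F x).1 hx, map_zero, map_zero]
  rfl

theorem mean_zero_mem_normOne {x : (RealAlgebra F)ˣ} {v : InfinitePlace F → ℝ}
    (hx : realLog F (Additive.ofMul x) = v) (hv : ∑ w, v w = 0) : x ∈ normOne F := by
  rw [mem_normOne_iff, hx, hv]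

/-- A continuous character of the norm-one group that is trivial on the maximal compact subgroup
is the exponential of a linear form. -/
theorem exists_linearMap_of_normOne_character (ψ : normOne F →* Circle) (hψ : Continuous ψ)
    (hC : ∀ x : normOne F, (x : (RealAlgebra F)ˣ) ∈ maxCompact F → ψ x = 1) :
    ∃ ℓ : (InfinitePlace F → ℝ) →ₗ[ℝ] ℝ, ℓ 1 = 0 ∧
      ∀ x : normOne F, circleExp (ℓ (realLog F (Additive.ofMul (x : (RealAlgebra F)ˣ)))) =
        Additive.ofMul (ψ x) := by
  obtain ⟨s, hs, hsl⟩ := exists_realExp F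
  -- The projection onto the hyperplane of vectors with sum zero, along (1, …, 1). Exponentials of
  -- such vectors lie in the norm-one group.
  let p : (InfinitePlace F → ℝ) →+ (InfinitePlace F → ℝ) :=
    { toFun := fun v w => v w - (∑ w', v w') / Fintype.card (InfinitePlace F)
      map_zero' := funext fun w => by simp
      map_add' := fun v v' => funext fun w => by
        simp only [Pi.add_apply, Finset.sum_add_distrib, add_div]
        ring }
  have hp : ∀ v w, p v w = v w - (∑ w', v w') / Fintype.card (InfinitePlace F) := fun _ _ => rfl
  have hpc : Continuous p := continuous_pi fun w => by
    simp only [hp]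
    fun_prop
  have hcard : (Fintype.card (InfinitePlace F) : ℝ) ≠ 0 := Nat.cast_ne_zero.2 Fintype.card_ne_zero
  have hp0 : ∀ v, ∑ w, p v w = 0 := fun v => by
    simp only [hp, Finset.sum_sub_distrib, Finset.sum_const, Finset.card_univ, nsmul_eq_mul]
    rw [mul_div_cancel₀ _ hcard, sub_self]
  let e : Multiplicative (InfinitePlace F → ℝ) →* normOne F :=
    (s.comp (AddMonoidHom.toMultiplicative p)).codRestrict (normOne F) fun v =>
      mean_zero_mem_normOne F (hsl _) (hp0 (Multiplicative.toAdd v))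
  have he : Continuous e := Continuous.subtype_mk
    (hs.comp (continuous_ofAdd.comp (hpc.comp continuous_toAdd))) _
  have hel : ∀ v, realLog F (Additive.ofMul (e (Multiplicative.ofAdd v) : (RealAlgebra F)ˣ)) = p v :=
    fun v => hsl _
  obtain ⟨ℓ, hℓ⟩ := exists_linearMap_of_continuous_character
    (AddMonoidHom.toMultiplicativeLeft.symm (ψ.comp e))
    (hψ.comp (he.comp continuous_ofAdd))
  have hℓ' : ∀ v, circleExp (ℓ v) = Additive.ofMul (ψ (e (Multiplicative.ofAdd v))) := hℓ
  -- Two elements with the same logarithms differ by an element of the maximal compact subgroup, on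
  -- which ψ is trivial.
  have hker : ∀ (x : normOne F) v,
      realLog F (Additive.ofMul (x : (RealAlgebra F)ˣ)) = p v →
        circleExp (ℓ v) = Additive.ofMul (ψ x) := fun x v h => by
    rw [hℓ']
    have h1 : ψ (x⁻¹ * e (Multiplicative.ofAdd v)) = 1 := hC _ ((mem_maxCompact_iff F _).2 (by
      refine (map_add (realLog F) (-Additive.ofMul (x : (RealAlgebra F)ˣ)) (Additive.ofMul
        (e (Multiplicative.ofAdd v) : (RealAlgebra F)ˣ))).trans ?_
      rw [map_neg, h, hel, neg_add_cancel]))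
    rw [map_mul, map_inv, inv_mul_eq_one] at h1
    rw [h1]
  -- All multiples of (1, …, 1) project to 0, the logarithm of 1, so exp(2πi t ℓ(1)) = 1 for every
  -- real t.
  refine ⟨ℓ, eq_zero_of_forall_circleExp fun t => ?_, fun x => hker x _ (funext fun w => ?_)⟩
  · rw [← smul_eq_mul, ← map_smul, hker 1 (t • 1), map_one]
    · rfl
    · refine (map_zero (realLog F)).trans (funext fun w => ?_)
      rw [hp]
      simp only [Pi.smul_apply, Pi.one_apply, Pi.zero_apply, smul_eq_mul, mul_one, Finset.sum_const,
        Finset.card_univ, nsmul_eq_mul]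
      rw [mul_div_cancel_left₀ _ hcard, sub_self]
  · rw [hp, (mem_normOne_iff F _).1 x.2, zero_div, sub_zero]

end LogCharacters

/-! ### The Pontryagin dual of the Arakelov class group -/

section ArakelovDual

open NumberField NumberField.Units NumberField.InfinitePlace NumberField.ComplexEmbedding Module
  ComplexConjugate G0

section

variable (F : Type u) [Field F] [NumberField F]

/-- The projection of the oriented Arakelov class group to the Arakelov class group. -/
def toPic0 : OrientedPic F →* Pic0 F := QuotientGroup.mk' (compactImage F)

theorem continuous_toPic0 : Continuous (toPic0 F) := continuous_quotient_mk'

theorem continuous_toPic : Continuous (toPic F) := continuous_quotient_mk'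

theorem toPic0_surjective : Function.Surjective (toPic0 F) := QuotientGroup.mk'_surjective _

theorem continuous_toPic0_iff {T : Type*} [TopologicalSpace T] (f : Pic0 F → T) :
    Continuous f ↔ Continuous (f ∘ toPic0 F) :=
  (isQuotientMap_quot_mk (r := _)).continuous_iff

theorem continuous_normOneToFibre : Continuous (normOneToFibre F) :=
  Continuous.subtype_mk (continuous_const.prodMk continuous_subtype_val) _

theorem toPic0_eq_one_iff (x : OrientedPic F) : toPic0 F x = 1 ↔
    ∃ c : normOne F, (c : (RealAlgebra F)ˣ) ∈ maxCompact F ∧ toPic F (normOneToFibre F c) = x := by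
  refine (QuotientGroup.eq_one_iff x).trans ?_
  constructor
  · rintro ⟨⟨⟨I, y⟩, h⟩, ⟨hI, hy⟩, rfl⟩
    obtain rfl : I = 1 := hI
    exact ⟨⟨y, maxCompact_le_normOne F hy⟩, hy, rfl⟩
  · rintro ⟨c, hc, rfl⟩
    exact ⟨normOneToFibre F c, ⟨rfl, hc⟩, rfl⟩

/-- The map from the norm-one group to the Arakelov class group. -/
def normOneToPic0 : normOne F →* Pic0 F := (toPic0 F).comp ((toPic F).comp (normOneToFibre F))

theorem normOneToPic0_eq_one_of_mem {c : normOne F} (hc : (c : (RealAlgebra F)ˣ) ∈ maxCompact F) :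
    normOneToPic0 F c = 1 :=
  (toPic0_eq_one_iff F _).2 ⟨c, hc, rfl⟩

theorem toPic_normOneToFibre_unitsToReal (ε : (𝓞 F)ˣ) :
    toPic F (normOneToFibre F ⟨unitsToReal F ε, unitsToReal_mem_normOne F ε⟩) = 1 :=
  (toPic_normOneToFibre_eq_one_iff F _).2 ⟨ε, rfl⟩

/-- The projection of the oriented Arakelov class group to the ideal class group. -/
def toCl : OrientedPic F →* Cl F :=
  QuotientGroup.lift (diagonalMap F).range
    ((QuotientGroup.mk' (principalIdeals F)).comp
      ((MonoidHom.fst (IdealGroup F) (RealAlgebra F)ˣ).comp (normFibre F).subtype)) (by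
    rintro _ ⟨a, rfl⟩
    exact (QuotientGroup.eq_one_iff _).2 ⟨a, rfl⟩)

/-- The projection of the Arakelov class group to the ideal class group. -/
def pic0ToCl : Pic0 F →* Cl F :=
  QuotientGroup.lift (compactImage F) (toCl F) (by
    intro x hx
    obtain ⟨c, -, rfl⟩ := (toPic0_eq_one_iff F x).1 ((QuotientGroup.eq_one_iff x).2 hx)
    exact map_one (QuotientGroup.mk' (principalIdeals F)))

theorem pic0ToCl_surjective : Function.Surjective (pic0ToCl F) := by
  intro c
  obtain ⟨I, rfl⟩ := QuotientGroup.mk'_surjective (principalIdeals F) c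
  obtain ⟨s, -, hs⟩ := exists_realExp F
  let w₀ := Classical.arbitrary (InfinitePlace F)
  classical
  -- Any ideal can be completed to an element of the fibre product: put its whole norm at one
  -- Archimedean place.
  let y := s (Multiplicative.ofAdd (Pi.single w₀ (Real.log (idealNorm F I))))
  have hpos : 0 < idealNorm F I := by
    refine lt_of_le_of_ne ?_ fun h => ?_
    · exact Rat.cast_nonneg.2 (FractionalIdeal.absNorm_nonneg _)
    · have h1 := map_mul (idealNorm F) I I⁻¹
      rw [mul_inv_cancel, map_one, ← h, zero_mul] at h1
      exact one_ne_zero h1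
  have hpos' : 0 < realNorm F y := by
    rw [realNorm_eq_prod]
    exact Finset.prod_pos fun φ _ => norm_pos_iff.2 (extendEmbedding_units_ne_zero F φ y)
  have hy : idealNorm F I = realNorm F y := by
    refine Real.log_injOn_pos hpos hpos' ?_
    rw [← sum_realLog, hs, Finset.sum_pi_single']
    simp
  exact ⟨toPic0 F (toPic F ⟨(I, y), hy⟩), rfl⟩

/-- If the ideal component is generated by α, dividing by the principal element of α leaves ideal
component 1 and an element of norm ±1. -/
theorem exists_normOne_of_pic0ToCl_eq_one {x : Pic0 F} (hx : pic0ToCl F x = 1) :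
    ∃ y, normOneToPic0 F y = x := by
  obtain ⟨x, rfl⟩ := toPic0_surjective F x
  obtain ⟨⟨⟨I, y⟩, h⟩, rfl⟩ := toPic_surjective F x
  obtain ⟨a, rfl⟩ := (QuotientGroup.eq_one_iff (N := principalIdeals F) I).1 hx
  have h1 : realNorm F ((Units.map (toRealAlgebra F : F →* RealAlgebra F) a)⁻¹ * y) = 1 := by
    have h2 := (norm_principal F a).symm.trans h
    have h3 := map_mul (realNorm F) (Units.map (toRealAlgebra F : F →* RealAlgebra F) a)⁻¹
      (Units.map (toRealAlgebra F : F →* RealAlgebra F) a)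
    rw [inv_mul_cancel, map_one] at h3
    rw [map_mul, h3, h2]
    rfl
  refine ⟨⟨_, h1⟩, congrArg (toPic0 F) ?_⟩
  change toPic F _ = toPic F _
  rw [← inv_mul_eq_one, ← map_inv, ← map_mul, toPic_eq_one_iff]
  refine ⟨a, Subtype.ext (Prod.ext ?_ ?_)⟩
  · change _ = (1 : IdealGroup F)⁻¹ * _
    rw [inv_one, one_mul]
    rfl
  · change _ = ((Units.map (toRealAlgebra F : F →* RealAlgebra F) a)⁻¹ * y)⁻¹ * y
    rw [mul_inv_rev, inv_inv, mul_comm y⁻¹, inv_mul_cancel_right]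
    rfl

theorem pic0ToCl_normOneToPic0 (x : normOne F) : pic0ToCl F (normOneToPic0 F x) = 1 :=
  map_one (QuotientGroup.mk' (principalIdeals F))

/-- Restriction of characters of the Arakelov class group to the norm-one group. -/
def restrictNormOne : Additive (PontryaginDual (Pic0 F)) →+ Additive (normOne F →* Circle) where
  toFun χ := Additive.ofMul
    ((show Pic0 F →ₜ* Circle from Additive.toMul χ).toMonoidHom.comp (normOneToPic0 F))
  map_zero' := rfl
  map_add' _ _ := rfl

/-- The map to the class group factors through the discrete group of ideals, so all characters of
the class group inflate to continuous ones. -/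
theorem continuous_comp_pic0ToCl {T : Type*} [TopologicalSpace T] (f : Cl F → T) :
    Continuous (f ∘ pic0ToCl F) := by
  rw [continuous_toPic0_iff]
  refine (continuous_toPic_iff F _).2 ?_
  exact (continuous_of_discreteTopology (f := fun I : IdealGroup F =>
    f (QuotientGroup.mk' (principalIdeals F) I))).comp (continuous_fst.comp continuous_subtype_val)

/-- Inflation of characters of the class group to the Arakelov class group. -/
def inflateCl : Additive (Cl F →* Circle) →+ Additive (PontryaginDual (Pic0 F)) where
  toFun η := Additive.ofMul (show PontryaginDual (Pic0 F) from
    (⟨(Additive.toMul η).comp (pic0ToCl F), continuous_comp_pic0ToCl F _⟩ : Pic0 F →ₜ* Circle))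
  map_zero' := rfl
  map_add' _ _ := rfl

theorem inflateCl_injective : Function.Injective (inflateCl F) := fun η η' h =>
  Additive.toMul.injective (MonoidHom.ext fun c => by
    obtain ⟨x, rfl⟩ := pic0ToCl_surjective F c
    exact DFunLike.congr_fun (show (show Pic0 F →ₜ* Circle from Additive.toMul (inflateCl F η)) =
      (show Pic0 F →ₜ* Circle from Additive.toMul (inflateCl F η')) from h) x)

theorem restrictNormOne_eq_zero_iff (χ) :
    restrictNormOne F χ = 0 ↔ ∃ η, inflateCl F η = χ := by
  constructor
  · intro h
    obtain ⟨η, hη⟩ := exists_character_extension (pic0ToCl F)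
      (show Pic0 F →ₜ* Circle from Additive.toMul χ).toMonoidHom (fun x hx => by
        obtain ⟨y, rfl⟩ := exists_normOne_of_pic0ToCl_eq_one F hx
        exact DFunLike.congr_fun (congrArg Additive.toMul h) y)
    exact ⟨Additive.ofMul η, PontryaginDual.ext (A := Pic0 F) hη⟩
  · rintro ⟨η, rfl⟩
    refine MonoidHom.ext fun y => ?_
    change Additive.toMul η (pic0ToCl F (normOneToPic0 F y)) = 1
    rw [pic0ToCl_normOneToPic0, map_one]

/-- An integral linear form, seen as a real-valued homomorphism. -/
def realForm : Module.Dual ℤ (Additive (ModTorsion F)) →+ (Additive (ModTorsion F) →+ ℝ) where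
  toFun f := (Int.castAddHom ℝ).comp f.toAddMonoidHom
  map_zero' := AddMonoidHom.ext fun _ => Int.cast_zero
  map_add' f f' := AddMonoidHom.ext fun x => Int.cast_add (f x) (f' x)

/-- The characters of the norm-one group defined by integral linear forms on the units. -/
def dualChar : Module.Dual ℤ (Additive (ModTorsion F)) →+ Additive (normOne F →* Circle) where
  toFun f := Additive.ofMul ((logChar F (realForm F f)).comp (normOne F).subtype)
  map_zero' := MonoidHom.ext fun x => by
    refine Additive.ofMul.injective ?_
    refine (logChar_apply F _ _).trans ?_
    rw [map_zero, logForm_zero]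
    exact map_zero circleExp
  map_add' f f' := MonoidHom.ext fun x => by
    refine Additive.ofMul.injective ?_
    refine (logChar_apply F _ _).trans ?_
    rw [map_add, logForm_add]
    exact map_add circleExp _ _

/-- The norm-one group contains elements whose logarithms are all real multiples t of that of a unit
y. Triviality of exp(2πi t f(y)) for every t forces f(y) = 0. -/
theorem dualChar_injective : Function.Injective (dualChar F) := by
  refine (injective_iff_map_eq_zero _).2 fun f hf => LinearMap.ext fun y => ?_
  obtain ⟨s, -, hs⟩ := exists_realExp F
  have : (f y : ℝ) = 0 := eq_zero_of_forall_circleExp fun t => by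
    have hv : ∑ w, (t • placeLog F y) w = 0 := by
      obtain ⟨ε, hε⟩ := toModTorsion_surjective F (Additive.toMul y)
      obtain rfl : Additive.ofMul (toModTorsion F ε) = y := hε
      simp only [Pi.smul_apply, ← Finset.smul_sum]
      rw [← realLog_unitsToReal, (mem_normOne_iff F _).1 (unitsToReal_mem_normOne F ε), smul_zero]
    have h1 : logChar F (realForm F f) (s (Multiplicative.ofAdd (t • placeLog F y))) = 1 :=
      DFunLike.congr_fun (congrArg Additive.toMul hf)
        (⟨_, mean_zero_mem_normOne F (hs _) hv⟩ : normOne F)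
    have h2 := logChar_apply F (realForm F f) (s (Multiplicative.ofAdd (t • placeLog F y)))
    rw [hs, h1, map_smul, logForm_placeLog] at h2
    exact h2.symm
  exact Int.cast_eq_zero.1 this

theorem logChar_realForm_unitsToReal (f) (ε : (𝓞 F)ˣ) :
    logChar F (realForm F f) (unitsToReal F ε) = 1 := by
  refine Additive.ofMul.injective ?_
  rw [logChar_unitsToReal]
  exact (circleExp_eq_zero_iff _).2 ⟨_, rfl⟩

/-- The characters of the norm-one group that come from the Arakelov class group are those defined
by integral linear forms on the units. -/
theorem range_restrictNormOne_eq (ψ : Additive (normOne F →* Circle)) :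
    (∃ χ, restrictNormOne F χ = ψ) ↔ ∃ f, dualChar F f = ψ := by
  constructor
  · rintro ⟨χ, rfl⟩
    have hc : Continuous (Additive.toMul (restrictNormOne F χ) : normOne F →* Circle) :=
      (show Pic0 F →ₜ* Circle from Additive.toMul χ).continuous_toFun.comp
        ((continuous_toPic0 F).comp ((continuous_toPic F).comp (continuous_normOneToFibre F)))
    obtain ⟨ℓ, hℓ1, hℓ⟩ := exists_linearMap_of_normOne_character F _ hc (fun x hx => by
      change (show Pic0 F →ₜ* Circle from Additive.toMul χ) (normOneToPic0 F x) = 1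
      rw [normOneToPic0_eq_one_of_mem F hx]
      exact map_one (show Pic0 F →ₜ* Circle from Additive.toMul χ))
    -- Units become trivial in the Arakelov class group, so ℓ takes integral values on their
    -- logarithms.
    obtain ⟨f, hf⟩ := exists_int_hom (ℓ.toAddMonoidHom.comp (placeLog F)) (fun y => by
      refine (circleExp_eq_zero_iff _).1 ?_
      obtain ⟨ε, hε⟩ := toModTorsion_surjective F (Additive.toMul y)
      obtain rfl : Additive.ofMul (toModTorsion F ε) = y := hε
      change circleExp (ℓ (placeLog F _)) = 0
      rw [← realLog_unitsToReal]
      refine (hℓ ⟨_, unitsToReal_mem_normOne F ε⟩).trans ?_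
      change Additive.ofMul ((show Pic0 F →ₜ* Circle from Additive.toMul χ)
        (toPic0 F (toPic F (normOneToFibre F _)))) = 0
      rw [toPic_normOneToFibre_unitsToReal, map_one]
      exact congrArg Additive.ofMul (map_one (show Pic0 F →ₜ* Circle from Additive.toMul χ)))
    refine ⟨f.toIntLinearMap, MonoidHom.ext fun x => ?_⟩
    refine Additive.ofMul.injective ((hℓ x).symm.trans ?_).symm
    rw [eq_logForm F (f := realForm F f.toIntLinearMap) hℓ1 fun y => (hf y).symm]
    rfl
  · rintro ⟨f, rfl⟩
    -- Integrality of f makes the character trivial on units, so it extends to the oriented class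
    -- group. Being defined through logarithms, it kills the maximal compact subgroup and descends.
    obtain ⟨χ, hχ⟩ := exists_pic_character F (logChar F (realForm F f)) (continuous_logChar F _)
      (logChar_realForm_unitsToReal F f)
    let χ₀ : OrientedPic F →ₜ* Circle := χ
    let η : Pic0 F →* Circle := QuotientGroup.lift (compactImage F) χ₀.toMonoidHom (by
      intro x hx
      obtain ⟨c, hc, rfl⟩ := (toPic0_eq_one_iff F x).1 ((QuotientGroup.eq_one_iff x).2 hx)
      exact (hχ c).trans (logChar_maxCompact F _ hc))
    have hη : Continuous η := (continuous_toPic0_iff F η).2 χ₀.continuous_toFun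
    exact ⟨Additive.ofMul (show PontryaginDual (Pic0 F) from (⟨η, hη⟩ : Pic0 F →ₜ* Circle)),
      MonoidHom.ext hχ⟩

end

variable (K : Type v) (F : Type u) [Field K] [Field F] [NumberField F] [Algebra K F]

theorem normOneToPic0_smul (g : Gal(F/K)) (x : normOne F) :
    normOneToPic0 F (g • x) = g • normOneToPic0 F x :=
  congrArg (fun y => toPic0 F (toPic F y)) (normOneToFibre_smul g x)

theorem pic0ToCl_smul (g : Gal(F/K)) (x : Pic0 F) : pic0ToCl F (g • x) = g • pic0ToCl F x := by
  obtain ⟨x, rfl⟩ := toPic0_surjective F x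
  obtain ⟨x, rfl⟩ := toPic_surjective F x
  rfl

/-- Follows from uniqueness of the linear form extending a given homomorphism on the units, since
Log is equivariant. -/
theorem logChar_realForm_smul (g : Gal(F/K)) (f : Module.Dual ℤ (Additive (ModTorsion F)))
    (x : (RealAlgebra F)ˣ) :
    logChar F (realForm F ((unitsModTorsionRep K F).dual g f)) x =
      logChar F (realForm F f) (g⁻¹ • x) := by
  refine Additive.ofMul.injective ?_
  rw [logChar_apply, logChar_apply]
  have h : ∀ v, logForm F (realForm F ((unitsModTorsionRep K F).dual g f)) v =
      logForm F (realForm F f) (LinearMap.funLeft ℝ ℝ (g • · : InfinitePlace F → InfinitePlace F) v) := by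
    refine DFunLike.congr_fun (eq_logForm F (ℓ := logForm F (realForm F f) ∘ₗ
      LinearMap.funLeft ℝ ℝ (g • · : InfinitePlace F → InfinitePlace F))
      (logForm_one F (realForm F f)) fun y => ?_).symm
    have h1 : LinearMap.funLeft ℝ ℝ (g • · : InfinitePlace F → InfinitePlace F) (placeLog F y) =
        placeLog F (unitsModTorsionRep K F g⁻¹ y) := funext fun w => by
      rw [placeLog_smul, inv_inv]
      rfl
    rw [LinearMap.comp_apply, h1, logForm_placeLog]
    rfl
  rw [h]
  congr 2
  refine funext fun w => ?_
  rw [realLog_smul, inv_inv]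
  rfl

/-- The class of the Pontryagin dual of the Arakelov class group. -/
theorem exists_clsRep_arRep [Finite Gal(F/K)]
    [Module.Finite (MonoidAlgebra ℤ Gal(F/K)) (charRep Gal(F/K) (Cl F)).asModule] :
    ∃ _ : Module.Finite (MonoidAlgebra ℤ Gal(F/K)) (arRep K F).asModule,
      clsRep (arRep K F) =
        clsRep (unitsModTorsionRep K F).dual + clsRep (charRep Gal(F/K) (Cl F)) := by
  -- Integral linear forms inject into the characters of the norm-one group, so the second kernel in
  -- `clsRep_of_range_eq` is the zero module.
  let L : Representation ℤ Gal(F/K) PUnit.{u + 1} :=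
    Representation.trivial ℤ Gal(F/K) PUnit.{u + 1}
  have : Subsingleton L.asModule := inferInstanceAs (Subsingleton PUnit.{u + 1})
  obtain ⟨h1, h2⟩ := clsRep_of_range_eq (ρA := arRep K F) (ρB := (unitsModTorsionRep K F).dual)
    (ρK := charRep Gal(F/K) (Cl F)) (ρL := L) (ρE := charRep Gal(F/K) (normOne F))
    (inflateCl F) (restrictNormOne F) 0 (dualChar F)
    (fun g η => PontryaginDual.ext (A := Pic0 F) fun x => by
      change Additive.toMul η (g⁻¹ • pic0ToCl F x) = Additive.toMul η (pic0ToCl F (g⁻¹ • x))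
      rw [pic0ToCl_smul])
    (fun g χ => MonoidHom.ext fun x => by
      change (show Pic0 F →ₜ* Circle from Additive.toMul χ) (g⁻¹ • normOneToPic0 F x) =
        (show Pic0 F →ₜ* Circle from Additive.toMul χ) (normOneToPic0 F (g⁻¹ • x))
      rw [normOneToPic0_smul])
    (fun g _ => (map_zero _).symm)
    (fun g f => MonoidHom.ext fun x => logChar_realForm_smul K F g f x)
    (inflateCl_injective F) (restrictNormOne_eq_zero_iff F)
    (fun _ _ _ => rfl)
    (fun f => ⟨fun h => ⟨0, (dualChar_injective F (h.trans (map_zero _).symm)).symm⟩,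
      by rintro ⟨_, rfl⟩; exact map_zero _⟩)
    (range_restrictNormOne_eq F)
  refine ⟨h1, ?_⟩
  rw [← h2, left_eq_add]
  exact cls_of_subsingleton _

end ArakelovDual

/-! ### Characters of the maximal compact subgroup -/

section CompactCharacters

open NumberField NumberField.Units NumberField.InfinitePlace NumberField.ComplexEmbedding
  ComplexConjugate

variable (F : Type u) [Field F]

open Classical in
/-- The exponents of the trivial characters: multiples of `φ + φ̄` for each Archimedean place. -/
def placeExponent : MonoidAlgebra ℤ (InfinitePlace F) →+ ((F →+* ℂ) → ℤ) where
  -- At a real embedding φ̄ = φ, so the sum φ + φ̄ counts φ twice.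
  toFun m φ := (if IsReal φ then 2 else 1) * m.coeff (InfinitePlace.mk φ)
  map_zero' := funext fun _ => mul_zero _
  map_add' _ _ := funext fun _ => mul_add _ _ _

open Classical in
theorem placeExponent_apply (m) (φ : F →+* ℂ) : placeExponent F m φ =
    (if IsReal φ then 2 else 1) * m.coeff (InfinitePlace.mk φ) := rfl

theorem placeExponent_injective : Function.Injective (placeExponent F) := by
  intro m m' h
  refine MonoidAlgebra.ext (Finsupp.ext fun w => ?_)
  have := congrFun h w.embedding
  rw [placeExponent_apply, placeExponent_apply, mk_embedding] at this
  exact mul_left_cancel₀ (by split_ifs <;> norm_num) this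

variable [NumberField F]

variable {F} in
/-- The coordinate of an element of the maximal compact subgroup at an embedding. -/
def circleCoord (φ : F →+* ℂ) : maxCompact F →* Circle where
  toFun c := ⟨extendEmbedding φ ((c : (RealAlgebra F)ˣ) : RealAlgebra F),
    mem_sphere_zero_iff_norm.2 (c.2 φ)⟩
  map_one' := Circle.ext (map_one (extendEmbedding φ))
  map_mul' _ _ := Circle.ext (map_mul (extendEmbedding φ) _ _)

variable {F} in
theorem coe_circleCoord (φ : F →+* ℂ) (c : maxCompact F) :
    (circleCoord φ c : ℂ) = extendEmbedding φ ((c : (RealAlgebra F)ˣ) : RealAlgebra F) := rfl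

variable {F} in
theorem continuous_circleCoord (φ : F →+* ℂ) : Continuous (circleCoord φ) :=
  Continuous.subtype_mk ((continuous_extendEmbedding F φ).comp
    (Units.continuous_val.comp continuous_subtype_val)) _

variable {F} in
theorem circleCoord_conjugate (φ : F →+* ℂ) (c : maxCompact F) :
    circleCoord (conjugate φ) c = (circleCoord φ c)⁻¹ := by
  refine Circle.ext ?_
  rw [Circle.coe_inv_eq_conj, coe_circleCoord, coe_circleCoord, extendEmbedding_conjugate]

variable {F} in
theorem maxCompact_ext {c c' : maxCompact F} (h : ∀ φ, circleCoord φ c = circleCoord φ c') :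
    c = c' :=
  Subtype.ext (realUnits_ext fun φ => congrArg Subtype.val (h φ))

/-- The tuples in `∏_φ S¹` that are compatible with complex conjugation. -/
def conjTuples : Subgroup ((F →+* ℂ) → Circle) where
  carrier := {z | ∀ φ, z (conjugate φ) = (z φ)⁻¹}
  one_mem' _ := inv_one.symm
  mul_mem' hx hy φ := by
    rw [Pi.mul_apply, Pi.mul_apply, hx φ, hy φ, mul_inv]
  inv_mem' hx φ := by
    rw [Pi.inv_apply, Pi.inv_apply, hx φ]

theorem exists_continuous_compactHom : ∃ s : conjTuples F →* maxCompact F, Continuous s ∧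
    ∀ φ t, circleCoord φ (s t) = (t : (F →+* ℂ) → Circle) φ := by
  obtain ⟨s, hs, hsγ⟩ := exists_continuous_unitHom F
    (fun φ => Circle.coeHom.comp ((Pi.evalMonoidHom (fun _ : F →+* ℂ => Circle) φ).comp
      (conjTuples F).subtype))
    (fun φ => continuous_subtype_val.comp ((continuous_apply φ).comp continuous_subtype_val))
    (fun φ t => by
      change (t.1 (conjugate φ) : ℂ) = conj (t.1 φ : ℂ)
      rw [← Circle.coe_inv_eq_conj, t.2 φ])
  refine ⟨s.codRestrict (maxCompact F) fun t φ => ?_, Continuous.subtype_mk hs _, fun φ t => ?_⟩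
  · rw [hsγ]
    exact Circle.norm_coe _
  · exact Circle.ext (hsγ φ t)

/-- The character `c ↦ ∏_φ φ(c)^{n_φ}` of the maximal compact subgroup. -/
def compactChar : ((F →+* ℂ) → ℤ) →+ Additive (maxCompact F →* Circle) where
  toFun n := Additive.ofMul (∏ φ, (zpowGroupHom (n φ)).comp (circleCoord φ))
  map_zero' := by
    refine congrArg Additive.ofMul (Finset.prod_eq_one fun φ _ => MonoidHom.ext fun c => ?_)
    exact zpow_zero _
  map_add' n n' := by
    refine congrArg Additive.ofMul (Eq.trans ?_ Finset.prod_mul_distrib)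
    refine Finset.prod_congr rfl fun φ _ => MonoidHom.ext fun c => ?_
    exact zpow_add _ _ _

theorem compactChar_apply (n : (F →+* ℂ) → ℤ) (c : maxCompact F) :
    Additive.toMul (compactChar F n) c = ∏ φ, circleCoord φ c ^ n φ :=
  MonoidHom.finsetProd_apply _ _ _

theorem continuous_compactChar (n : (F →+* ℂ) → ℤ) :
    Continuous (Additive.toMul (compactChar F n) : maxCompact F →* Circle) := by
  have : ((Additive.toMul (compactChar F n) : maxCompact F →* Circle) : maxCompact F → Circle) =
      fun c => ∏ φ, circleCoord φ c ^ n φ := funext (compactChar_apply F n)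
  rw [this]
  exact continuous_finsetProd _ fun φ _ => (continuous_circleCoord φ).zpow (n φ)

theorem circleCoord_sq_eq_one {φ : F →+* ℂ} (h : IsReal φ) (c : maxCompact F) :
    circleCoord φ c ^ 2 = 1 := by
  have := circleCoord_conjugate φ c
  rw [ComplexEmbedding.isReal_iff.1 h, eq_inv_iff_mul_eq_one] at this
  rw [sq, this]

/-- The element of the maximal compact subgroup with coordinates `z` at `φ`, `z⁻¹` at `φ̄` and `1`
elsewhere. -/
theorem exists_single_compact (φ₀ : F →+* ℂ) (h : ¬ IsReal φ₀) :
    ∃ s : Circle →* maxCompact F, Continuous s ∧ (∀ z, circleCoord φ₀ (s z) = z) ∧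
      ∀ φ, mk φ ≠ mk φ₀ → ∀ z, circleCoord φ (s z) = 1 := by
  classical
  obtain ⟨s, hs, hsφ⟩ := exists_continuous_compactHom F
  have hne : conjugate φ₀ ≠ φ₀ := fun h' => h (ComplexEmbedding.isReal_iff.2 h')
  have hcc : ∀ φ : F →+* ℂ, conjugate (conjugate φ) = φ := fun φ => star_star φ
  let δ : Circle →* ((F →+* ℂ) → Circle) := MonoidHom.pi fun φ =>
    if φ = φ₀ then MonoidHom.id Circle else if φ = conjugate φ₀ then invMonoidHom else 1
  have hδ : ∀ z φ, δ z φ = if φ = φ₀ then z else if φ = conjugate φ₀ then z⁻¹ else 1 := by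
    intro z φ
    change (if φ = φ₀ then MonoidHom.id Circle else if φ = conjugate φ₀ then invMonoidHom else 1 :
      Circle →* Circle) z = _
    split_ifs <;> rfl
  have hmem : ∀ z, δ z ∈ conjTuples F := fun z φ => by
    rw [hδ, hδ]
    by_cases h1 : φ = φ₀
    · subst h1
      rw [if_neg hne, if_pos rfl, if_pos rfl]
    · rw [if_neg h1]
      by_cases h2 : φ = conjugate φ₀
      · subst h2
        rw [hcc, if_pos rfl, if_pos rfl, inv_inv]
      · rw [if_neg h2, if_neg (fun h3 => h2 (by rw [← h3, hcc])),
          if_neg (fun h3 => h1 (by rw [← hcc φ, h3, hcc])), inv_one]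
  have hδc : Continuous δ := continuous_pi fun φ => by
    simp only [hδ]
    split_ifs
    · exact continuous_id
    · exact continuous_inv
    · exact continuous_const
  refine ⟨s.comp (δ.codRestrict (conjTuples F) hmem), hs.comp (Continuous.subtype_mk hδc _),
    fun z => ?_, fun φ hφ z => ?_⟩
  · refine (hsφ φ₀ _).trans ((hδ z φ₀).trans (if_pos rfl))
  · refine (hsφ φ _).trans ((hδ z φ).trans ?_)
    rw [if_neg fun h1 => hφ (by rw [h1]), if_neg fun h1 => hφ (by rw [h1, mk_conjugate_eq])]

/-- The element of the maximal compact subgroup with coordinate `-1` at a real embedding and `1`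
elsewhere. -/
theorem exists_sign_compact (φ₀ : F →+* ℂ) (h : IsReal φ₀) :
    ∃ c : maxCompact F, circleCoord φ₀ c = Circle.exp Real.pi ∧
      ∀ φ, φ ≠ φ₀ → circleCoord φ c = 1 := by
  classical
  obtain ⟨s, hs, hsφ⟩ := exists_continuous_compactHom F
  have hcc : ∀ φ : F →+* ℂ, conjugate (conjugate φ) = φ := fun φ => star_star φ
  have hinv : (Circle.exp Real.pi)⁻¹ = Circle.exp Real.pi := by
    rw [inv_eq_iff_mul_eq_one, ← Circle.exp_add, ← two_mul, Circle.exp_two_pi]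
  have h' := ComplexEmbedding.isReal_iff.1 h
  refine ⟨s ⟨Pi.mulSingle φ₀ (Circle.exp Real.pi), fun φ => ?_⟩, ?_, fun φ hφ => ?_⟩
  · by_cases h1 : φ = φ₀
    · subst h1
      rw [h', Pi.mulSingle_eq_same, hinv]
    · rw [Pi.mulSingle_eq_of_ne h1, Pi.mulSingle_eq_of_ne, inv_one]
      intro h2
      rw [← h', ← h2, hcc] at h1
      exact h1 rfl
  · rw [hsφ]
    exact Pi.mulSingle_eq_same (M := fun _ : F →+* ℂ => Circle) φ₀ _
  · rw [hsφ]
    exact Pi.mulSingle_eq_of_ne (M := fun _ : F →+* ℂ => Circle) hφ _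

theorem exp_pi_zpow_eq_one_iff (n : ℤ) : Circle.exp Real.pi ^ n = 1 ↔ Even n := by
  rw [← Circle.exp_zsmul, Circle.exp_eq_one, zsmul_eq_mul, even_iff_exists_two_mul]
  refine exists_congr fun m => ?_
  rw [← mul_assoc, mul_left_inj' Real.pi_ne_zero, mul_comm 2 m]
  exact_mod_cast Iff.rfl

theorem circle_eq_one_of_forall_zpow {n : ℤ} (h : ∀ z : Circle, z ^ n = 1) : n = 0 := by
  have : (n : ℝ) = 0 := eq_zero_of_forall_circleExp fun t => by
    rw [mul_comm, ← zsmul_eq_mul, map_zsmul]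
    exact h _
  exact_mod_cast this

/-- The factors of C can be tested separately: a sign at a real place forces an even exponent, and a
circle at a complex place forces n_φ = n_φ̄. Conversely the relations φ · φ̄ = 1 on C kill these
exponents. -/
theorem compactChar_eq_zero_iff (n : (F →+* ℂ) → ℤ) :
    compactChar F n = 0 ↔ ∃ m, placeExponent F m = n := by
  classical
  constructor
  · intro h
    have h1 : ∀ c : maxCompact F, ∏ φ, circleCoord φ c ^ n φ = 1 := fun c => by
      rw [← compactChar_apply, h]
      rfl
    have hreal : ∀ φ₀ : F →+* ℂ, IsReal φ₀ → Even (n φ₀) := fun φ₀ h₀ => by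
      obtain ⟨c, hc, hc'⟩ := exists_sign_compact F φ₀ h₀
      have h2 := h1 c
      rw [Finset.prod_eq_single φ₀ (fun φ _ hφ => by rw [hc' φ hφ, one_zpow])
        (fun h3 => absurd (Finset.mem_univ _) h3), hc] at h2
      exact (exp_pi_zpow_eq_one_iff _).1 h2
    have hcomplex : ∀ φ₀ : F →+* ℂ, ¬ IsReal φ₀ → n (conjugate φ₀) = n φ₀ := fun φ₀ h₀ => by
      obtain ⟨s, -, hs, hs'⟩ := exists_single_compact F φ₀ h₀
      have hne : φ₀ ≠ conjugate φ₀ := fun h' => h₀ (ComplexEmbedding.isReal_iff.2 h'.symm)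
      refine (sub_eq_zero.1 (circle_eq_one_of_forall_zpow fun z => ?_)).symm
      have h2 := h1 (s z)
      rw [Finset.prod_eq_mul φ₀ (conjugate φ₀) hne (fun φ _ hφ => by
        rw [hs' φ _ z, one_zpow]
        intro h3
        rcases mk_eq_iff.1 h3 with h4 | h4
        · exact hφ.1 h4
        · exact hφ.2 (by rw [← h4]; exact (star_star φ).symm))
        (fun h3 => absurd (Finset.mem_univ _) h3) (fun h3 => absurd (Finset.mem_univ _) h3),
        circleCoord_conjugate, hs, inv_zpow, ← zpow_neg, ← zpow_add, ← sub_eq_add_neg] at h2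
      exact h2
    let m : InfinitePlace F → ℤ := fun w =>
      if IsReal w.embedding then n w.embedding / 2 else n w.embedding
    refine ⟨MonoidAlgebra.ofCoeff (Finsupp.equivFunOnFinite.symm m), funext fun φ => ?_⟩
    rw [placeExponent_apply]
    change (if IsReal φ then 2 else 1) * m (mk φ) = n φ
    by_cases hφ : IsReal φ
    · simp only [m]
      rw [embedding_mk_eq_of_isReal hφ, if_pos hφ, if_pos hφ]
      exact Int.mul_ediv_cancel' (hreal φ hφ).two_dvd
    · have hφ' : ¬ IsReal (mk φ).embedding := fun h2 => hφ (isReal_mk_iff.1 (by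
        rw [← mk_embedding (mk φ)]
        exact isReal_mk_iff.2 h2))
      simp only [m]
      rw [if_neg hφ, if_neg hφ', one_mul]
      rcases embedding_mk_eq φ with h2 | h2
      · rw [h2]
      · rw [h2, hcomplex φ hφ]
  · rintro ⟨m, rfl⟩
    refine MonoidHom.ext fun c => ?_
    refine (compactChar_apply F _ c).trans ?_
    -- Pair φ with φ̄; their factors are inverse to each other. The fixed points are the real
    -- embeddings, where the factor is an even power of a sign.
    refine Finset.prod_involution (fun φ _ => conjugate φ) (fun φ _ => ?_) (fun φ _ hφ h => hφ ?_)
      (fun _ _ => Finset.mem_univ _) (fun φ _ => star_star φ)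
    · rw [circleCoord_conjugate, placeExponent_apply, placeExponent_apply, mk_conjugate_eq,
        inv_zpow]
      simp only [ComplexEmbedding.isReal_conjugate_iff]
      exact mul_inv_cancel _
    · have hr := ComplexEmbedding.isReal_iff.2 h
      rw [placeExponent_apply, if_pos hr, zpow_mul]
      have := circleCoord_sq_eq_one F hr c
      rw [show circleCoord φ c ^ (2 : ℤ) = circleCoord φ c ^ 2 from zpow_natCast _ 2, this, one_zpow]

/-- Every continuous character of the maximal compact subgroup is of the form
`c ↦ ∏_φ φ(c)^{n_φ}`. -/
theorem exists_compactChar_eq (ψ : maxCompact F →* Circle) (hψ : Continuous ψ) :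
    ∃ n, Additive.toMul (compactChar F n) = ψ := by
  classical
  obtain ⟨s, hs, hsφ⟩ := exists_continuous_compactHom F
  -- The component of c in the factor C_w, with all other components 1. It reduces the claim to
  -- characters of {±1} and of the circle.
  let pr : InfinitePlace F → maxCompact F → maxCompact F := fun w c =>
    s ⟨fun φ => if mk φ = w then circleCoord φ c else 1, fun φ => by
      change (if mk (conjugate φ) = w then circleCoord (conjugate φ) c else 1) =
        (if mk φ = w then circleCoord φ c else 1)⁻¹
      rw [mk_conjugate_eq]
      split_ifs
      · exact circleCoord_conjugate φ c
      · exact inv_one.symm⟩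
  have hpr : ∀ w c φ, circleCoord φ (pr w c) = if mk φ = w then circleCoord φ c else 1 :=
    fun w c φ => hsφ φ _
  have hprod : ∀ c, c = ∏ w, pr w c := fun c => maxCompact_ext fun φ => by
    rw [map_prod]
    simp only [hpr]
    rw [Finset.prod_ite_eq, if_pos (Finset.mem_univ _)]
  have hw : ∀ w : InfinitePlace F, ∃ n : ℤ, ∀ c, ψ (pr w c) = circleCoord w.embedding c ^ n := by
    intro w
    by_cases hr : IsReal w.embedding
    · obtain ⟨e, he, he'⟩ := exists_sign_compact F w.embedding hr
      have hmk : ∀ φ : F →+* ℂ, mk φ = w ↔ φ = w.embedding := fun φ => by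
        constructor
        · rintro rfl
          rw [embedding_mk_eq_of_isReal]
          refine isReal_mk_iff.1 ?_
          rw [← mk_embedding (mk φ)]
          exact isReal_mk_iff.2 hr
        · rintro rfl
          exact mk_embedding w
      have he2 : e ^ 2 = 1 := maxCompact_ext fun φ => by
        rw [map_pow, map_one]
        by_cases h1 : φ = w.embedding
        · rw [h1, circleCoord_sq_eq_one F hr]
        · rw [he' φ h1, one_pow]
      have hsq : ∀ z : Circle, z ^ 2 = 1 → z = 1 ∨ z = Circle.exp Real.pi := fun z hz => by
        have h1 : (z : ℂ) ^ 2 = 1 := congrArg Subtype.val hz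
        rcases eq_or_eq_neg_of_sq_eq_sq (z : ℂ) 1 (by rw [h1, one_pow]) with h2 | h2
        · exact Or.inl (Circle.ext h2)
        · refine Or.inr (Circle.ext (h2.trans ?_))
          rw [Circle.coe_exp, Complex.exp_pi_mul_I]
      have hψe : ∃ n : ℤ, ψ e = Circle.exp Real.pi ^ n := by
        rcases hsq (ψ e) (by rw [← map_pow, he2, map_one]) with h1 | h1
        · exact ⟨0, by rw [h1, zpow_zero]⟩
        · exact ⟨1, by rw [h1, zpow_one]⟩
      obtain ⟨n, hn⟩ := hψe
      refine ⟨n, fun c => ?_⟩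
      rcases hsq _ (circleCoord_sq_eq_one F hr c) with h1 | h1
      · rw [h1, one_zpow, ← map_one ψ]
        refine congrArg ψ (maxCompact_ext fun φ => ?_)
        rw [hpr, map_one]
        split_ifs with h2
        · rw [(hmk φ).1 h2, h1]
        · rfl
      · rw [h1, ← hn]
        refine congrArg ψ (maxCompact_ext fun φ => ?_)
        rw [hpr]
        split_ifs with h2
        · rw [(hmk φ).1 h2, h1, he]
        · rw [he' φ fun h3 => h2 ((hmk φ).2 h3)]
    · obtain ⟨δ, hδ, hδ1, hδ2⟩ := exists_single_compact F w.embedding hr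
      obtain ⟨n, hn⟩ := exists_zpow_of_continuous_character (ψ.comp δ) (hψ.comp hδ)
      refine ⟨n, fun c => ?_⟩
      rw [← hn]
      refine congrArg ψ (maxCompact_ext fun φ => ?_)
      rw [hpr]
      split_ifs with h2
      · rw [← mk_embedding w] at h2
        rcases mk_eq_iff.1 h2 with h3 | h3
        · rw [h3, hδ1]
        · have h4 : φ = conjugate w.embedding := by
            rw [← h3]
            exact (star_star φ).symm
          rw [h4, circleCoord_conjugate, circleCoord_conjugate, hδ1]
      · rw [hδ2 φ (by rwa [mk_embedding])]
  choose n hn using hw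
  -- The exponent of each place is put on its distinguished embedding only; the conjugate embedding
  -- gets exponent 0.
  refine ⟨fun φ => if φ = (mk φ).embedding then n (mk φ) else 0, MonoidHom.ext fun c => ?_⟩
  rw [compactChar_apply]
  conv_rhs => rw [hprod c, map_prod]
  rw [← Finset.prod_fiberwise (f := fun φ : F →+* ℂ => circleCoord φ c ^
    (if φ = (mk φ).embedding then n (mk φ) else 0)) Finset.univ mk]
  refine Finset.prod_congr rfl fun w _ => ?_
  rw [hn, Finset.prod_eq_single_of_mem w.embedding (by simp), mk_embedding, if_pos rfl]
  intro φ hφ hne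
  have hφ' : mk φ = w := by simpa using hφ
  rw [hφ', if_neg hne, zpow_zero]

end CompactCharacters

/-! ### The Pontryagin dual of the oriented Arakelov class group -/

section OrientedDual

open NumberField NumberField.Units NumberField.InfinitePlace NumberField.ComplexEmbedding
  ComplexConjugate G0

section

variable (F : Type u) [Field F] [NumberField F]

/-- The roots of unity of `F` in the maximal compact subgroup. -/
def rootsToCompact : torsion F →* maxCompact F :=
  ((unitsToReal F).comp (torsion F).subtype).codRestrict (maxCompact F) fun ζ =>
    (unitsToReal_mem_maxCompact F ζ).2 ζ.2

theorem circleCoord_rootsToCompact (φ : F →+* ℂ) (ζ : torsion F) :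
    (circleCoord φ (rootsToCompact F ζ) : ℂ) = φ ((ζ : (𝓞 F)ˣ) : F) :=
  extendEmbedding_unitsToReal F φ _

/-- The character `ζ ↦ ∏_φ φ(ζ)^{n_φ}` of the group of roots of unity. -/
def rootChar : ((F →+* ℂ) → ℤ) →+ Additive (torsion F →* Circle) :=
  (MonoidHom.toAdditive (MonoidHom.compHom' (rootsToCompact F))).comp (compactChar F)

theorem rootChar_apply (n : (F →+* ℂ) → ℤ) (ζ : torsion F) :
    Additive.toMul (rootChar F n) ζ = Additive.toMul (compactChar F n) (rootsToCompact F ζ) := rfl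

/-- The exponents `n` such that `∏_φ φ(ζ)^{n_φ} = 1` for all roots of unity `ζ`. -/
abbrev rootKernel : Submodule ℤ ((F →+* ℂ) → ℤ) := LinearMap.ker (rootChar F).toIntLinearMap

/-- A single embedding is already a faithful character of the cyclic group μ_F, so its powers
exhaust all characters. -/
theorem rootChar_surjective : Function.Surjective (rootChar F) := by
  classical
  intro η
  obtain ⟨ζ, hζ⟩ := IsCyclic.exists_generator (α := torsion F)
  let φ : F →+* ℂ := Classical.arbitrary _
  let z : torsion F →* Circle := (circleCoord φ).comp (rootsToCompact F)
  have hz : Function.Injective z := fun a b h => by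
    have h1 : φ ((a : (𝓞 F)ˣ) : F) = φ ((b : (𝓞 F)ˣ) : F) := by
      rw [← circleCoord_rootsToCompact, ← circleCoord_rootsToCompact]
      exact congrArg Subtype.val h
    exact Subtype.ext (Units.ext (RingOfIntegers.ext (φ.injective h1)))
  have hord : IsPrimitiveRoot (z ζ : ℂ) (orderOf ζ) := by
    have h2 := IsPrimitiveRoot.orderOf (z ζ : ℂ)
    have h3 : orderOf (z ζ : ℂ) = orderOf ζ :=
      (orderOf_injective Circle.coeHom Circle.coe_injective (z ζ)).trans (orderOf_injective z hz ζ)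
    rwa [h3] at h2
  have : NeZero (orderOf ζ) := ⟨(orderOf_pos ζ).ne'⟩
  obtain ⟨k, -, hk⟩ := hord.eq_pow_of_pow_eq_one (ξ := ((Additive.toMul η : torsion F →* Circle) ζ : ℂ)) (by
    rw [← Circle.coe_pow, ← map_pow, pow_orderOf_eq_one, map_one, Circle.coe_one])
  have hk' : (Additive.toMul η : torsion F →* Circle) ζ = z ζ ^ k :=
    Circle.ext (hk.symm.trans (Circle.coe_pow _ _).symm)
  refine ⟨Pi.single φ (k : ℤ), MonoidHom.ext fun a => ?_⟩
  refine (rootChar_apply F _ a).trans ?_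
  rw [compactChar_apply, Finset.prod_eq_single φ (fun ψ _ hψ => by
    rw [Pi.single_eq_of_ne hψ, zpow_zero]) (fun h => absurd (Finset.mem_univ _) h),
    Pi.single_eq_same, zpow_natCast]
  obtain ⟨m, rfl⟩ := Subgroup.mem_zpowers_iff.1 (hζ a)
  change z (ζ ^ m) ^ k = (Additive.toMul η : torsion F →* Circle) (ζ ^ m)
  rw [map_zpow, map_zpow, hk', ← zpow_natCast, ← zpow_natCast, zpow_comm]

/-- The inclusion of the maximal compact subgroup, as a map to the oriented Arakelov class group. -/
def compactToPic : maxCompact F →* OrientedPic F :=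
  ((toPic F).comp (normOneToFibre F)).comp (Subgroup.inclusion (maxCompact_le_normOne F))

theorem continuous_compactToPic : Continuous (compactToPic F) :=
  (continuous_toPic F).comp ((continuous_normOneToFibre F).comp
    (Continuous.subtype_mk continuous_subtype_val _))

theorem toPic0_compactToPic (c : maxCompact F) : toPic0 F (compactToPic F c) = 1 :=
  (toPic0_eq_one_iff F _).2 ⟨_, c.2, rfl⟩

theorem compactToPic_rootsToCompact (ζ : torsion F) : compactToPic F (rootsToCompact F ζ) = 1 :=
  (toPic_normOneToFibre_eq_one_iff F _).2 ⟨ζ, rfl⟩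

/-- Restriction of characters of the oriented Arakelov class group to the maximal compact
subgroup. -/
def restrictCompact : Additive (PontryaginDual (OrientedPic F)) →+
    Additive (maxCompact F →* Circle) where
  toFun χ := Additive.ofMul
    ((show OrientedPic F →ₜ* Circle from Additive.toMul χ).toMonoidHom.comp (compactToPic F))
  map_zero' := rfl
  map_add' _ _ := rfl

/-- Inflation of characters of the Arakelov class group to the oriented Arakelov class group. -/
def inflatePic : Additive (PontryaginDual (Pic0 F)) →+
    Additive (PontryaginDual (OrientedPic F)) where
  toFun χ := Additive.ofMul (show PontryaginDual (OrientedPic F) from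
    (⟨(show Pic0 F →ₜ* Circle from Additive.toMul χ).toMonoidHom.comp (toPic0 F),
      (show Pic0 F →ₜ* Circle from Additive.toMul χ).continuous_toFun.comp (continuous_toPic0 F)⟩ :
      OrientedPic F →ₜ* Circle))
  map_zero' := rfl
  map_add' _ _ := rfl

theorem inflatePic_injective : Function.Injective (inflatePic F) := fun χ χ' h =>
  PontryaginDual.ext (A := Pic0 F) fun x => by
    obtain ⟨x, rfl⟩ := toPic0_surjective F x
    exact DFunLike.congr_fun
      (show (show OrientedPic F →ₜ* Circle from Additive.toMul (inflatePic F χ)) =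
        (show OrientedPic F →ₜ* Circle from Additive.toMul (inflatePic F χ')) from h) x

/-- Pic⁰ carries the quotient topology, so a continuous character trivial on the image of C descends
to a continuous one. -/
theorem restrictCompact_eq_zero_iff (χ) :
    restrictCompact F χ = 0 ↔ ∃ η, inflatePic F η = χ := by
  constructor
  · intro h
    let χ₀ : OrientedPic F →ₜ* Circle := Additive.toMul χ
    let η : Pic0 F →* Circle := QuotientGroup.lift (compactImage F) χ₀.toMonoidHom (by
      intro x hx
      obtain ⟨c, hc, rfl⟩ := (toPic0_eq_one_iff F x).1 ((QuotientGroup.eq_one_iff x).2 hx)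
      exact DFunLike.congr_fun (congrArg Additive.toMul h) (⟨c, hc⟩ : maxCompact F))
    have hη : Continuous η := (continuous_toPic0_iff F η).2 χ₀.continuous_toFun
    exact ⟨Additive.ofMul (show PontryaginDual (Pic0 F) from (⟨η, hη⟩ : Pic0 F →ₜ* Circle)),
      PontryaginDual.ext (A := OrientedPic F) fun _ => rfl⟩
  · rintro ⟨η, rfl⟩
    refine MonoidHom.ext fun c => ?_
    change (show Pic0 F →ₜ* Circle from Additive.toMul η) (toPic0 F (compactToPic F c)) = 1
    rw [toPic0_compactToPic]
    exact map_one (show Pic0 F →ₜ* Circle from Additive.toMul η)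

/-- The projection of `F_ℝˣ` onto its maximal compact subgroup. -/
theorem exists_compactPart : ∃ p : (RealAlgebra F)ˣ →* maxCompact F, Continuous p ∧
    ∀ c : maxCompact F, p c = c := by
  obtain ⟨s, hs, hsl⟩ := exists_realExp F
  -- Removing from x its totally positive part, the exponential of its logarithms, leaves an element
  -- all of whose absolute values are 1.
  let r : (RealAlgebra F)ˣ →* (RealAlgebra F)ˣ :=
    s.comp (AddMonoidHom.toMultiplicativeRight (realLog F))
  have hr : ∀ x, r x = s (Multiplicative.ofAdd (realLog F (Additive.ofMul x))) := fun _ => rfl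
  have hrc : Continuous r := hs.comp (continuous_ofAdd.comp (continuous_realLog F))
  refine ⟨(MonoidHom.id _ / r).codRestrict (maxCompact F) fun x => ?_,
    Continuous.subtype_mk (continuous_id.div' hrc) _, fun c => Subtype.ext ?_⟩
  · change (c : (RealAlgebra F)ˣ) / r c = c
    rw [hr, (mem_maxCompact_iff F _).1 c.2, ofAdd_zero, map_one, div_one]
  · rw [mem_maxCompact_iff]
    refine (map_sub (realLog F) (Additive.ofMul x) (Additive.ofMul (r x))).trans ?_
    rw [hr, hsl, sub_self]

/-- The characters of the maximal compact subgroup that come from the oriented Arakelov class group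
are those that are trivial on the roots of unity. -/
theorem range_restrictCompact_eq (ψ : Additive (maxCompact F →* Circle)) :
    (∃ χ, restrictCompact F χ = ψ) ↔ ∃ n : rootKernel F, compactChar F n = ψ := by
  constructor
  · rintro ⟨χ, rfl⟩
    let χ₀ : OrientedPic F →ₜ* Circle := Additive.toMul χ
    obtain ⟨n, hn⟩ := exists_compactChar_eq F (χ₀.toMonoidHom.comp (compactToPic F))
      (χ₀.continuous_toFun.comp (continuous_compactToPic F))
    refine ⟨⟨n, LinearMap.mem_ker.2 ?_⟩, congrArg Additive.ofMul hn⟩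
    refine MonoidHom.ext fun ζ => ?_
    refine (rootChar_apply F n ζ).trans ?_
    rw [hn, MonoidHom.comp_apply, compactToPic_rootsToCompact]
    exact map_one χ₀
  · rintro ⟨⟨n, hn⟩, rfl⟩
    obtain ⟨p, hp, hpc⟩ := exists_compactPart F
    -- Extending the character of C through the compact part need not make it trivial on units. On
    -- units it factors through U, by triviality on μ_F, and since U is free it lifts to a real form
    -- f. Dividing by the logarithmic character of f repairs the units without changing anything on
    -- C.
    let ν : (RealAlgebra F)ˣ →* Circle :=
      (Additive.toMul (compactChar F n) : maxCompact F →* Circle).comp p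
    have hν : Continuous ν := (continuous_compactChar F n).comp hp
    have hνc : ∀ c : maxCompact F, ν c = Additive.toMul (compactChar F n) c := fun c =>
      congrArg (Additive.toMul (compactChar F n) : maxCompact F →* Circle) (hpc c)
    let κ : ModTorsion F →* Circle := QuotientGroup.lift (torsion F) (ν.comp (unitsToReal F)) (by
      intro ζ hζ
      refine (hνc (rootsToCompact F ⟨ζ, hζ⟩)).trans ?_
      exact DFunLike.congr_fun (congrArg Additive.toMul (LinearMap.mem_ker.1 hn))
        (⟨ζ, hζ⟩ : torsion F))
    obtain ⟨f, hf⟩ := exists_circleExp_lift (MonoidHom.toAdditive κ)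
    obtain ⟨χ, hχ⟩ := exists_pic_character F (ν / logChar F f)
      (hν.div' (continuous_logChar F f)) (fun ε => by
        rw [MonoidHom.div_apply, div_eq_one]
        refine Additive.ofMul.injective ?_
        rw [logChar_unitsToReal, hf]
        rfl)
    refine ⟨Additive.ofMul χ, MonoidHom.ext fun c => ?_⟩
    refine (hχ (Subgroup.inclusion (maxCompact_le_normOne F) c)).trans ?_
    rw [MonoidHom.div_apply, Subgroup.coe_inclusion, logChar_maxCompact F f c.2, div_one]
    exact hνc c

end

variable (K : Type v) (F : Type u) [Field K] [Field F] [Algebra K F]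

/-- The Galois module of functions on the embeddings of `F`. -/
def embeddingRep : Representation ℤ Gal(F/K) ((F →+* ℂ) → ℤ) where
  toFun g := LinearMap.funLeft ℤ ℤ fun φ => φ.comp (g : F →+* F)
  map_one' := LinearMap.ext fun _ => rfl
  map_mul' _ _ := LinearMap.ext fun _ => rfl

variable {K F} in
/-- The permutation of the embeddings given by a Galois automorphism. -/
def compEquiv (g : Gal(F/K)) : (F →+* ℂ) ≃ (F →+* ℂ) where
  toFun φ := φ.comp (g : F →+* F)
  invFun φ := φ.comp ((g⁻¹ : Gal(F/K)) : F →+* F)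
  left_inv φ := RingHom.ext fun x => congrArg φ (g.apply_symm_apply x)
  right_inv φ := RingHom.ext fun x => congrArg φ (g.symm_apply_apply x)

theorem placeExponent_smul (g : Gal(F/K)) (m : MonoidAlgebra ℤ (InfinitePlace F)) :
    placeExponent F (placesRep K F g m) = embeddingRep K F g (placeExponent F m) := by
  classical
  funext φ
  change _ = placeExponent F m (φ.comp (g : F →+* F))
  rw [placeExponent_apply, placeExponent_apply, Representation.coeff_ofMulAction]
  have h1 : IsReal (φ.comp (g : F →+* F)) ↔ IsReal φ :=
    ComplexEmbedding.isReal_comp_iff (f := g.toRingEquiv)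
  rw [if_congr h1 rfl rfl]
  rfl

variable [NumberField F]

instance : MulDistribMulAction Gal(F/K) (maxCompact F) :=
  subgroupAction (maxCompact F) smul_mem_maxCompact

theorem compactToPic_smul (g : Gal(F/K)) (c : maxCompact F) :
    compactToPic F (g • c) = g • compactToPic F c :=
  congrArg (toPic F) (normOneToFibre_smul g (Subgroup.inclusion (maxCompact_le_normOne F) c))

theorem circleCoord_smul (g : Gal(F/K)) (φ : F →+* ℂ) (c : maxCompact F) :
    circleCoord φ (g • c) = circleCoord (φ.comp (g : F →+* F)) c :=
  Circle.ext (extendEmbedding_smul φ g _)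

/-- Reindex the product over embeddings by φ ↦ φ ∘ g. -/
theorem compactChar_smul (g : Gal(F/K)) (n : (F →+* ℂ) → ℤ) (c : maxCompact F) :
    Additive.toMul (compactChar F (embeddingRep K F g n)) c =
      Additive.toMul (compactChar F n) (g⁻¹ • c) := by
  rw [compactChar_apply, compactChar_apply]
  refine Fintype.prod_equiv (compEquiv g) _ _ fun φ => ?_
  rw [circleCoord_smul]
  change circleCoord φ c ^ _ = circleCoord ((compEquiv g).symm (compEquiv g φ)) c ^ _
  rw [Equiv.symm_apply_apply]
  rfl

theorem rootChar_smul (g : Gal(F/K)) (n : (F →+* ℂ) → ℤ) :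
    rootChar F (embeddingRep K F g n) = charRep Gal(F/K) (torsion F) g (rootChar F n) :=
  MonoidHom.ext fun ζ => compactChar_smul K F g n (rootsToCompact F ζ)

/-- The Galois module of exponents that are trivial on the roots of unity. -/
abbrev rootKernelRep : Representation ℤ Gal(F/K) (rootKernel F) :=
  (embeddingRep K F).subrepresentation (rootKernel F) fun g n hn => LinearMap.mem_ker.2 (by
    refine (rootChar_smul K F g n).trans ?_
    rw [show rootChar F n = 0 from LinearMap.mem_ker.1 hn, map_zero])

theorem clsRep_embeddingRep [Finite Gal(F/K)]
    [Module.Finite (MonoidAlgebra ℤ Gal(F/K)) (charRep Gal(F/K) (torsion F)).asModule] :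
    clsRep (embeddingRep K F) =
      clsRep (rootKernelRep K F) + clsRep (charRep Gal(F/K) (torsion F)) := by
  refine clsRep_of_exact (rootKernel F).subtype.toAddMonoidHom (rootChar F) (fun _ _ => rfl)
    (fun g n => rootChar_smul K F g n) Subtype.val_injective (fun n => ?_) (rootChar_surjective F)
  exact ⟨fun h => ⟨⟨n, LinearMap.mem_ker.2 h⟩, rfl⟩, by
    rintro ⟨a, rfl⟩
    exact LinearMap.mem_ker.1 a.2⟩

/-- The class of the Pontryagin dual of the oriented Arakelov class group. -/
theorem exists_clsRep_orientedArRep [Finite Gal(F/K)]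
    [Module.Finite (MonoidAlgebra ℤ Gal(F/K)) (arRep K F).asModule] :
    ∃ _ : Module.Finite (MonoidAlgebra ℤ Gal(F/K)) (orientedArRep K F).asModule,
      clsRep (orientedArRep K F) + clsRep (placesRep K F) =
        clsRep (rootKernelRep K F) + clsRep (arRep K F) := by
  -- Inside the characters of C, those coming from the oriented class group are also the image of
  -- the exponents that are trivial on roots of unity. One kernel consists of the characters of
  -- Pic⁰, the other of ℤ[S_∞].
  refine clsRep_of_range_eq (ρA := orientedArRep K F) (ρB := rootKernelRep K F)
    (ρK := arRep K F) (ρL := placesRep K F) (ρE := charRep Gal(F/K) (maxCompact F))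
    (inflatePic F) (restrictCompact F)
    ((placeExponent F).codRestrict (rootKernel F) fun m => ?_)
    ((compactChar F).comp (rootKernel F).subtype.toAddMonoidHom)
    (fun _ _ => rfl)
    (fun g χ => MonoidHom.ext fun c => congrArg
      (show OrientedPic F →ₜ* Circle from Additive.toMul χ) (compactToPic_smul K F g⁻¹ c).symm)
    (fun g m => Subtype.ext (placeExponent_smul K F g m))
    (fun g n => MonoidHom.ext fun c => compactChar_smul K F g n c)
    (inflatePic_injective F) (restrictCompact_eq_zero_iff F)
    (fun m m' h => placeExponent_injective F (congrArg Subtype.val h)) (fun n => ?_)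
    (fun ψ => range_restrictCompact_eq F ψ)
  · refine LinearMap.mem_ker.2 (MonoidHom.ext fun ζ => ?_)
    exact DFunLike.congr_fun (congrArg Additive.toMul
      ((compactChar_eq_zero_iff F (placeExponent F m)).2 ⟨m, rfl⟩)) (rootsToCompact F ζ)
  · refine (compactChar_eq_zero_iff F n).trans ?_
    exact ⟨fun ⟨m, hm⟩ => ⟨m, Subtype.ext hm⟩, fun ⟨m, hm⟩ => ⟨m, congrArg Subtype.val hm⟩⟩

end OrientedDual

/-! ### Comparison of classes -/

section Comparison

open NumberField NumberField.Units NumberField.ComplexEmbedding G0 LatticeTrace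

variable (K : Type v) (F : Type u) [Field K] [NumberField K] [Field F] [Algebra K F]

/-- The embeddings of `F` form a free `G`-set with `[K : ℚ]` orbits. -/
theorem exists_embeddings_equiv [IsGalois K F] : ∃ e : Fin (Module.finrank ℚ K) × Gal(F/K) ≃ (F →+* ℂ),
    ∀ i g h, e (i, g⁻¹ * h) = (e (i, h)).comp (g : F →+* F) := by
  let ι : Fin (Module.finrank ℚ K) ≃ (K →+* ℂ) :=
    (Fintype.equivFinOfCardEq (Embeddings.card K ℂ)).symm
  let τ : Fin (Module.finrank ℚ K) → (F →+* ℂ) := fun i => ComplexEmbedding.lift F (ι i)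
  have hτ : ∀ i, (τ i).comp (algebraMap K F) = ι i := fun i => ComplexEmbedding.lift_comp_algebraMap F (ι i)
  -- One extension τ i is fixed for each embedding of K. Composing with the inverse of the group
  -- element turns the right action on embeddings into left translation.
  let f : Fin (Module.finrank ℚ K) × Gal(F/K) → (F →+* ℂ) := fun x =>
    (τ x.1).comp ((x.2⁻¹ : Gal(F/K)) : F →+* F)
  have hf : ∀ x, (f x).comp (algebraMap K F) = ι x.1 := fun x => by
    rw [← hτ]
    exact RingHom.ext fun a => congrArg (τ x.1) ((x.2⁻¹).commutes a)
  have hbij : Function.Bijective f := by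
    constructor
    · rintro ⟨i, g⟩ ⟨j, h⟩ hij
      obtain rfl : i = j := ι.injective (by rw [← hf (i, g), hij, hf])
      refine Prod.ext rfl (inv_injective (AlgEquiv.ext fun a => (τ i).injective ?_))
      exact RingHom.congr_fun hij a
    · intro φ
      -- As F/K is Galois, two embeddings with the same restriction to K differ by an automorphism.
      obtain ⟨σ, hσ⟩ := exists_comp_symm_eq_of_comp_eq (k := K)
        (τ (ι.symm (φ.comp (algebraMap K F)))) φ (by rw [hτ, Equiv.apply_symm_apply])
      exact ⟨(_, σ), hσ⟩
  refine ⟨Equiv.ofBijective f hbij, fun i g h => RingHom.ext fun a => ?_⟩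
  change τ i ((g⁻¹ * h)⁻¹ a) = τ i (h⁻¹ (g a))
  rw [mul_inv_rev, inv_inv]
  rfl

variable [NumberField F]

theorem clsRep_embeddingRep_eq [IsGalois K F] : clsRep (embeddingRep K F) =
    Module.finrank ℚ K • cls (MonoidAlgebra ℤ Gal(F/K)) (MonoidAlgebra ℤ Gal(F/K)) := by
  obtain ⟨e, he⟩ := exists_embeddings_equiv K F
  rw [← cls_fin_fun, ← clsRep_modRep]
  let f : ((F →+* ℂ) → ℤ) ≃+ (Fin (Module.finrank ℚ K) → MonoidAlgebra ℤ Gal(F/K)) :=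
    { toFun := fun n i => MonoidAlgebra.ofCoeff (Finsupp.equivFunOnFinite.symm fun g => n (e (i, g)))
      invFun := fun x φ => (x (e.symm φ).1).coeff (e.symm φ).2
      left_inv := fun n => funext fun φ => congrArg n (e.apply_symm_apply φ)
      right_inv := fun x => funext fun i => MonoidAlgebra.ext (Finsupp.ext fun g => by
        change (x (e.symm (e (i, g))).1).coeff (e.symm (e (i, g))).2 = _
        rw [Equiv.symm_apply_apply])
      map_add' := fun n n' => funext fun i => MonoidAlgebra.ext (Finsupp.ext fun g => rfl) }
  refine clsRep_congr f fun g n => ?_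
  rw [modRep_apply]
  refine funext fun i => MonoidAlgebra.ext (Finsupp.ext fun h => ?_)
  rw [Pi.smul_apply, smul_eq_mul, MonoidAlgebra.of_apply, MonoidAlgebra.coeff_single_mul_apply,
    one_mul]
  change n ((e (i, h)).comp (g : F →+* F)) = n (e (i, g⁻¹ * h))
  rw [he]

/-- Permutation lattices and ℤ are fixed by σ, and U is replaced by its dual. The two finite terms
are kept in this form until they are rewritten as negatives of their character groups. -/
theorem sigma_Psi : sigma Gal(F/K) (Psi K F) =
    sigma Gal(F/K) (clsRep (rootsRep K F)) + clsRep (unitsModTorsionRep K F).dual -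
      (clsRep (placesRep K F) - clsRep (trivialRep K F)) -
        sigma Gal(F/K) (clsRep (clRep K F)) := by
  have hx : clsRep (xRep K F) = clsRep (placesRep K F) - clsRep (trivialRep K F) := by
    rw [clsRep_placesRep, add_sub_cancel_right]
  have hp : sigma Gal(F/K) (clsRep (placesRep K F)) = clsRep (placesRep K F) :=
    sigma_permRep (InfinitePlace F)
  have ht : sigma Gal(F/K) (clsRep (trivialRep K F)) = clsRep (trivialRep K F) := sigma_trivial
  rw [Psi, clsRep_unitsRep, hx, map_sub, map_sub, map_sub, map_add, hp, ht, sigma_clsRep (unitsModTorsionRep K F)]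

end Comparison

end

theorem mainTheorem5 (K : Type v) (F : Type u) [Field K] [NumberField K] [Field F] [NumberField F]
    [Algebra K F] [IsGalois K F] :
    ∃ (_ : Module.Finite (MonoidAlgebra ℤ Gal(F/K)) (orientedArRep K F).asModule)
      (_ : Module.Finite (MonoidAlgebra ℤ Gal(F/K)) (arRep K F).asModule),
      (MainConjecture K F ↔ Psi K F = 0) ∧
      Psi K F ∈ AddCommGroup.torsion (G0 (MonoidAlgebra ℤ Gal(F/K))) := by
  obtain ⟨_, hcl⟩ := exists_finite_charRep (G := Gal(F/K)) (Cl F)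
  obtain ⟨_, hroots⟩ := exists_finite_charRep (G := Gal(F/K)) (NumberField.Units.torsion F)
  obtain ⟨hAr, har⟩ := exists_clsRep_arRep K F
  obtain ⟨hOr, hor⟩ := exists_clsRep_orientedArRep K F
  refine ⟨hOr, hAr, ?_, Psi_mem_torsion K F⟩
  have hP := clsRep_embeddingRep K F
  rw [clsRep_embeddingRep_eq] at hP
  have hψ := sigma_Psi K F
  rw [hcl, hroots] at hψ
  -- σ is an involution, hence injective.
  have hΨ : Psi K F = 0 ↔ G0.sigma Gal(F/K) (Psi K F) = 0 :=
    ⟨fun h => by rw [h, map_zero], fun h => by rw [← G0.sigma_sigma (Psi K F), h, map_zero]⟩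
  -- The difference of the two sides of (b) is [U*] + [Cl_F^∨] - [ℤ[S_∞]] + [ℤ] - [μ_F^∨], which is
  -- σ(Ψ).
  have hb : ArakelovEquality K F ↔ G0.sigma Gal(F/K) (Psi K F) = 0 := by
    rw [ArakelovEquality, har, hroots, hψ, ← sub_eq_zero]
    refine Eq.congr_left ?_
    abel
  -- Replacing [N] by d[ℤ[G]] - [μ_F^∨], the free part cancels against the right-hand side of (a),
  -- and the same expression remains.
  have ha : OrientedArakelovEquality K F ↔ G0.sigma Gal(F/K) (Psi K F) = 0 := by
    rw [OrientedArakelovEquality, eq_sub_of_add_eq hor, har, hP, hψ, ← sub_eq_zero]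
    refine Eq.congr_left ?_
    abel
  rw [MainConjecture, ha, hb, and_self, hΨ]
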